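/- **Setting.** Let $y_t=\mu_t+e_t$, $\mu_t=\sum_{j\ge1}\theta_jx_{tj}$, $t=1,\dots,n$, where $\sum_j|\theta_j|<\infty$, $\sup_{t,j}\mathrm E(x_{tj}^2)<\infty$, and $\{e_t\}_{t\in\mathbb Z}$ is a (weakly) stationary process with mean zero and finite variance, independent of $\{x_{tj}\}$. Fix a positive integer $N$ and a real $S>4N$, and assume: (1) The autocovariances $\gamma_j=\mathrm E(e_te_{t+j})$ satisfy $\sum_{j\in\mathbb Z}\gamma_j^2<\infty$, and $e_t=\sum_{k\ge0}\beta_k\alpha_{t-k}$ with $\beta_0=1$, where $\alpha_t$ is $\mathcal F_t$-measurable for an increasing family of $\sigma$-fields $(\mathcal F_t)_{t\in\mathbb Z}$ and, almost surely, for all $t$, $\mathrm E(\alpha_t\mid\mathcal F_{t-1})=0$, $\mathrm E(\alpha_t^2\mid\mathcal F_{t-1})=\sigma_\alpha^2$ and $\mathrm E(|\alpha_t|^S\mid\mathcal F_{t-1})\le C_S$ for a constant $C_S<\infty$. (2) $\sum_{j}|\beta_j|<\infty$, and the spectral density $\frac{\sigma_\alpha^2}{2\pi}\big|\sum_{j\ge0}\beta_je^{-ij\lambda}\big|^2$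 is nonzero for all $-\pi<\lambda\le\pi$. Write $Y_n=(y_1,\dots,y_n)'$, $\mathbf e_n=(e_1,\dots,e_n)'$, $\boldsymbol\mu_n=(\mu_1,\dots,\mu_n)'$ and $\Sigma_n=\mathrm E(\mathbf e_n\mathbf e_n')$. For all sufficiently large $n$ let $M=M_n\ge1$ candidate models be given, the $m$-th using the first $k_m=k_{m,n}$ regressors, with $1\le k_1<\dots<k_M<n$, and let $X_m=(x_{tj})_{1\le t\le n,\,1\le j\le k_m}$, where $X_M$ is almost surely of full rank. Fix $0<\underline\delta<1/N$ and let $\mathcal H_N$ be the set of weight vectors $\boldsymbol w=(w_1,\dots,w_M)'$ with $\sum_mw_m=1$ that have at least $1$ and at most $N$ nonzero components, all nonzero components lying in $[\underline\delta,1]$. Let $$L_n^*(\boldsymbol w)=(\hat{\boldsymbol\mu}_n(\boldsymbol w)-\boldsymbol\mu_n)'\Sigma_n^{-1}(\hat{\boldsymbol\mu}_n(\boldsymbol w)-\boldsymbol\mu_n),\qquad \hat{\boldsymbol\mu}_n(\boldsymbol w)=\sum_{m=1}^Mw_mX_m(X_m'\Sigma_n^{-1}X_m)^{-1}X_m'\Sigma_n^{-1}Y_n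 .$$ Given $n\times n$ random matrices $\hat\Sigma_n^{-1}$ (estimates of $\Sigma_n^{-1}$), let $\hat{\boldsymbol\mu}_n^*(\boldsymbol w)=\sum_{m=1}^Mw_mX_m(X_m'\hat\Sigma_n^{-1}X_m)^{-1}X_m'\hat\Sigma_n^{-1}Y_n$, $$L_n^F(\boldsymbol w)=(\hat{\boldsymbol\mu}_n^*(\boldsymbol w)-\boldsymbol\mu_n)'\Sigma_n^{-1}(\hat{\boldsymbol\mu}_n^*(\boldsymbol w)-\boldsymbol\mu_n),\qquad \hat C_n^*(\boldsymbol w)=(Y_n-\hat{\boldsymbol\mu}_n^*(\boldsymbol w))'\hat\Sigma_n^{-1}(Y_n-\hat{\boldsymbol\mu}_n^*(\boldsymbol w))+2\sum_{m=1}^Mw_mk_m,$$ and let $\hat{\boldsymbol w}_n$ be a minimizer of $\hat C_n^*$ over $\mathcal H_N$ (almost surely, for all large $n$). Finally let $$k_n^*=\min_{1\le m\le M}\Big\{\boldsymbol\mu_n'\Sigma_n^{-1/2}(I-P_m)\Sigma_n^{-1/2}\boldsymbol\mu_n+k_m\Big\},\qquad P_m=\Sigma_n^{-1/2}X_m(X_m'\Sigma_n^{-1}X_m)^{-1}X_m'\Sigma_n^{-1/2}.$$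 **Theorem.** Suppose that $k_n^*\to\infty$ almost surely, that there are positive numbers $b_n=o(n^{1/2})$ with $n\|\hat\Sigma_n^{-1}-\Sigma_n^{-1}\|^2=O_p(b_n^2)$ in spectral norm, and that for some $\theta$ with $2N/S<\theta<1/2$, $$\lim_{n\to\infty}\frac{b_n^2}{(k_n^*)^{1-2\theta}}=0\quad\text{almost surely}.$$ Then $$\frac{L_n^F(\hat{\boldsymbol w}_n)}{\inf_{\boldsymbol w\in\mathcal H_N}L_n^*(\boldsymbol w)}\longrightarrow1\quad\text{in probability}.$$ -/

import Mathlib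

open MeasureTheory ProbabilityTheory Filter Topology

noncomputable section

/-! Times and regressor indices are numbered from `0`: a sample of size `n` consists of the times
`t = 0, …, n - 1`, and the regressors are `x t 0, x t 1, …`. -/

/-- Spectral norm of a square real matrix: the operator norm for the Euclidean norm. -/
def spectralNorm2 {n : ℕ} (A : Matrix (Fin n) (Fin n) ℝ) : ℝ :=
  ‖Matrix.toEuclideanCLM (n := Fin n) (𝕜 := ℝ) A‖

/-- `Z n = O_p(a n)`: for every `ε > 0` there is a constant `C` such that
`P (|Z n| > C * a n) ≤ ε` for all large `n`. -/
def IsBigOInProbability {Ω : Type*} [MeasurableSpace Ω] (P : Measure Ω)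
    (Z : ℕ → Ω → ℝ) (a : ℕ → ℝ) : Prop :=
  ∀ ε : ℝ, 0 < ε → ∃ C : ℝ, ∀ᶠ n in atTop,
    P {ω | C * a n < |Z n ω|} ≤ ENNReal.ofReal ε

/-! ### The errors -/

/-- A (weakly) stationary process with zero mean and finite variance. -/
structure IsCenteredStationary {Ω : Type*} [MeasurableSpace Ω] (P : Measure Ω)
    (e : ℤ → Ω → ℝ) : Prop where
  measurable : ∀ t, Measurable (e t)
  memLp : ∀ t, MemLp (e t) 2 P
  mean_zero : ∀ t, ∫ ω, e t ω ∂P = 0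
  cov_shift : ∀ s t h : ℤ, ∫ ω, e s ω * e (s + h) ω ∂P = ∫ ω, e t ω * e (t + h) ω ∂P

/-- Autocovariance function `γ_j = E (e_t e_{t+j})` of a stationary process. -/
def autocov {Ω : Type*} [MeasurableSpace Ω] (P : Measure Ω) (e : ℤ → Ω → ℝ) (j : ℤ) : ℝ :=
  ∫ ω, e 0 ω * e j ω ∂P

/-- The errors `e` are stationary with square summable autocovariances and have the linear
representation `e_t = ∑_{k ≥ 0} β_k α_{t-k}`, `β_0 = 1`, in terms of innovations `α` that are
martingale differences with constant conditional variance `σ²` and conditional moments of order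
`S` bounded by a constant. -/
structure IsLinearErrorProcess {Ω : Type*} [MeasurableSpace Ω] (P : Measure Ω)
    (ℱ : Filtration ℤ (inferInstance : MeasurableSpace Ω)) (e α : ℤ → Ω → ℝ) (β : ℕ → ℝ)
    (σ S : ℝ) : Prop where
  stationary : IsCenteredStationary P e
  summable_autocov_sq : Summable fun j : ℤ => autocov P e j ^ 2
  beta_zero : β 0 = 1
  linear : ∀ t : ℤ, ∀ᵐ ω ∂P, HasSum (fun k : ℕ => β k * α (t - k) ω) (e t ω)
  adapted : ∀ t, Measurable[ℱ t] (α t)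
  /-- Integrability, without which the conditional moments below would be meaningless. -/
  integrable_rpow : ∀ t, Integrable (fun ω => |α t ω| ^ S) P
  condMean : ∀ t : ℤ, P[α t | ℱ (t - 1)] =ᵐ[P] 0
  condVar : ∀ t : ℤ, P[fun ω => α t ω ^ 2 | ℱ (t - 1)] =ᵐ[P] fun _ => σ ^ 2
  condMoment : ∃ C : ℝ, 0 < C ∧
    ∀ᵐ ω ∂P, ∀ t : ℤ, (P[fun ω' => |α t ω'| ^ S | ℱ (t - 1)]) ω ≤ C

/-- Spectral density `f(lam) = (σ² / 2π) |∑_{j ≥ 0} β_j e^{-i j lam}|²` of the linear process. -/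
def spectralDensity (σ : ℝ) (β : ℕ → ℝ) (lam : ℝ) : ℝ :=
  σ ^ 2 / (2 * Real.pi) *
    ‖∑' j : ℕ, (β j : ℂ) * Complex.exp (-(Complex.I * (j : ℂ) * (lam : ℂ)))‖ ^ 2

/-- Nonvanishing spectral density and absolutely summable coefficients. -/
structure IsSpectrallyRegular (σ : ℝ) (β : ℕ → ℝ) : Prop where
  density_ne_zero : ∀ lam : ℝ, -Real.pi < lam → lam ≤ Real.pi → spectralDensity σ β lam ≠ 0
  summable_abs : Summable fun j => |β j|

/-- `Σ_n = E (e_n e_n')`. -/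
def errorCov {Ω : Type*} [MeasurableSpace Ω] (P : Measure Ω) (e : ℤ → Ω → ℝ) (n : ℕ) :
    Matrix (Fin n) (Fin n) ℝ :=
  Matrix.of fun s t => ∫ ω, e (s : ℕ) ω * e (t : ℕ) ω ∂P

/-! ### The regression -/

/-- Regressors with bounded second moments, absolutely summable coefficients, and errors
independent of the regressors. -/
structure IsRegression {Ω : Type*} [MeasurableSpace Ω] (P : Measure Ω)
    (x : ℕ → ℕ → Ω → ℝ) (θ : ℕ → ℝ) (e : ℤ → Ω → ℝ) : Prop where
  measurable : ∀ t j, Measurable (x t j)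
  memLp : ∀ t j, MemLp (x t j) 2 P
  bounded_moment : ∃ K : ℝ, ∀ t j, ∫ ω, x t j ω ^ 2 ∂P ≤ K
  summable_abs : Summable fun j => |θ j|
  indep : IndepFun (fun ω (t : ℤ) => e t ω) (fun ω (p : ℕ × ℕ) => x p.1 p.2 ω) P

/-- `μ_n = (μ_t)` with `μ_t = ∑_j θ_j x_{tj}`; the series converges absolutely almost surely when
`IsRegression` holds. -/
def meanVec {Ω : Type*} (x : ℕ → ℕ → Ω → ℝ) (θ : ℕ → ℝ) (n : ℕ) (ω : Ω) : Fin n → ℝ :=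
  fun t => ∑' j : ℕ, θ j * x t j ω

/-- `Y_n = μ_n + e_n`. -/
def responseVec {Ω : Type*} (x : ℕ → ℕ → Ω → ℝ) (θ : ℕ → ℝ) (e : ℤ → Ω → ℝ) (n : ℕ) (ω : Ω) :
    Fin n → ℝ :=
  fun t => meanVec x θ n ω t + e (t : ℕ) ω

/-- The design matrix of the first `k` regressors. -/
def designMat {Ω : Type*} (x : ℕ → ℕ → Ω → ℝ) (n k : ℕ) (ω : Ω) : Matrix (Fin n) (Fin k) ℝ :=
  Matrix.of fun t j => x t j ω

/-- `M n ≥ 1` nested candidate models with `1 ≤ k_1 < ⋯ < k_M < n` regressors, the design matrices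
having almost surely full column rank (for all sufficiently large sample sizes `n`). -/
structure IsCandidateFamily {Ω : Type*} [MeasurableSpace Ω] (P : Measure Ω)
    (x : ℕ → ℕ → Ω → ℝ) (M : ℕ → ℕ) (k : (n : ℕ) → Fin (M n) → ℕ) : Prop where
  nonempty : ∀ᶠ n in atTop, 1 ≤ M n
  pos : ∀ᶠ n in atTop, ∀ m, 1 ≤ k n m
  strictMono : ∀ᶠ n in atTop, StrictMono (k n)
  lt : ∀ᶠ n in atTop, ∀ m, k n m < n
  fullRank : ∀ᶠ n in atTop, ∀ᵐ ω ∂P, ∀ m, (designMat x n (k n m) ω).rank = k n m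

/-! ### Generalized least squares averaging

Here `W` is a weight matrix: the inverse covariance matrix or an estimate of it. -/

/-- `X (X' W X)⁻¹ X' W`. -/
def glsHat {n k : ℕ} (X : Matrix (Fin n) (Fin k) ℝ) (W : Matrix (Fin n) (Fin n) ℝ) :
    Matrix (Fin n) (Fin n) ℝ :=
  X * (X.transpose * W * X)⁻¹ * X.transpose * W

/-- The averaging estimator `(∑_m w_m X_m (X_m' W X_m)⁻¹ X_m' W) Y` of `μ_n`. -/
def glsAverage {n M : ℕ} {k : Fin M → ℕ} (X : (m : Fin M) → Matrix (Fin n) (Fin (k m)) ℝ)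
    (W : Matrix (Fin n) (Fin n) ℝ) (Y : Fin n → ℝ) (w : Fin M → ℝ) : Fin n → ℝ :=
  (∑ m, w m • glsHat (X m) W).mulVec Y

/-- The quadratic form `v' A v`. -/
def quadForm {n : ℕ} (A : Matrix (Fin n) (Fin n) ℝ) (v : Fin n → ℝ) : ℝ :=
  v ⬝ᵥ A.mulVec v

/-- The criterion `(Y - μ̂(w))' W (Y - μ̂(w)) + 2 ∑_m w_m k_m`, with `μ̂(w)` the averaging estimator
that uses `W`. -/
def averagingCriterion {n M : ℕ} {k : Fin M → ℕ}
    (X : (m : Fin M) → Matrix (Fin n) (Fin (k m)) ℝ)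
    (W : Matrix (Fin n) (Fin n) ℝ) (Y : Fin n → ℝ) (w : Fin M → ℝ) : ℝ :=
  quadForm W (Y - glsAverage X W Y w) + 2 * ∑ m, w m * (k m : ℝ)

/-- The generalized squared error `(μ̂(w) - μ)' V (μ̂(w) - μ)`, where the averaging estimator `μ̂(w)`
uses `W` (and `V` is the true inverse covariance matrix). -/
def averagingLoss {n M : ℕ} {k : Fin M → ℕ}
    (X : (m : Fin M) → Matrix (Fin n) (Fin (k m)) ℝ)
    (V W : Matrix (Fin n) (Fin n) ℝ) (Y μ : Fin n → ℝ) (w : Fin M → ℝ) : ℝ :=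
  quadForm V (glsAverage X W Y w - μ)

/-- Weight vectors with exactly `l` nonzero components, all of which lie in `[δ, 1]`, and with
sum `1`. -/
def sparseWeightsEq (M l : ℕ) (δ : ℝ) : Set (Fin M → ℝ) :=
  {w | (∀ i, w i ≠ 0 → δ ≤ w i ∧ w i ≤ 1) ∧ {i | w i ≠ 0}.ncard = l ∧ ∑ i, w i = 1}

/-- The weight set `H_N`: between `1` and `N` nonzero components, all in `[δ, 1]`, sum `1`. -/
def sparseWeights (M N : ℕ) (δ : ℝ) : Set (Fin M → ℝ) :=
  ⋃ l ∈ Set.Icc 1 N, sparseWeightsEq M l δ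

open scoped MatrixOrder in
/-- `Σ^{-1/2}`: the positive semidefinite square root of `Σ⁻¹`. -/
def invSqrt {n : ℕ} (Sig : Matrix (Fin n) (Fin n) ℝ) : Matrix (Fin n) (Fin n) ℝ :=
  CFC.sqrt Sig⁻¹

/-- `P = Σ^{-1/2} X (X' Σ⁻¹ X)⁻¹ X' Σ^{-1/2}`. -/
def whitenedProj {n k : ℕ} (Sig : Matrix (Fin n) (Fin n) ℝ) (X : Matrix (Fin n) (Fin k) ℝ) :
    Matrix (Fin n) (Fin n) ℝ :=
  invSqrt Sig * X * (X.transpose * Sig⁻¹ * X)⁻¹ * X.transpose * invSqrt Sig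

/-- `D(X) = μ' Σ^{-1/2} (I - P) Σ^{-1/2} μ + k`. -/
def modelRisk {n k : ℕ} (Sig : Matrix (Fin n) (Fin n) ℝ) (X : Matrix (Fin n) (Fin k) ℝ)
    (μ : Fin n → ℝ) : ℝ :=
  quadForm (invSqrt Sig * (1 - whitenedProj Sig X) * invSqrt Sig) μ + (k : ℝ)

/-- `k*_n = min_m D_n(m)`, a random variable. -/
def minModelRisk {Ω : Type*} [MeasurableSpace Ω] (P : Measure Ω)
    (x : ℕ → ℕ → Ω → ℝ) (θ : ℕ → ℝ) (e : ℤ → Ω → ℝ) (M : ℕ → ℕ) (k : (n : ℕ) → Fin (M n) → ℕ)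
    (n : ℕ) (ω : Ω) : ℝ :=
  ⨅ m : Fin (M n), modelRisk (errorCov P e n) (designMat x n (k n m) ω) (meanVec x θ n ω)

/-- The loss `L*_n(w)` of the infeasible average, which uses the true `Σ_n⁻¹`. -/
def infeasibleLoss {Ω : Type*} [MeasurableSpace Ω] (P : Measure Ω)
    (x : ℕ → ℕ → Ω → ℝ) (θ : ℕ → ℝ) (e : ℤ → Ω → ℝ) (M : ℕ → ℕ) (k : (n : ℕ) → Fin (M n) → ℕ)
    (n : ℕ) (ω : Ω) (w : Fin (M n) → ℝ) : ℝ :=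
  averagingLoss (fun m => designMat x n (k n m) ω) (errorCov P e n)⁻¹ (errorCov P e n)⁻¹
    (responseVec x θ e n ω) (meanVec x θ n ω) w

/-- The loss `L^F_n(w)` of the feasible average, which uses the estimate `W n` of `Σ_n⁻¹`. -/
def feasibleLoss {Ω : Type*} [MeasurableSpace Ω] (P : Measure Ω)
    (x : ℕ → ℕ → Ω → ℝ) (θ : ℕ → ℝ) (e : ℤ → Ω → ℝ) (M : ℕ → ℕ) (k : (n : ℕ) → Fin (M n) → ℕ)
    (W : (n : ℕ) → Ω → Matrix (Fin n) (Fin n) ℝ)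
    (n : ℕ) (ω : Ω) (w : Fin (M n) → ℝ) : ℝ :=
  averagingLoss (fun m => designMat x n (k n m) ω) (errorCov P e n)⁻¹ (W n ω)
    (responseVec x θ e n ω) (meanVec x θ n ω) w

/-- The feasible criterion (FAMMA), which uses the estimate `W n` of `Σ_n⁻¹` throughout. -/
def feasibleCriterion {Ω : Type*}
    (x : ℕ → ℕ → Ω → ℝ) (θ : ℕ → ℝ) (e : ℤ → Ω → ℝ) (M : ℕ → ℕ) (k : (n : ℕ) → Fin (M n) → ℕ)
    (W : (n : ℕ) → Ω → Matrix (Fin n) (Fin n) ℝ)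
    (n : ℕ) (ω : Ω) (w : Fin (M n) → ℝ) : ℝ :=
  averagingCriterion (fun m => designMat x n (k n m) ω) (W n ω) (responseVec x θ e n ω) w

end

/-! Multiplication by `Σ^{-1/2}` turns the infeasible fits into orthogonal projections `P_m` onto
nested subspaces. In these coordinates, with `μ` and `e` whitened, `L*(w) = ‖∑ w_m P_m (μ + e) -
μ‖²`, and an estimate `W` of `Σ⁻¹` acts as `1 + Δ` with `Δ = Σ^{1/2} (W - Σ⁻¹) Σ^{1/2}`. Let `D_m =
‖(1 - P_m) μ‖² + k_m`, so that `k* = min D_m`.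

The deterministic core is `IsRegularAveraging.loss_bounds`. Suppose that `|‖P_m e‖² - k_m|` and
`|⟪(1 - P_m) μ, e⟫|` are at most `ε D_m` for all `m`, that `‖Δ‖ ≤ ε`, and that `‖Δ‖ ‖e‖ ≤ ε √k*`.
Nestedness makes all inner products among the biases, and among the projected noises, nonnegative;
as nonzero weights are at least `δ`, `L*(w)` is at least `δ²/2` times the largest `D_m` in the
support of `w`. All errors are `O(ε)` times that risk, so the feasible loss, and the criterion up to
a term free of `w`, equal `L*(w)` up to a relative error `O(ε/δ²)`. A minimizer of the criterion is
then nearly optimal (`abs_div_sInf_sub_one_le`).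

The assumptions on the noise hold with high probability for three reasons. First, `e'Ge` deviates
from its mean by at most a multiple of the Frobenius norm of `G` in `L²`
(`exists_eLpNorm_quadForm_le`), because products of martingale differences are orthogonal. Second,
the eigenvalues of `Σ_n` lie in a fixed interval `[c, C]` with `c > 0`: on the circle, `v'Σ_n v` is
the integral of `|v̂|²` against a continuous nonvanishing density
(`exists_quadForm_errorCov_bounds`). Third, Chebyshev bounds can be summed over the models: for the
cross terms because fourth moments give probabilities of order `D_m⁻²`, for `‖P_m e‖²` because it is
monotone in `m`, so that only block endpoints matter (`measure_exists_lt_abs_sub_le`). Independence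
extends the bounds from fixed to random regressors by Fubini.

Finally `‖Δ‖² = O_p(b_n²/n)` tends to zero, and `‖Δ‖² ‖e‖² = O_p(b_n²)` is negligible against `k*`
(`norm_whitenedError_bounds`, `eventually_rate_le`). -/

noncomputable section

/-! ### Quadratic forms in the innovations -/

/-- Martingale differences with constant conditional variance and bounded fourth moments. -/
structure IsInnovation {Ω : Type*} [MeasurableSpace Ω] (P : Measure Ω)
    (ℱ : Filtration ℤ (inferInstance : MeasurableSpace Ω)) (α : ℤ → Ω → ℝ) (σ C : ℝ) : Prop where
  adapted : ∀ t, Measurable[ℱ t] (α t)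
  memLp : ∀ t, MemLp (α t) 4 P
  moment_le : ∀ t, ∫ ω, α t ω ^ 4 ∂P ≤ C
  condMean : ∀ t : ℤ, P[α t | ℱ (t - 1)] =ᵐ[P] 0
  condVar : ∀ t : ℤ, P[fun ω => α t ω ^ 2 | ℱ (t - 1)] =ᵐ[P] fun _ => σ ^ 2

theorem holderTriple_four_four_two : ENNReal.HolderTriple 4 4 2 := by
  constructor
  have h : (4 : ENNReal) = 2 * 2 := by norm_num
  rw [h, ENNReal.mul_inv (by simp) (by simp), ← mul_add, ENNReal.inv_two_add_inv_two, mul_one]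

theorem MeasureTheory.MemLp.mul_four {Ω : Type*} [MeasurableSpace Ω] {P : Measure Ω}
    {f g : Ω → ℝ} (hf : MemLp f 4 P) (hg : MemLp g 4 P) :
    MemLp (fun ω => f ω * g ω) 2 P := by
  have := holderTriple_four_four_two
  exact MemLp.mul hg hf

theorem integral_sq_sum_le_of_orthogonal {Ω ι : Type*} [MeasurableSpace Ω] {P : Measure Ω}
    (F : Finset ι) (ψ : ι → Ω → ℝ) (b : ι → ℝ) (C : ℝ) (hψ : ∀ i ∈ F, MemLp (ψ i) 2 P)
    (horth : ∀ i ∈ F, ∀ j ∈ F, i ≠ j → ∫ ω, ψ i ω * ψ j ω ∂P = 0)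
    (hC : ∀ i ∈ F, ∫ ω, ψ i ω ^ 2 ∂P ≤ C) :
    ∫ ω, (∑ i ∈ F, b i * ψ i ω) ^ 2 ∂P ≤ C * ∑ i ∈ F, b i ^ 2 := by
  have hint : ∀ i ∈ F, ∀ j ∈ F, Integrable (fun ω => b i * ψ i ω * (b j * ψ j ω)) P :=
    fun i hi j hj => ((hψ i hi).const_mul (b i)).integrable_mul ((hψ j hj).const_mul (b j))
  calc ∫ ω, (∑ i ∈ F, b i * ψ i ω) ^ 2 ∂P
      = ∑ i ∈ F, ∑ j ∈ F, ∫ ω, b i * ψ i ω * (b j * ψ j ω) ∂P := by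
        simp_rw [sq, Finset.sum_mul_sum]
        rw [integral_finsetSum _ fun i hi => integrable_finsetSum _ fun j hj => hint i hi j hj]
        exact Finset.sum_congr rfl fun i hi => integral_finsetSum _ fun j hj => hint i hi j hj
    _ = ∑ i ∈ F, b i ^ 2 * ∫ ω, ψ i ω ^ 2 ∂P := by
        refine Finset.sum_congr rfl fun i hi => ?_
        rw [Finset.sum_eq_single_of_mem i hi]
        · rw [← integral_const_mul]
          exact integral_congr_ae (.of_forall fun ω => by ring)
        · intro j hj hij
          have h : (fun ω => b i * ψ i ω * (b j * ψ j ω))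
              = fun ω => b i * b j * (ψ i ω * ψ j ω) := by
            ext ω; ring
          rw [h, integral_const_mul, horth i hi j hj hij.symm, mul_zero]
    _ ≤ C * ∑ i ∈ F, b i ^ 2 := by
        rw [Finset.mul_sum]
        refine Finset.sum_le_sum fun i hi => ?_
        rw [mul_comm C]
        exact mul_le_mul_of_nonneg_left (hC i hi) (sq_nonneg _)

namespace IsInnovation

variable {Ω : Type*} [MeasurableSpace Ω] {P : Measure Ω}
  {ℱ : Filtration ℤ (inferInstance : MeasurableSpace Ω)} {α : ℤ → Ω → ℝ} {σ C : ℝ}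

theorem memLp_two [IsProbabilityMeasure P] (h : IsInnovation P ℱ α σ C) (t : ℤ) : MemLp (α t) 2 P :=
  (h.memLp t).mono_exponent (by norm_num)

theorem measurable_of_le (h : IsInnovation P ℱ α σ C) {s t : ℤ} (hst : s ≤ t) :
    Measurable[ℱ t] (α s) :=
  (h.adapted s).mono (ℱ.mono hst) le_rfl

theorem integral_mul_eq_zero [IsProbabilityMeasure P]
    (h : IsInnovation P ℱ α σ C) (t : ℤ) {f : Ω → ℝ}
    (hf : Measurable[ℱ (t - 1)] f) (hfα : Integrable (fun ω => f ω * α t ω) P) :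
    ∫ ω, f ω * α t ω ∂P = 0 := by
  have h1 : P[fun ω => f ω * α t ω | ℱ (t - 1)] =ᵐ[P] 0 := by
    have h2 := condExp_mul_of_stronglyMeasurable_left (μ := P) hf.stronglyMeasurable hfα
      ((h.memLp_two t).integrable (by norm_num))
    filter_upwards [h2, h.condMean t] with ω h3 h4
    refine h3.trans ?_
    simp [h4]
  rw [← integral_condExp (ℱ.le (t - 1)), integral_congr_ae h1]
  simp

theorem integral_mul_sq [IsProbabilityMeasure P] (h : IsInnovation P ℱ α σ C) (t : ℤ) {f : Ω → ℝ}
    (hf : Measurable[ℱ (t - 1)] f) (hfα : Integrable (fun ω => f ω * α t ω ^ 2) P) :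
    ∫ ω, f ω * α t ω ^ 2 ∂P = σ ^ 2 * ∫ ω, f ω ∂P := by
  have h1 : P[fun ω => f ω * α t ω ^ 2 | ℱ (t - 1)] =ᵐ[P] fun ω => σ ^ 2 * f ω := by
    have h2 := condExp_mul_of_stronglyMeasurable_left (μ := P) hf.stronglyMeasurable hfα
      (h.memLp_two t).integrable_sq
    filter_upwards [h2, h.condVar t] with ω h3 h4
    refine h3.trans ?_
    simp [h4, mul_comm]
  rw [← integral_condExp (ℱ.le (t - 1)), integral_congr_ae h1, integral_const_mul]

theorem integral_sq [IsProbabilityMeasure P]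
    (h : IsInnovation P ℱ α σ C) (t : ℤ) : ∫ ω, α t ω ^ 2 ∂P = σ ^ 2 := by
  have := h.integral_mul_sq t (f := fun _ => 1) measurable_const
    (by simpa using (h.memLp_two t).integrable_sq)
  simpa using this

theorem integral_mul_of_ne [IsProbabilityMeasure P]
    (h : IsInnovation P ℱ α σ C) {s t : ℤ} (hst : s ≠ t) :
    ∫ ω, α s ω * α t ω ∂P = 0 := by
  rcases lt_or_gt_of_ne hst with hlt | hlt
  · exact h.integral_mul_eq_zero t (h.measurable_of_le (by omega))
      ((h.memLp_two s).integrable_mul (h.memLp_two t))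
  · simp_rw [mul_comm (α s _)]
    exact h.integral_mul_eq_zero s (h.measurable_of_le (by omega))
      ((h.memLp_two t).integrable_mul (h.memLp_two s))

theorem integral_mul [IsProbabilityMeasure P] (h : IsInnovation P ℱ α σ C) (s t : ℤ) :
    ∫ ω, α s ω * α t ω ∂P = if s = t then σ ^ 2 else 0 := by
  split_ifs with hst
  · subst hst
    simpa [sq] using h.integral_sq s
  · exact h.integral_mul_of_ne hst

theorem memLp_mul (h : IsInnovation P ℱ α σ C) (s t : ℤ) :
    MemLp (fun ω => α s ω * α t ω) 2 P :=
  (h.memLp s).mul_four (h.memLp t)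

/-- Condition on the past of the latest time. If it occurs once, the martingale property gives zero.
If it occurs twice, its square contributes the constant `σ²`, leaving the product of two distinct
innovations, which has mean zero. -/
theorem integral_off_diag_mul [IsProbabilityMeasure P]
    (h : IsInnovation P ℱ α σ C) {s t s' t' : ℤ} (hst : s < t)
    (hst' : s' < t') (hne : (s, t) ≠ (s', t')) :
    ∫ ω, (α s ω * α t ω) * (α s' ω * α t' ω) ∂P = 0 := by
  have key : ∀ s t s' t' : ℤ, s < t → s' < t' → t < t' →
      ∫ ω, (α s ω * α t ω) * (α s' ω * α t' ω) ∂P = 0 := by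
    intro s t s' t' h1 h2 h3
    have hint := (h.memLp_mul s t).integrable_mul (h.memLp_mul s' t')
    have he : (fun ω => (α s ω * α t ω) * (α s' ω * α t' ω))
        = fun ω => (α s ω * α t ω * α s' ω) * α t' ω := by ext ω; ring
    have hint' : Integrable (fun ω => (α s ω * α t ω * α s' ω) * α t' ω) P := by
      rw [← he]; exact hint
    rw [he]
    exact h.integral_mul_eq_zero t' (((h.measurable_of_le (by omega)).mul
      (h.measurable_of_le (by omega))).mul (h.measurable_of_le (by omega))) hint'
  rcases lt_trichotomy t t' with hlt | heq | hgt
  · exact key s t s' t' hst hst' hlt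
  · subst heq
    have hs : s ≠ s' := fun hs => hne (by rw [hs])
    have hint := (h.memLp_mul s t).integrable_mul (h.memLp_mul s' t)
    have he : (fun ω => (α s ω * α t ω) * (α s' ω * α t ω))
        = fun ω => (α s ω * α s' ω) * α t ω ^ 2 := by ext ω; ring
    have hint' : Integrable (fun ω => (α s ω * α s' ω) * α t ω ^ 2) P := by
      rw [← he]; exact hint
    have hf : Measurable[ℱ (t - 1)] fun ω => α s ω * α s' ω :=
      (h.measurable_of_le (by omega)).mul (h.measurable_of_le (by omega))
    rw [he, h.integral_mul_sq t hf hint', h.integral_mul_of_ne hs, mul_zero]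
  · have := key s' t' s t hst' hst hgt
    simp_rw [mul_comm (α s _ * α t _)]
    exact this

theorem integral_off_diag_sq [IsProbabilityMeasure P]
    (h : IsInnovation P ℱ α σ C) {s t : ℤ} (hst : s < t) :
    ∫ ω, (α s ω * α t ω) ^ 2 ∂P = σ ^ 4 := by
  have he : (fun ω => (α s ω * α t ω) ^ 2) = fun ω => α s ω ^ 2 * α t ω ^ 2 := by
    ext ω; ring
  have hint : Integrable (fun ω => α s ω ^ 2 * α t ω ^ 2) P := by
    rw [← he]; exact (h.memLp_mul s t).integrable_sq
  rw [he, h.integral_mul_sq t ((h.measurable_of_le (by omega)).pow_const 2) hint, h.integral_sq]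
  ring

theorem memLp_sq_sub [IsProbabilityMeasure P] (h : IsInnovation P ℱ α σ C) (t : ℤ) :
    MemLp (fun ω => α t ω * α t ω - σ ^ 2) 2 P :=
  (h.memLp_mul t t).sub (memLp_const _)

theorem integral_diag_mul [IsProbabilityMeasure P]
    (h : IsInnovation P ℱ α σ C) {s t : ℤ} (hst : s ≠ t) :
    ∫ ω, (α s ω * α s ω - σ ^ 2) * (α t ω * α t ω - σ ^ 2) ∂P = 0 := by
  have key : ∀ s t : ℤ, s < t →
      ∫ ω, (α s ω * α s ω - σ ^ 2) * (α t ω * α t ω - σ ^ 2) ∂P = 0 := by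
    intro s t hst
    have h1 := (h.memLp_sq_sub s).integrable_mul (h.memLp_mul t t)
    have he : (fun ω => (α s ω * α s ω - σ ^ 2) * (α t ω * α t ω))
        = fun ω => (α s ω * α s ω - σ ^ 2) * α t ω ^ 2 := by ext ω; ring
    have h2 : Integrable (fun ω => (α s ω * α s ω - σ ^ 2) * α t ω ^ 2) P := by
      rw [← he]; exact h1
    have h3 : Integrable (fun ω => (α s ω * α s ω - σ ^ 2) * σ ^ 2) P :=
      ((h.memLp_sq_sub s).integrable (by norm_num)).mul_const _
    have hf : Measurable[ℱ (t - 1)] fun ω => α s ω * α s ω - σ ^ 2 :=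
      ((h.measurable_of_le (by omega)).mul (h.measurable_of_le (by omega))).sub_const _
    calc ∫ ω, (α s ω * α s ω - σ ^ 2) * (α t ω * α t ω - σ ^ 2) ∂P
        = ∫ ω, ((α s ω * α s ω - σ ^ 2) * α t ω ^ 2 - (α s ω * α s ω - σ ^ 2) * σ ^ 2) ∂P :=
          integral_congr_ae (.of_forall fun ω => by ring)
      _ = 0 := by
          rw [integral_sub h2 h3, h.integral_mul_sq t hf h2, integral_mul_const]
          ring
  rcases lt_or_gt_of_ne hst with hlt | hlt
  · exact key s t hlt
  · simp_rw [mul_comm (α s _ * α s _ - σ ^ 2)]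
    exact key t s hlt

theorem integral_diag_sq_le [IsProbabilityMeasure P] (h : IsInnovation P ℱ α σ C) (t : ℤ) :
    ∫ ω, (α t ω * α t ω - σ ^ 2) ^ 2 ∂P ≤ 2 * C + 2 * σ ^ 4 := by
  have h4 : Integrable (fun ω => α t ω ^ 4) P := by
    have := (h.memLp_mul t t).integrable_sq
    refine this.congr (.of_forall fun ω => by simp only; ring)
  calc ∫ ω, (α t ω * α t ω - σ ^ 2) ^ 2 ∂P ≤ ∫ ω, (2 * α t ω ^ 4 + 2 * σ ^ 4) ∂P := by
        refine integral_mono (h.memLp_sq_sub t).integrable_sq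
          ((h4.const_mul 2).add (integrable_const _)) fun ω => ?_
        simp only
        nlinarith [sq_nonneg (α t ω * α t ω + σ ^ 2)]
    _ = 2 * ∫ ω, α t ω ^ 4 ∂P + 2 * σ ^ 4 := by
        rw [integral_add (h4.const_mul 2) (integrable_const _), integral_const_mul]
        simp
    _ ≤ 2 * C + 2 * σ ^ 4 := by linarith [h.moment_le t]

/-- Centered quadratic forms in the innovations have second moment bounded by the squared
Frobenius norm of their matrix. -/
theorem integral_quadratic_sq_le [IsProbabilityMeasure P]
    (h : IsInnovation P ℱ α σ C) {ι : Type*} (F : Finset ι)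
    (u v : ι → ℤ) (huv : Set.InjOn (fun i => (u i, v i)) F) (b : ι → ℝ) :
    ∫ ω, (∑ i ∈ F, b i * (α (u i) ω * α (v i) ω - if u i = v i then σ ^ 2 else 0)) ^ 2 ∂P
      ≤ 3 * (2 * C + 2 * σ ^ 4) * ∑ i ∈ F, b i ^ 2 := by
  set ψ : ι → Ω → ℝ := fun i ω => α (u i) ω * α (v i) ω - if u i = v i then σ ^ 2 else 0 with hψ
  have hC : 0 ≤ C := (integral_nonneg fun ω => by positivity).trans (h.moment_le 0)
  have hmem : ∀ i, MemLp (ψ i) 2 P := fun i => (h.memLp_mul _ _).sub (memLp_const _)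
  have hbound : ∀ F' ⊆ F, (∀ i ∈ F', ∀ j ∈ F', i ≠ j → ∫ ω, ψ i ω * ψ j ω ∂P = 0) →
      (∀ i ∈ F', ∫ ω, ψ i ω ^ 2 ∂P ≤ 2 * C + 2 * σ ^ 4) →
      ∫ ω, (∑ i ∈ F', b i * ψ i ω) ^ 2 ∂P ≤ (2 * C + 2 * σ ^ 4) * ∑ i ∈ F', b i ^ 2 :=
    fun F' _ h1 h2 => integral_sq_sum_le_of_orthogonal F' ψ b _ (fun i _ => hmem i) h1 h2
  -- Orthogonality holds only inside each of the parts `u < v`, `v < u` and `u = v`: the pairs `(s,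
  -- t)` and `(t, s)` give the same variable, and a diagonal term against an off-diagonal one
  -- involves conditional third moments. The parts are therefore bounded separately and recombined
  -- by `(x + y + z)² ≤ 3 (x² + y² + z²)`.
  have h1 := hbound (F.filter fun i => u i < v i) (Finset.filter_subset _ _)
    (fun i hi j hj hij => by
      obtain ⟨hi1, hi2⟩ := Finset.mem_filter.1 hi
      obtain ⟨hj1, hj2⟩ := Finset.mem_filter.1 hj
      simp only [hψ, hi2.ne, hj2.ne, if_false, sub_zero]
      exact h.integral_off_diag_mul hi2 hj2 fun he => hij (huv hi1 hj1 he))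
    (fun i hi => by
      obtain ⟨hi1, hi2⟩ := Finset.mem_filter.1 hi
      simp only [hψ, hi2.ne, if_false, sub_zero]
      rw [h.integral_off_diag_sq hi2]
      nlinarith [sq_nonneg (σ ^ 2)])
  have h2 := hbound (F.filter fun i => v i < u i) (Finset.filter_subset _ _)
    (fun i hi j hj hij => by
      obtain ⟨hi1, hi2⟩ := Finset.mem_filter.1 hi
      obtain ⟨hj1, hj2⟩ := Finset.mem_filter.1 hj
      simp only [hψ, hi2.ne', hj2.ne', if_false, sub_zero]
      simp_rw [mul_comm (α (u _) _)]
      exact h.integral_off_diag_mul hi2 hj2 fun he => hij (huv hi1 hj1 (by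
        simp only [Prod.mk.injEq] at he ⊢; exact he.symm)))
    (fun i hi => by
      obtain ⟨hi1, hi2⟩ := Finset.mem_filter.1 hi
      simp only [hψ, hi2.ne', if_false, sub_zero]
      simp_rw [mul_comm (α (u _) _)]
      rw [h.integral_off_diag_sq hi2]
      nlinarith [sq_nonneg (σ ^ 2)])
  have h3 := hbound (F.filter fun i => u i = v i) (Finset.filter_subset _ _)
    (fun i hi j hj hij => by
      obtain ⟨hi1, hi2⟩ := Finset.mem_filter.1 hi
      obtain ⟨hj1, hj2⟩ := Finset.mem_filter.1 hj
      simp only [hψ, hi2, hj2, if_true]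
      exact h.integral_diag_mul fun he => hij (huv hi1 hj1 (by
        simp only [Prod.mk.injEq]; exact ⟨by omega, he⟩)))
    (fun i hi => by
      obtain ⟨hi1, hi2⟩ := Finset.mem_filter.1 hi
      simp only [hψ, hi2, if_true]
      exact h.integral_diag_sq_le _)
  have hsplit : ∀ f : ι → ℝ, ∑ i ∈ F, f i = ∑ i ∈ F.filter (fun i => u i < v i), f i
      + ∑ i ∈ F.filter (fun i => v i < u i), f i + ∑ i ∈ F.filter (fun i => u i = v i), f i := by
    intro f
    simp only [Finset.sum_filter]
    rw [← Finset.sum_add_distrib, ← Finset.sum_add_distrib]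
    refine Finset.sum_congr rfl fun i _ => ?_
    rcases lt_trichotomy (u i) (v i) with hl | he | hg
    · simp [hl, hl.ne, hl.not_gt]
    · simp [he]
    · simp [hg, hg.ne', hg.not_gt]
  have hL : ∀ F' : Finset ι, MemLp (fun ω => ∑ i ∈ F', b i * ψ i ω) 2 P := fun F' =>
    memLp_finsetSum _ fun i _ => (hmem i).const_mul (b i)
  calc ∫ ω, (∑ i ∈ F, b i * ψ i ω) ^ 2 ∂P
      ≤ ∫ ω, (3 * (∑ i ∈ F.filter (fun i => u i < v i), b i * ψ i ω) ^ 2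
        + 3 * (∑ i ∈ F.filter (fun i => v i < u i), b i * ψ i ω) ^ 2
        + 3 * (∑ i ∈ F.filter (fun i => u i = v i), b i * ψ i ω) ^ 2) ∂P := by
        refine integral_mono (hL F).integrable_sq ((((hL _).integrable_sq.const_mul 3).add
          ((hL _).integrable_sq.const_mul 3)).add ((hL _).integrable_sq.const_mul 3)) fun ω => ?_
        simp only
        rw [hsplit]
        set x := ∑ i ∈ F.filter (fun i => u i < v i), b i * ψ i ω
        set y := ∑ i ∈ F.filter (fun i => v i < u i), b i * ψ i ω
        set z := ∑ i ∈ F.filter (fun i => u i = v i), b i * ψ i ω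
        nlinarith [sq_nonneg (x - y), sq_nonneg (y - z), sq_nonneg (x - z)]
    _ ≤ 3 * (2 * C + 2 * σ ^ 4) * ∑ i ∈ F, b i ^ 2 := by
        have hI : ∀ F' : Finset ι, Integrable (fun ω => 3 * (∑ i ∈ F', b i * ψ i ω) ^ 2) P :=
          fun F' => (hL F').integrable_sq.const_mul 3
        rw [integral_add ((hI _).fun_add (hI _)) (hI _), integral_add (hI _) (hI _),
          integral_const_mul, integral_const_mul, integral_const_mul,
          hsplit fun i => b i ^ 2]
        linarith

end IsInnovation

/-! ### Quadratic forms in the errors -/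

/-- Minkowski bounds every finite partial sum, and the `L²` norm is lower semicontinuous under
almost everywhere convergence (Fatou). -/
theorem eLpNorm_le_tsum_of_hasSum {Ω ι : Type*} [MeasurableSpace Ω] [Countable ι] {P : Measure Ω}
    {f : ι → Ω → ℝ} {g : Ω → ℝ} {a : ι → ℝ} (hf : ∀ i, AEStronglyMeasurable (f i) P)
    (ha : Summable a) (ha0 : ∀ i, 0 ≤ a i)
    (hfa : ∀ i, eLpNorm (f i) 2 P ≤ ENNReal.ofReal (a i))
    (hg : ∀ᵐ ω ∂P, HasSum (fun i => f i ω) (g ω)) :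
    eLpNorm g 2 P ≤ ENNReal.ofReal (∑' i, a i) := by
  refine Lp.eLpNorm_le_of_ae_tendsto (u := (atTop : Filter (Finset ι)))
    (f := fun F ω => ∑ i ∈ F, f i ω) (.of_forall fun F => ?_)
    (fun F => Finset.aestronglyMeasurable_fun_sum F fun i _ => hf i) hg
  calc eLpNorm (fun ω => ∑ i ∈ F, f i ω) 2 P = eLpNorm (∑ i ∈ F, f i) 2 P := by
        congr 1; ext ω; simp
    _ ≤ ∑ i ∈ F, eLpNorm (f i) 2 P := eLpNorm_sum_le (fun i _ => hf i) (by norm_num)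
    _ ≤ ∑ i ∈ F, ENNReal.ofReal (a i) := Finset.sum_le_sum fun i _ => hfa i
    _ = ENNReal.ofReal (∑ i ∈ F, a i) := (ENNReal.ofReal_sum_of_nonneg fun i _ => ha0 i).symm
    _ ≤ ENNReal.ofReal (∑' i, a i) :=
        ENNReal.ofReal_le_ofReal (ha.sum_le_tsum F fun i _ => ha0 i)

theorem eLpNorm_two_le_of_integral_sq_le {Ω : Type*} [MeasurableSpace Ω] {P : Measure Ω}
    {f : Ω → ℝ} (hf : MemLp f 2 P) {c : ℝ} (hc : 0 ≤ c) (h : ∫ ω, f ω ^ 2 ∂P ≤ c ^ 2) :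
    eLpNorm f 2 P ≤ ENNReal.ofReal c := by
  rw [hf.eLpNorm_eq_integral_rpow_norm (by norm_num) (by norm_num)]
  refine ENNReal.ofReal_le_ofReal ?_
  have h2 : ∀ ω, ‖f ω‖ ^ (ENNReal.toReal 2) = f ω ^ 2 := fun ω => by simp
  simp_rw [h2]
  calc (∫ ω, f ω ^ 2 ∂P) ^ (ENNReal.toReal 2)⁻¹ ≤ (c ^ 2) ^ (ENNReal.toReal 2)⁻¹ :=
        Real.rpow_le_rpow (integral_nonneg fun ω => sq_nonneg _) h (by norm_num)
    _ = c := by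
        have : (ENNReal.toReal 2)⁻¹ = ((2 : ℕ) : ℝ)⁻¹ := by norm_num
        rw [this, Real.pow_rpow_inv_natCast hc (by norm_num)]

namespace IsLinearErrorProcess

variable {Ω : Type*} [MeasurableSpace Ω] {P : Measure Ω}
  {ℱ : Filtration ℤ (inferInstance : MeasurableSpace Ω)} {e α : ℤ → Ω → ℝ} {β : ℕ → ℝ}
  {σ S : ℝ}

/-- Taking expectations in the conditional bound controls the moment of order `S`, and `r⁴ ≤ 1 +
r^S` for `r ≥ 0` reduces the fourth moment to it. -/
theorem exists_isInnovation [IsProbabilityMeasure P]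
    (h : IsLinearErrorProcess P ℱ e α β σ S) (hS : 4 < S) :
    ∃ C, IsInnovation P ℱ α σ C := by
  obtain ⟨C, hC, hcond⟩ := h.condMoment
  have hmeas : ∀ t, Measurable (α t) := fun t => (h.adapted t).mono (ℱ.le t) le_rfl
  have hmom : ∀ t, ∫ ω, |α t ω| ^ S ∂P ≤ C := by
    intro t
    rw [← integral_condExp (ℱ.le (t - 1))]
    calc ∫ ω, (P[fun ω' => |α t ω'| ^ S | ℱ (t - 1)]) ω ∂P ≤ ∫ _, C ∂P := by
          refine integral_mono_ae integrable_condExp (integrable_const _) ?_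
          filter_upwards [hcond] with ω hω using hω t
      _ = C := by simp
  have hpow : ∀ r : ℝ, 0 ≤ r → r ^ (4 : ℕ) ≤ 1 + r ^ S := by
    intro r hr
    rcases le_total r 1 with h1 | h1
    · have := pow_le_one₀ (n := 4) hr h1
      have := Real.rpow_nonneg hr S
      linarith
    · have := Real.rpow_le_rpow_of_exponent_le h1 hS.le
      rw [show (4 : ℝ) = ((4 : ℕ) : ℝ) by norm_num, Real.rpow_natCast] at this
      linarith
  have habs : ∀ r : ℝ, r ^ 4 = |r| ^ 4 := fun r => by rw [← abs_pow, abs_of_nonneg (by positivity)]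
  have hint : ∀ t, Integrable (fun ω => α t ω ^ 4) P := by
    intro t
    refine ((integrable_const 1).add (h.integrable_rpow t)).mono'
      ((hmeas t).pow_const 4).aestronglyMeasurable (.of_forall fun ω => ?_)
    rw [Real.norm_of_nonneg (by positivity), habs]
    exact hpow _ (abs_nonneg _)
  refine ⟨1 + C, h.adapted, fun t => ?_, fun t => ?_, h.condMean, h.condVar⟩
  · refine (integrable_norm_rpow_iff (hmeas t).aestronglyMeasurable (by norm_num)
      (by norm_num)).1 ?_
    refine (hint t).congr (.of_forall fun ω => ?_)
    have h4 : (ENNReal.toReal 4) = ((4 : ℕ) : ℝ) := by norm_num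
    simp only [h4, Real.rpow_natCast, Real.norm_eq_abs]
    exact habs _
  · calc ∫ ω, α t ω ^ 4 ∂P ≤ ∫ ω, (1 + |α t ω| ^ S) ∂P := by
          refine integral_mono (hint t) ((integrable_const 1).add (h.integrable_rpow t)) fun ω => ?_
          simp only [habs (α t ω)]
          exact hpow _ (abs_nonneg _)
      _ = 1 + ∫ ω, |α t ω| ^ S ∂P := by
          rw [integral_add (integrable_const 1) (h.integrable_rpow t)]
          simp
      _ ≤ 1 + C := by linarith [hmom t]

theorem hasSum_mul (h : IsLinearErrorProcess P ℱ e α β σ S) (s t : ℤ) :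
    ∀ᵐ ω ∂P, HasSum (fun p : ℕ × ℕ => β p.1 * β p.2 * (α (s - p.1) ω * α (t - p.2) ω))
      (e s ω * e t ω) := by
  filter_upwards [h.linear s, h.linear t] with ω hs ht
  have := hs.mul ht (summable_mul_of_summable_norm hs.summable.norm ht.summable.norm)
  refine this.congr_fun fun p => ?_
  ring

theorem summable_weight (hβ : Summable fun j => |β j|) :
    Summable fun p : ℕ × ℕ => |β p.1 * β p.2| :=
  (summable_mul_of_summable_norm (f := β) (g := β) hβ hβ).abs

/-- Termwise integration of the double series for `e_s e_t` is justified by `E |α_i α_j| ≤ σ²` and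
the absolute summability of `β`. -/
theorem hasSum_cov [IsProbabilityMeasure P] (h : IsLinearErrorProcess P ℱ e α β σ S) {C : ℝ}
    (hα : IsInnovation P ℱ α σ C) (hβ : Summable fun j => |β j|) (s t : ℤ) :
    HasSum (fun p : ℕ × ℕ => β p.1 * β p.2 * if s - p.1 = t - p.2 then σ ^ 2 else 0)
      (∫ ω, e s ω * e t ω ∂P) := by
  have hint : ∀ p : ℕ × ℕ,
      Integrable (fun ω => β p.1 * β p.2 * (α (s - p.1) ω * α (t - p.2) ω)) P :=
    fun p => ((hα.memLp_mul _ _).integrable (by norm_num)).const_mul _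
  have hsq : ∀ i j : ℤ, ∫ ω, ‖α i ω * α j ω‖ ∂P ≤ σ ^ 2 := by
    intro i j
    have hi := (hα.memLp_two i).integrable_sq
    have hj := (hα.memLp_two j).integrable_sq
    calc ∫ ω, ‖α i ω * α j ω‖ ∂P ≤ ∫ ω, (α i ω ^ 2 / 2 + α j ω ^ 2 / 2) ∂P := by
          refine integral_mono ((hα.memLp_mul i j).integrable (by norm_num)).norm
            ((hi.div_const 2).add (hj.div_const 2)) fun ω => ?_
          simp only [Real.norm_eq_abs]
          rw [abs_le]
          constructor <;> nlinarith [sq_nonneg (α i ω + α j ω), sq_nonneg (α i ω - α j ω)]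
      _ = σ ^ 2 := by
          rw [integral_add (hi.div_const 2) (hj.div_const 2), integral_div, integral_div,
            hα.integral_sq, hα.integral_sq]
          ring
  have hsum := hasSum_integral_of_summable_integral_norm hint (by
    refine Summable.of_nonneg_of_le (fun p => integral_nonneg fun ω => norm_nonneg _) (fun p => ?_)
      ((summable_weight hβ).mul_right (σ ^ 2))
    simp_rw [norm_mul (β p.1 * β p.2), integral_const_mul]
    exact mul_le_mul_of_nonneg_left (hsq _ _) (abs_nonneg _))
  have hcongr : ∫ ω, ∑' p : ℕ × ℕ, β p.1 * β p.2 * (α (s - p.1) ω * α (t - p.2) ω) ∂P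
      = ∫ ω, e s ω * e t ω ∂P := by
    refine integral_congr_ae ?_
    filter_upwards [h.hasSum_mul s t] with ω hω using hω.tsum_eq
  rw [hcongr] at hsum
  refine hsum.congr_fun fun p => ?_
  rw [integral_const_mul, hα.integral_mul]

/-- Centered quadratic forms in the errors are bounded in `L²` by a constant multiple of the
Frobenius norm of their matrix. -/
theorem exists_eLpNorm_quadForm_le [IsProbabilityMeasure P]
    (h : IsLinearErrorProcess P ℱ e α β σ S) (hS : 4 < S) (hβ : Summable fun j => |β j|) :
    ∃ C : ℝ, 0 ≤ C ∧ ∀ (n : ℕ) (G : Matrix (Fin n) (Fin n) ℝ),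
      eLpNorm (fun ω => quadForm G (fun t => e (t : ℕ) ω) - (G * errorCov P e n).trace) 2 P
        ≤ ENNReal.ofReal (C * √(∑ s, ∑ t, G s t ^ 2)) := by
  obtain ⟨C, hα⟩ := h.exists_isInnovation hS
  have hC : 0 ≤ C := (integral_nonneg fun ω => by positivity).trans (hα.moment_le 0)
  set A := 3 * (2 * C + 2 * σ ^ 4) with hA
  have hA0 : 0 ≤ A := by positivity
  refine ⟨(∑' p : ℕ × ℕ, |β p.1 * β p.2|) * √A,
    mul_nonneg (tsum_nonneg fun p => abs_nonneg _) (Real.sqrt_nonneg _), fun n G => ?_⟩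
  set γ := √A * √(∑ s, ∑ t, G s t ^ 2) with hγ
  -- For each pair of lags `p` this is a centered quadratic form in shifted innovations with the
  -- same matrix `G`, so its norm has a bound independent of `p`. The form in the errors is the
  -- series of the `q p` with coefficients `β p.1 * β p.2`, whence the factor `∑ |β p.1 * β p.2|`.
  set q : ℕ × ℕ → Ω → ℝ := fun p ω => ∑ i : Fin n × Fin n, G i.1 i.2 *
    (α ((i.1 : ℕ) - p.1) ω * α ((i.2 : ℕ) - p.2) ω
      - if ((i.1 : ℕ) : ℤ) - p.1 = (i.2 : ℕ) - p.2 then σ ^ 2 else 0) with hq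
  have hqL : ∀ p, MemLp (q p) 2 P := fun p => memLp_finsetSum _ fun i _ =>
    ((hα.memLp_mul _ _).sub (memLp_const _)).const_mul _
  have hqn : ∀ p, eLpNorm (q p) 2 P ≤ ENNReal.ofReal γ := by
    intro p
    refine eLpNorm_two_le_of_integral_sq_le (hqL p) (by positivity) ?_
    have h1 := hα.integral_quadratic_sq_le (Finset.univ : Finset (Fin n × Fin n))
      (fun i => ((i.1 : ℕ) : ℤ) - p.1) (fun i => ((i.2 : ℕ) : ℤ) - p.2)
      (fun i _ j _ hij => by
        simp only [Prod.mk.injEq] at hij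
        exact Prod.ext (Fin.ext (by omega)) (Fin.ext (by omega)))
      (fun i => G i.1 i.2)
    refine h1.trans_eq ?_
    have hs : √(∑ s, ∑ t, G s t ^ 2) ^ 2 = ∑ s, ∑ t, G s t ^ 2 :=
      Real.sq_sqrt (Finset.sum_nonneg fun s _ => Finset.sum_nonneg fun t _ => sq_nonneg _)
    have hγ2 : γ ^ 2 = A * ∑ s, ∑ t, G s t ^ 2 := by
      rw [hγ, mul_pow, Real.sq_sqrt hA0, hs]
    rw [hγ2, ← Fintype.sum_prod_type']
  have hsum : ∀ᵐ ω ∂P, HasSum (fun p : ℕ × ℕ => β p.1 * β p.2 * q p ω)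
      (quadForm G (fun t => e (t : ℕ) ω) - (G * errorCov P e n).trace) := by
    have hall : ∀ᵐ ω ∂P, ∀ i : Fin n × Fin n,
        HasSum (fun p : ℕ × ℕ => β p.1 * β p.2 * (α ((i.1 : ℕ) - p.1) ω * α ((i.2 : ℕ) - p.2) ω))
          (e (i.1 : ℕ) ω * e (i.2 : ℕ) ω) := ae_all_iff.2 fun i => h.hasSum_mul _ _
    filter_upwards [hall] with ω hω
    have h1 := hasSum_sum (s := Finset.univ) fun (i : Fin n × Fin n) _ =>
      ((hω i).sub (h.hasSum_cov hα hβ (i.1 : ℕ) (i.2 : ℕ))).mul_left (G i.1 i.2)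
    have h2 : ∑ i : Fin n × Fin n, G i.1 i.2 * (e (i.1 : ℕ) ω * e (i.2 : ℕ) ω
        - ∫ ω, e (i.1 : ℕ) ω * e (i.2 : ℕ) ω ∂P)
        = quadForm G (fun t => e (t : ℕ) ω) - (G * errorCov P e n).trace := by
      have hsymm : ∀ s t : Fin n, errorCov P e n s t = errorCov P e n t s := fun s t => by
        simp only [errorCov, Matrix.of_apply]
        exact integral_congr_ae (.of_forall fun ω => mul_comm _ _)
      simp only [mul_sub, Finset.sum_sub_distrib]
      congr 1
      · simp only [quadForm, dotProduct, Matrix.mulVec, Fintype.sum_prod_type, Finset.mul_sum]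
        exact Finset.sum_congr rfl fun s _ => Finset.sum_congr rfl fun t _ => by ring
      · simp only [Matrix.trace, Matrix.diag, Matrix.mul_apply, Fintype.sum_prod_type]
        refine Finset.sum_congr rfl fun s _ => Finset.sum_congr rfl fun t _ => ?_
        rw [hsymm t s]
        rfl
    rw [h2] at h1
    refine h1.congr_fun fun p => ?_
    simp only [hq, Finset.mul_sum]
    exact Finset.sum_congr rfl fun i _ => by ring
  have := eLpNorm_le_tsum_of_hasSum (P := P) (f := fun p ω => β p.1 * β p.2 * q p ω)
    (a := fun p => |β p.1 * β p.2| * γ)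
    (fun p => ((hqL p).const_mul _).aestronglyMeasurable) ((summable_weight hβ).mul_right γ)
    (fun p => by positivity)
    (fun p => by
      refine (eLpNorm_const_smul_le (c := β p.1 * β p.2) (f := q p)).trans ?_
      rw [ENNReal.ofReal_mul (abs_nonneg _), Real.enorm_eq_ofReal_abs]
      gcongr
      exact hqn p) hsum
  rw [tsum_mul_right] at this
  rw [mul_assoc]
  exact this

end IsLinearErrorProcess

/-! ### Spectral bounds for the covariance matrices of the errors -/

section Fourier

open AddCircle ComplexConjugate

instance fact_two_pi_pos : Fact (0 < 2 * Real.pi) := ⟨Real.two_pi_pos⟩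

theorem integral_fourier_two_pi (m : ℤ) :
    ∫ y : AddCircle (2 * Real.pi), fourier m y ∂haarAddCircle = if m = 0 then 1 else 0 := by
  have h := congrFun (fourierCoeff_fourier (T := 2 * Real.pi) m) 0
  rw [fourierCoeff] at h
  simpa [Pi.single_apply, eq_comm] using h

/-- The transfer function `∑_j β_j e^{-i j y}` on the circle. -/
def transferFun (β : ℕ → ℝ) (y : AddCircle (2 * Real.pi)) : ℂ :=
  ∑' j : ℕ, (β j : ℂ) * fourier (-(j : ℤ)) y

/-- The trigonometric polynomial with coefficients `v`. -/
def trigPoly {n : ℕ} (v : Fin n → ℝ) (y : AddCircle (2 * Real.pi)) : ℂ :=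
  ∑ s, (v s : ℂ) * fourier ((s : ℕ) : ℤ) y

theorem norm_transferFun_term (β : ℕ → ℝ) (j : ℕ) (y : AddCircle (2 * Real.pi)) :
    ‖(β j : ℂ) * fourier (-(j : ℤ)) y‖ = |β j| := by
  rw [norm_mul, Complex.norm_real, Real.norm_eq_abs]
  have : ‖fourier (-(j : ℤ)) y‖ = 1 := Circle.norm_coe _
  rw [this, mul_one]

variable {β : ℕ → ℝ}

theorem hasSum_transferFun (hβ : Summable fun j => |β j|) (y : AddCircle (2 * Real.pi)) :
    HasSum (fun j : ℕ => (β j : ℂ) * fourier (-(j : ℤ)) y) (transferFun β y) := by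
  refine Summable.hasSum (Summable.of_norm ?_)
  simp_rw [norm_transferFun_term]
  exact hβ

theorem continuous_transferFun (hβ : Summable fun j => |β j|) : Continuous (transferFun β) :=
  continuous_tsum (fun _ => continuous_const.mul (fourier _).continuous) hβ
    fun _ y => (norm_transferFun_term β _ y).le

theorem continuous_trigPoly {n : ℕ} (v : Fin n → ℝ) : Continuous (trigPoly v) :=
  continuous_finsetSum _ fun _ _ => continuous_const.mul (fourier _).continuous

/-- Every point of the circle has a representative in `(-π, π]`, where the spectral density is
assumed nonzero. -/
theorem transferFun_ne_zero {σ : ℝ} (h : IsSpectrallyRegular σ β) (y : AddCircle (2 * Real.pi)) :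
    transferFun β y ≠ 0 := by
  obtain ⟨lam, hlam, rfl⟩ : ∃ lam ∈ Set.Ioc (-Real.pi) (-Real.pi + 2 * Real.pi),
      (lam : AddCircle (2 * Real.pi)) = y := by
    have := AddCircle.coe_image_Ioc_eq (2 * Real.pi) (-Real.pi)
    have hy : y ∈ (Set.univ : Set (AddCircle (2 * Real.pi))) := Set.mem_univ y
    rw [← this] at hy
    exact hy
  have h1 := h.density_ne_zero lam hlam.1 (by linarith [hlam.2])
  intro h0
  apply h1
  have h2 : ∑' j : ℕ, (β j : ℂ) * Complex.exp (-(Complex.I * (j : ℂ) * (lam : ℂ)))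
      = transferFun β lam := by
    refine tsum_congr fun j => ?_
    rw [fourier_coe_apply]
    congr 2
    have : (Real.pi : ℂ) ≠ 0 := Complex.ofReal_ne_zero.2 Real.pi_ne_zero
    push_cast
    field_simp
  rw [spectralDensity, h2, h0]
  simp

theorem ne_zero_of_isSpectrallyRegular {σ : ℝ} (h : IsSpectrallyRegular σ β) : σ ≠ 0 := by
  rintro rfl
  exact h.density_ne_zero 0 (by linarith [Real.pi_pos]) Real.pi_pos.le (by simp [spectralDensity])

theorem trigPoly_term_mul (n : ℕ) (v : Fin n → ℝ) (k l : ℕ) (y : AddCircle (2 * Real.pi)) :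
    (fourier (-(k : ℤ)) y * trigPoly v y) * conj (fourier (-(l : ℤ)) y * trigPoly v y)
      = ∑ s, ∑ t, ((v s * v t : ℝ) : ℂ)
          * fourier (((s : ℕ) : ℤ) - k - (((t : ℕ) : ℤ) - l)) y := by
  simp only [trigPoly, Finset.mul_sum, map_sum, map_mul, Finset.sum_mul, Complex.conj_ofReal,
    ← fourier_neg]
  rw [Finset.sum_comm]
  refine Finset.sum_congr rfl fun s _ => Finset.sum_congr rfl fun t _ => ?_
  have h : ((s : ℕ) : ℤ) - k - (((t : ℕ) : ℤ) - l)
      = (-(k : ℤ) + (s : ℕ)) + (-(-(l : ℤ)) + -((t : ℕ) : ℤ)) := by ring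
  rw [h, fourier_add, fourier_add, fourier_add]
  push_cast
  ring

theorem integral_trigPoly_term (n : ℕ) (v : Fin n → ℝ) (k l : ℕ) :
    ∫ y, (fourier (-(k : ℤ)) y * trigPoly v y) * conj (fourier (-(l : ℤ)) y * trigPoly v y)
        ∂haarAddCircle
      = ∑ s, ∑ t, ((v s * v t : ℝ) : ℂ)
          * if ((s : ℕ) : ℤ) - k = ((t : ℕ) : ℤ) - l then 1 else 0 := by
  have hint : ∀ (c : ℂ) (m : ℤ), Integrable
      (fun y : AddCircle (2 * Real.pi) => c * fourier m y) haarAddCircle := fun c m =>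
    (continuous_const.mul (fourier m).continuous).integrable_of_hasCompactSupport
      (HasCompactSupport.of_compactSpace _)
  simp_rw [trigPoly_term_mul]
  rw [integral_finsetSum _ fun s _ => integrable_finsetSum _ fun t _ => hint _ _]
  refine Finset.sum_congr rfl fun s _ => ?_
  rw [integral_finsetSum _ fun t _ => hint _ _]
  refine Finset.sum_congr rfl fun t _ => ?_
  rw [integral_const_mul, integral_fourier_two_pi]
  simp only [sub_eq_zero]

theorem integral_norm_trigPoly_sq (n : ℕ) (v : Fin n → ℝ) :
    ∫ y, ‖trigPoly v y‖ ^ 2 ∂haarAddCircle = ∑ s, v s ^ 2 := by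
  have h := integral_trigPoly_term n v 0 0
  have h1 : ∀ y : AddCircle (2 * Real.pi),
      (fourier (-((0 : ℕ) : ℤ)) y * trigPoly v y) * conj (fourier (-((0 : ℕ) : ℤ)) y * trigPoly v y)
        = ((‖trigPoly v y‖ ^ 2 : ℝ) : ℂ) := by
    intro y
    simp [Complex.mul_conj, Complex.normSq_eq_norm_sq]
  simp_rw [h1] at h
  rw [integral_complex_ofReal] at h
  have h2 : (((∑ s, v s ^ 2 : ℝ)) : ℂ) = ∑ s, ∑ t, ((v s * v t : ℝ) : ℂ)
      * if ((s : ℕ) : ℤ) - (0 : ℕ) = ((t : ℕ) : ℤ) - (0 : ℕ) then 1 else 0 := by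
    push_cast
    refine Finset.sum_congr rfl fun s _ => ?_
    rw [Finset.sum_eq_single_of_mem s (Finset.mem_univ _)]
    · simp [sq]
    · intro t _ hts
      have : ((s : ℕ) : ℤ) ≠ ((t : ℕ) : ℤ) := fun he => hts (Fin.ext (by omega))
      simp [this]
  rw [← h2] at h
  exact_mod_cast h

theorem tsum_mul_conj {a : ℕ → ℂ} {z : ℂ} (ha : HasSum a z) :
    ∑' p : ℕ × ℕ, a p.1 * conj (a p.2) = ((‖z‖ ^ 2 : ℝ) : ℂ) := by
  have h1 : Summable fun j => ‖a j‖ := ha.summable.norm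
  have h2 : Summable fun j => ‖conj (a j)‖ := by simpa only [RCLike.norm_conj] using h1
  have h3 : ∑' j, conj (a j) = conj z := by rw [← Complex.conj_tsum, ha.tsum_eq]
  rw [← tsum_mul_tsum_of_summable_norm h1 h2, h3, ha.tsum_eq, Complex.mul_conj,
    Complex.normSq_eq_norm_sq]

/-- Expand the squared modulus as a double series over lags and integrate termwise, the
trigonometric polynomial being bounded; orthogonality of characters leaves the same Kronecker deltas
as in `hasSum_cov`. -/
theorem hasSum_integral_transferFun (hβ : Summable fun j => |β j|) (n : ℕ) (v : Fin n → ℝ) :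
    HasSum (fun p : ℕ × ℕ => β p.1 * β p.2 * ∑ s, ∑ t, v s * v t
        * if ((s : ℕ) : ℤ) - p.1 = ((t : ℕ) : ℤ) - p.2 then 1 else 0)
      (∫ y, ‖transferFun β y * trigPoly v y‖ ^ 2 ∂haarAddCircle) := by
  obtain ⟨B, hB⟩ := isCompact_univ.exists_bound_of_continuousOn (continuous_trigPoly v).continuousOn
  have hB' : ∀ y, ‖trigPoly v y‖ ≤ B := fun y => hB y (Set.mem_univ y)
  set F : ℕ × ℕ → AddCircle (2 * Real.pi) → ℂ := fun p y => (β p.1 * β p.2 : ℝ) *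
    ((fourier (-(p.1 : ℤ)) y * trigPoly v y) * conj (fourier (-(p.2 : ℤ)) y * trigPoly v y)) with hF
  have hcont : ∀ p, Continuous (F p) := fun p => continuous_const.mul
    (((fourier _).continuous.mul (continuous_trigPoly v)).mul
      (Complex.continuous_conj.comp ((fourier _).continuous.mul (continuous_trigPoly v))))
  have hint : ∀ p, Integrable (F p) haarAddCircle := fun p =>
    (hcont p).integrable_of_hasCompactSupport (HasCompactSupport.of_compactSpace _)
  have hnorm : ∀ p y, ‖F p y‖ ≤ |β p.1 * β p.2| * (B * B) := by
    intro p y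
    have h1 : ∀ m : ℤ, ‖fourier m y‖ = 1 := fun m => Circle.norm_coe _
    simp only [hF, norm_mul, Complex.norm_real, RCLike.norm_conj, h1, one_mul, Real.norm_eq_abs,
      abs_mul]
    exact mul_le_mul_of_nonneg_left (mul_le_mul (hB' y) (hB' y) (norm_nonneg _)
      ((norm_nonneg _).trans (hB' y))) (by positivity)
  have hsum := hasSum_integral_of_summable_integral_norm hint (by
    refine Summable.of_nonneg_of_le (fun p => integral_nonneg fun y => norm_nonneg _) (fun p => ?_)
      ((IsLinearErrorProcess.summable_weight hβ).mul_right (B * B))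
    calc ∫ y, ‖F p y‖ ∂haarAddCircle ≤ ∫ _ : AddCircle (2 * Real.pi),
          |β p.1 * β p.2| * (B * B) ∂haarAddCircle :=
          integral_mono (hint p).norm (integrable_const _) (hnorm p)
      _ = |β p.1 * β p.2| * (B * B) := by simp)
  have hpt : ∀ y, ∑' p, F p y = ((‖transferFun β y * trigPoly v y‖ ^ 2 : ℝ) : ℂ) := by
    intro y
    have h1 := (hasSum_transferFun hβ y).mul_right (trigPoly v y)
    rw [← tsum_mul_conj h1]
    refine tsum_congr fun p => ?_
    simp only [hF, map_mul, Complex.conj_ofReal]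
    push_cast
    ring
  simp_rw [hpt] at hsum
  rw [integral_complex_ofReal] at hsum
  have hterm : ∀ p, ∫ y, F p y ∂haarAddCircle = ((β p.1 * β p.2 * ∑ s, ∑ t, v s * v t
      * if ((s : ℕ) : ℤ) - p.1 = ((t : ℕ) : ℤ) - p.2 then 1 else 0 : ℝ) : ℂ) := by
    intro p
    simp only [hF]
    rw [integral_const_mul, integral_trigPoly_term]
    push_cast
    simp only [apply_ite Complex.ofReal, Complex.ofReal_one, Complex.ofReal_zero]
  simp_rw [hterm] at hsum
  exact Complex.hasSum_ofReal.1 hsum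

end Fourier

variable {Ω : Type*} [MeasurableSpace Ω] {P : Measure Ω} [IsProbabilityMeasure P]
  {ℱ : Filtration ℤ (inferInstance : MeasurableSpace Ω)} {e α : ℤ → Ω → ℝ} {β : ℕ → ℝ}
  {σ S : ℝ}

/-- Both sides are sums of one and the same double series over lags, once through the covariances
and once through the circle. -/
theorem quadForm_errorCov_eq (h : IsLinearErrorProcess P ℱ e α β σ S) (hS : 4 < S)
    (hβ : Summable fun j => |β j|) (n : ℕ) (v : Fin n → ℝ) :
    quadForm (errorCov P e n) v
      = σ ^ 2 * ∫ y, ‖transferFun β y * trigPoly v y‖ ^ 2 ∂AddCircle.haarAddCircle := by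
  obtain ⟨C, hα⟩ := h.exists_isInnovation hS
  have h1 := (hasSum_integral_transferFun hβ n v).mul_left (σ ^ 2)
  have h2 := hasSum_sum (s := Finset.univ) fun (s : Fin n) _ =>
    hasSum_sum (s := Finset.univ) fun (t : Fin n) _ =>
      (h.hasSum_cov hα hβ (s : ℕ) (t : ℕ)).mul_left (v s * v t)
  have h3 : quadForm (errorCov P e n) v
      = ∑ s : Fin n, ∑ t : Fin n, v s * v t * ∫ ω, e (s : ℕ) ω * e (t : ℕ) ω ∂P := by
    simp only [quadForm, dotProduct, Matrix.mulVec, errorCov, Matrix.of_apply, Finset.mul_sum]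
    exact Finset.sum_congr rfl fun s _ => Finset.sum_congr rfl fun t _ => by ring
  rw [h3]
  refine h2.unique (h1.congr_fun fun p => ?_)
  simp only [Finset.mul_sum]
  refine Finset.sum_congr rfl fun s _ => Finset.sum_congr rfl fun t _ => ?_
  split_ifs <;> ring

/-- The eigenvalues of the covariance matrices of the errors are bounded away from `0` and `∞`. -/
theorem exists_quadForm_errorCov_bounds (h : IsLinearErrorProcess P ℱ e α β σ S) (hS : 4 < S)
    (hspec : IsSpectrallyRegular σ β) :
    ∃ c C : ℝ, 0 < c ∧ 0 < C ∧ ∀ (n : ℕ) (v : Fin n → ℝ),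
      c * (v ⬝ᵥ v) ≤ quadForm (errorCov P e n) v ∧
        quadForm (errorCov P e n) v ≤ C * (v ⬝ᵥ v) := by
  have hβ := hspec.summable_abs
  have hcont : Continuous fun y => ‖transferFun β y‖ ^ 2 :=
    (continuous_transferFun hβ).norm.pow 2
  -- By compactness the squared transfer function attains its extrema; the minimum is positive since
  -- it never vanishes.
  obtain ⟨y₀, -, hy₀⟩ := isCompact_univ.exists_isMinOn Set.univ_nonempty hcont.continuousOn
  obtain ⟨y₁, -, hy₁⟩ := isCompact_univ.exists_isMaxOn Set.univ_nonempty hcont.continuousOn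
  have hpos : ∀ y, 0 < ‖transferFun β y‖ ^ 2 := fun y =>
    pow_pos (norm_pos_iff.2 (transferFun_ne_zero hspec y)) 2
  have hσ : 0 < σ ^ 2 := sq_pos_of_ne_zero (ne_zero_of_isSpectrallyRegular hspec)
  refine ⟨σ ^ 2 * ‖transferFun β y₀‖ ^ 2, σ ^ 2 * ‖transferFun β y₁‖ ^ 2,
    mul_pos hσ (hpos _), mul_pos hσ (hpos _), fun n v => ?_⟩
  have hvv : v ⬝ᵥ v = ∫ y, ‖trigPoly v y‖ ^ 2 ∂AddCircle.haarAddCircle := by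
    rw [integral_norm_trigPoly_sq]
    simp [dotProduct, sq]
  have hint : ∀ {f : AddCircle (2 * Real.pi) → ℝ}, Continuous f →
      Integrable f AddCircle.haarAddCircle := fun hf =>
    hf.integrable_of_hasCompactSupport (HasCompactSupport.of_compactSpace _)
  have hi1 : Continuous fun y => ‖trigPoly v y‖ ^ 2 := (continuous_trigPoly v).norm.pow 2
  have hi2 : Continuous fun y => ‖transferFun β y * trigPoly v y‖ ^ 2 :=
    ((continuous_transferFun hβ).mul (continuous_trigPoly v)).norm.pow 2
  rw [quadForm_errorCov_eq h hS hβ, hvv, mul_assoc, mul_assoc]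
  constructor
  · refine mul_le_mul_of_nonneg_left ?_ hσ.le
    rw [← integral_const_mul]
    refine integral_mono (hint (continuous_const.mul hi1)) (hint hi2) fun y => ?_
    simp only [norm_mul, mul_pow]
    exact mul_le_mul_of_nonneg_right (hy₀ (Set.mem_univ y)) (by positivity)
  · refine mul_le_mul_of_nonneg_left ?_ hσ.le
    rw [← integral_const_mul]
    refine integral_mono (hint hi2) (hint (continuous_const.mul hi1)) fun y => ?_
    simp only [norm_mul, mul_pow]
    exact mul_le_mul_of_nonneg_right (hy₁ (Set.mem_univ y)) (by positivity)

/-! ### Averages of nested projections -/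

section Averaging

open RealInnerProductSpace

variable {E ι : Type*} [NormedAddCommGroup E] [InnerProductSpace ℝ E]

/-- All terms of the expanded square are nonnegative, so the single diagonal term at `a` is a lower
bound: averaging cannot cancel the contribution of one model. -/
theorem sq_mul_norm_sq_le_norm_sum_sq (F : Finset ι) (w : ι → ℝ) (hw : ∀ i, 0 ≤ w i) (z : ι → E)
    (hz : ∀ i j, 0 ≤ ⟪z i, z j⟫) {a : ι} (ha : a ∈ F) :
    w a ^ 2 * ‖z a‖ ^ 2 ≤ ‖∑ i ∈ F, w i • z i‖ ^ 2 := by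
  rw [← real_inner_self_eq_norm_sq (∑ i ∈ F, w i • z i), sum_inner]
  simp_rw [inner_sum, inner_smul_left, inner_smul_right]
  have h0 : ∀ i j, 0 ≤ (starRingEnd ℝ) (w i) * (w j * ⟪z i, z j⟫) := fun i j =>
    mul_nonneg (hw i) (mul_nonneg (hw j) (hz i j))
  refine le_trans ?_ (Finset.single_le_sum (fun i _ => Finset.sum_nonneg fun j _ => h0 i j) ha)
  refine le_trans ?_ (Finset.single_le_sum (fun j _ => h0 a j) ha)
  rw [real_inner_self_eq_norm_sq]
  simp [sq, mul_assoc]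

/-- The bound is asked only on the support of `w`, because the risks are compared with the largest
risk in that support. -/
theorem norm_sum_smul_le_of_sum_eq_one (F : Finset ι) (w : ι → ℝ) (hw : ∀ i, 0 ≤ w i)
    (hw1 : ∑ i ∈ F, w i = 1) {G : Type*} [SeminormedAddCommGroup G] [NormedSpace ℝ G]
    (z : ι → G) {c : ℝ} (hz : ∀ i ∈ F, w i ≠ 0 → ‖z i‖ ≤ c) : ‖∑ i ∈ F, w i • z i‖ ≤ c := by
  calc ‖∑ i ∈ F, w i • z i‖ ≤ ∑ i ∈ F, w i * c := by
        refine norm_sum_le_of_le _ fun i hi => ?_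
        rw [norm_smul, Real.norm_of_nonneg (hw i)]
        by_cases h0 : w i = 0
        · simp [h0]
        · exact mul_le_mul_of_nonneg_left (hz i hi h0) (hw i)
    _ = c := by rw [← Finset.sum_mul, hw1, one_mul]

variable (U : ι → Submodule ℝ E) [∀ i, (U i).HasOrthogonalProjection]

theorem inner_sub_starProjection_eq_zero {i : ι} {u : E} (hu : u ∈ U i) (v : E) :
    ⟪u, v - (U i).starProjection v⟫ = 0 := by
  rw [real_inner_comm]
  exact Submodule.starProjection_inner_eq_zero v u hu

theorem inner_starProjection_of_mem {i : ι} {u : E} (hu : u ∈ U i) (v : E) :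
    ⟪u, (U i).starProjection v⟫ = ⟪u, v⟫ := by
  have := inner_sub_starProjection_eq_zero U hu v
  rw [inner_sub_right] at this
  linarith

theorem norm_sub_starProjection_le (i : ι) (v : E) : ‖v - (U i).starProjection v‖ ≤ ‖v‖ := by
  have h := inner_sub_starProjection_eq_zero U (Submodule.starProjection_apply_mem (U i) v) v
  have h2 : ‖v‖ ^ 2 = ‖v - (U i).starProjection v‖ ^ 2 + ‖(U i).starProjection v‖ ^ 2 := by
    have h3 := norm_add_sq_real ((U i).starProjection v) (v - (U i).starProjection v)
    rw [h, add_sub_cancel] at h3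
    linarith
  exact le_of_sq_le_sq (by nlinarith [sq_nonneg ‖(U i).starProjection v‖]) (norm_nonneg _)

variable [LinearOrder ι]

/-- For nested subspaces the inner product is the squared norm of the smaller projection. -/
theorem inner_starProjection_starProjection_nonneg (hU : Monotone U) (i j : ι) (v : E) :
    0 ≤ ⟪(U i).starProjection v, (U j).starProjection v⟫ := by
  have key : ∀ i j, i ≤ j → 0 ≤ ⟪(U i).starProjection v, (U j).starProjection v⟫ := by
    intro i j hij
    have hmem := Submodule.starProjection_apply_mem (U i) v
    rw [inner_starProjection_of_mem U (hU hij hmem), ← inner_starProjection_of_mem U hmem,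
      real_inner_self_eq_norm_sq]
    positivity
  rcases le_total i j with h | h
  · exact key i j h
  · rw [real_inner_comm]; exact key j i h

/-- For nested subspaces the inner product is the squared norm of the residual from the larger
subspace. -/
theorem inner_sub_starProjection_sub_starProjection_nonneg (hU : Monotone U) (i j : ι) (v : E) :
    0 ≤ ⟪v - (U i).starProjection v, v - (U j).starProjection v⟫ := by
  have key : ∀ i j, i ≤ j → 0 ≤ ⟪v - (U i).starProjection v, v - (U j).starProjection v⟫ := by
    intro i j hij
    have h1 := inner_sub_starProjection_eq_zero U
      (hU hij (Submodule.starProjection_apply_mem (U i) v)) v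
    have h2 := inner_sub_starProjection_eq_zero U (Submodule.starProjection_apply_mem (U j) v) v
    have h3 : ⟪v - (U i).starProjection v, v - (U j).starProjection v⟫
        = ⟪v - (U j).starProjection v, v - (U j).starProjection v⟫ := by
      rw [inner_sub_left v, inner_sub_left v, h1, h2]
    rw [h3, real_inner_self_eq_norm_sq]
    positivity
  rcases le_total i j with h | h
  · exact key i j h
  · rw [real_inner_comm]; exact key j i h

/-- If `j ≤ i` the vectors are orthogonal. Otherwise `(P_j - P_i) μ` lies in `U j`, and the inner
product equals `⟪μ - P_i μ, e⟫ - ⟪μ - P_j μ, e⟫`. Hence control of one inner product per model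
suffices for all pairs of models. -/
theorem abs_inner_sub_starProjection_starProjection_le (hU : Monotone U) (μ e : E) {c : ℝ}
    {i j : ι} (hi : |⟪μ - (U i).starProjection μ, e⟫| ≤ c)
    (hj : |⟪μ - (U j).starProjection μ, e⟫| ≤ c) :
    |⟪μ - (U i).starProjection μ, (U j).starProjection e⟫| ≤ 2 * c := by
  have hc : 0 ≤ c := (abs_nonneg _).trans hi
  rcases le_total j i with h | h
  · rw [real_inner_comm, inner_sub_starProjection_eq_zero U
      (hU h (Submodule.starProjection_apply_mem (U j) e)) μ, abs_zero]
    positivity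
  · have hmem : (U j).starProjection μ - (U i).starProjection μ ∈ U j :=
      (U j).sub_mem (Submodule.starProjection_apply_mem _ _)
        (hU h (Submodule.starProjection_apply_mem _ _))
    have h1 : ⟪μ - (U i).starProjection μ, (U j).starProjection e⟫
        = ⟪μ - (U i).starProjection μ, e⟫ - ⟪μ - (U j).starProjection μ, e⟫ := by
      have h2 := inner_starProjection_of_mem U hmem e
      have h3 : ⟪μ - (U j).starProjection μ, (U j).starProjection e⟫ = 0 := by
        rw [real_inner_comm]
        exact inner_sub_starProjection_eq_zero U (Submodule.starProjection_apply_mem _ _) μ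
      simp only [inner_sub_left] at h2 h3 ⊢
      linarith
    rw [h1]
    rw [abs_le] at hi hj ⊢
    constructor <;> linarith [hi.1, hi.2, hj.1, hj.2]

omit [LinearOrder ι] in
/-- Solutions of perturbed normal equations are close to the orthogonal projection. -/
theorem norm_sub_starProjection_le_of_normal_eq {i : ι} {y p : E} {Δ : E →L[ℝ] E}
    (hΔ : ‖Δ‖ ≤ 1 / 2) (hp : p ∈ U i) (hn : ∀ u ∈ U i, ⟪u, y - p + Δ (y - p)⟫ = 0) :
    ‖p - (U i).starProjection y‖ ≤ 2 * ‖Δ‖ * ‖y - (U i).starProjection y‖ := by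
  set d := p - (U i).starProjection y with hd
  set r := y - (U i).starProjection y with hr
  have hdU : d ∈ U i := (U i).sub_mem hp (Submodule.starProjection_apply_mem _ _)
  -- Testing the perturbed equations with `d` itself gives `‖d‖² = ⟪d, Δ r⟫ - ⟪d, Δ d⟫`; since `‖Δ‖
  -- ≤ 1/2`, the last term is absorbed on the left.
  have h1 := hn d hdU
  have h2 : ⟪d, r⟫ = 0 := inner_sub_starProjection_eq_zero U hdU y
  have h3 : y - p = r - d := by rw [hr, hd]; abel
  rw [h3, map_sub, inner_add_right, inner_sub_right d r d, inner_sub_right d (Δ r), h2,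
    real_inner_self_eq_norm_sq] at h1
  have h4 : ⟪d, Δ r⟫ ≤ ‖d‖ * (‖Δ‖ * ‖r‖) :=
    (real_inner_le_norm _ _).trans (mul_le_mul_of_nonneg_left (Δ.le_opNorm r) (norm_nonneg _))
  have h5 : -⟪d, Δ d⟫ ≤ ‖d‖ * (‖Δ‖ * ‖d‖) :=
    (neg_le_abs _).trans ((abs_real_inner_le_norm _ _).trans
      (mul_le_mul_of_nonneg_left (Δ.le_opNorm d) (norm_nonneg _)))
  rcases (norm_nonneg d).eq_or_lt with h0 | h0
  · rw [← h0]; positivity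
  · have h6 : ‖Δ‖ * ‖d‖ ≤ 1 / 2 * ‖d‖ := mul_le_mul_of_nonneg_right hΔ h0.le
    have h7 : ‖d‖ * ‖d‖ ≤ ‖d‖ * (2 * ‖Δ‖ * ‖r‖) := by
      nlinarith [mul_le_mul_of_nonneg_left h6 h0.le]
    exact le_of_mul_le_mul_left h7 h0

/-- Here `g` is the estimation error, `e - g` the residual and `2 * c` the penalty. The subtracted
terms in `e` alone do not depend on the weights; what remains beyond the loss `‖g‖ ^ 2` is the
penalty mismatch and terms linear in `Δ`. -/
theorem criterion_sub_eq (e g : E) (Δ : E →L[ℝ] E) (c : ℝ) :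
    ⟪e - g, e - g + Δ (e - g)⟫ + 2 * c - (‖e‖ ^ 2 + ⟪e, Δ e⟫) - ‖g‖ ^ 2
      = -2 * (⟪e, g⟫ - c) - ⟪e, Δ g⟫ - ⟪g, Δ e⟫ + ⟪g, Δ g⟫ := by
  have h1 := norm_sub_sq_real e g
  rw [inner_add_right, real_inner_self_eq_norm_sq, h1, map_sub, inner_sub_right (e - g),
    inner_sub_left e g, inner_sub_left e g]
  ring

/-- The mismatch counts twice, giving `20 ε R²`. Each mixed term is at most `ε/2 (R² + ‖g‖²)` by the
arithmetic–geometric mean inequality, and `⟪g, Δ g⟫` adds `ε ‖g‖²`. -/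
theorem abs_criterion_sub_le {ε K R : ℝ} {Δ : E →L[ℝ] E} {e : E} (hΔ : ‖Δ‖ ≤ ε)
    (hΔe : ‖Δ‖ * ‖e‖ ≤ ε * √K) (hε : 0 ≤ ε) (hKR : √K ≤ R) (g : E) (c : ℝ)
    (heg : |⟪e, g⟫ - c| ≤ 10 * ε * R ^ 2) :
    |⟪e - g, e - g + Δ (e - g)⟫ + 2 * c - (‖e‖ ^ 2 + ⟪e, Δ e⟫) - ‖g‖ ^ 2|
      ≤ 21 * ε * R ^ 2 + 2 * ε * ‖g‖ ^ 2 := by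
  rw [criterion_sub_eq]
  have hKg : ε * √K * ‖g‖ ≤ ε / 2 * (R ^ 2 + ‖g‖ ^ 2) := by
    have h2 : √K * ‖g‖ ≤ R * ‖g‖ := mul_le_mul_of_nonneg_right hKR (norm_nonneg _)
    have h3 : R * ‖g‖ ≤ (R ^ 2 + ‖g‖ ^ 2) / 2 := by nlinarith [sq_nonneg (R - ‖g‖)]
    have := mul_le_mul_of_nonneg_left (h2.trans h3) hε
    linarith
  have h2 : |⟪e, Δ g⟫| ≤ ε * √K * ‖g‖ := by
    calc |⟪e, Δ g⟫| ≤ ‖e‖ * (‖Δ‖ * ‖g‖) := (abs_real_inner_le_norm _ _).trans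
          (mul_le_mul_of_nonneg_left (Δ.le_opNorm g) (norm_nonneg _))
      _ = (‖Δ‖ * ‖e‖) * ‖g‖ := by ring
      _ ≤ ε * √K * ‖g‖ := mul_le_mul_of_nonneg_right hΔe (norm_nonneg _)
  have h3 : |⟪g, Δ e⟫| ≤ ε * √K * ‖g‖ := by
    calc |⟪g, Δ e⟫| ≤ ‖g‖ * (‖Δ‖ * ‖e‖) := (abs_real_inner_le_norm _ _).trans
          (mul_le_mul_of_nonneg_left (Δ.le_opNorm e) (norm_nonneg _))
      _ = (‖Δ‖ * ‖e‖) * ‖g‖ := by ring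
      _ ≤ ε * √K * ‖g‖ := mul_le_mul_of_nonneg_right hΔe (norm_nonneg _)
  have h4 : |⟪g, Δ g⟫| ≤ ε * ‖g‖ ^ 2 := by
    calc |⟪g, Δ g⟫| ≤ ‖g‖ * (‖Δ‖ * ‖g‖) := (abs_real_inner_le_norm _ _).trans
          (mul_le_mul_of_nonneg_left (Δ.le_opNorm g) (norm_nonneg _))
      _ = ‖Δ‖ * ‖g‖ ^ 2 := by ring
      _ ≤ ε * ‖g‖ ^ 2 := mul_le_mul_of_nonneg_right hΔ (sq_nonneg _)
  rw [abs_le] at heg h2 h3 h4 ⊢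
  constructor <;> linarith [heg.1, heg.2, h2.1, h2.2, h3.1, h3.2, h4.1, h4.2]

/-- Data of a least squares averaging problem with nested subspaces on which the noise behaves
regularly up to the precision `ε`. Here `p i` solves the normal equations of the weighted inner
product given by `1 + Δ`. -/
structure IsRegularAveraging [Fintype ι] (μ e : E) (k : ι → ℝ) (Δ : E →L[ℝ] E) (p : ι → E)
    (K ε : ℝ) : Prop where
  mono : Monotone U
  K_pos : 0 < K
  K_le : ∀ i, K ≤ ‖μ - (U i).starProjection μ‖ ^ 2 + k i
  k_nonneg : ∀ i, 0 ≤ k i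
  noise_sq : ∀ i, |‖(U i).starProjection e‖ ^ 2 - k i|
    ≤ ε * (‖μ - (U i).starProjection μ‖ ^ 2 + k i)
  noise_inner : ∀ i, |⟪μ - (U i).starProjection μ, e⟫|
    ≤ ε * (‖μ - (U i).starProjection μ‖ ^ 2 + k i)
  norm_le : ‖Δ‖ ≤ ε
  norm_mul_le : ‖Δ‖ * ‖e‖ ≤ ε * √K
  mem : ∀ i, p i ∈ U i
  normal_eq : ∀ i, ∀ u ∈ U i, ⟪u, μ + e - p i + Δ (μ + e - p i)⟫ = 0

/-- Weights on the simplex whose nonzero entries are at least `δ`. -/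
structure IsWeight [Fintype ι] (δ : ℝ) (w : ι → ℝ) : Prop where
  nonneg : ∀ i, 0 ≤ w i
  sum_eq_one : ∑ i, w i = 1
  le_of_ne_zero : ∀ i, w i ≠ 0 → δ ≤ w i

set_option maxHeartbeats 1000000 in
/-- The loss of the weighted orthogonal projections, the loss of the weighted solutions of the
normal equations and the averaging criterion (up to a constant) agree up to a small relative
error. -/
theorem IsRegularAveraging.loss_bounds [Fintype ι] {μ e : E} {k : ι → ℝ} {Δ : E →L[ℝ] E}
    {p : ι → E} {K ε δ : ℝ} (h : IsRegularAveraging U μ e k Δ p K ε) (hδ : 0 < δ) (hδ1 : δ ≤ 1)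
    (hε : ε ≤ δ ^ 2 / 10) {w : ι → ℝ} (hw : IsWeight δ w) :
    δ ^ 2 / 2 * K ≤ ‖∑ i, w i • (U i).starProjection (μ + e) - μ‖ ^ 2 ∧
    |‖∑ i, w i • p i - μ‖ ^ 2 - ‖∑ i, w i • (U i).starProjection (μ + e) - μ‖ ^ 2|
      ≤ 66 * ε / δ ^ 2 * ‖∑ i, w i • (U i).starProjection (μ + e) - μ‖ ^ 2 ∧
    |⟪μ + e - ∑ i, w i • p i, μ + e - ∑ i, w i • p i + Δ (μ + e - ∑ i, w i • p i)⟫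
        + 2 * ∑ i, w i * k i - (‖e‖ ^ 2 + ⟪e, Δ e⟫)
        - ‖∑ i, w i • (U i).starProjection (μ + e) - μ‖ ^ 2|
      ≤ 66 * ε / δ ^ 2 * ‖∑ i, w i • (U i).starProjection (μ + e) - μ‖ ^ 2 := by
  classical
  set D : ι → ℝ := fun i => ‖μ - (U i).starProjection μ‖ ^ 2 + k i with hD
  have hε0 : 0 ≤ ε := (norm_nonneg _).trans h.norm_le
  have hδ2 : δ ^ 2 ≤ 1 := pow_le_one₀ hδ.le hδ1
  have hδ20 : 0 < δ ^ 2 := by positivity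
  have hε1 : ε ≤ 1 / 10 := by linarith
  -- the index of the support with the largest risk
  have hne : (Finset.univ.filter fun i => w i ≠ 0).Nonempty := by
    rw [Finset.nonempty_iff_ne_empty]
    intro h0
    have h1 : ∀ i, w i = 0 := fun i => by
      by_contra hi
      have : i ∈ (Finset.univ.filter fun i => w i ≠ 0) := by simp [hi]
      simp [h0] at this
    have := hw.sum_eq_one
    simp [h1] at this
  obtain ⟨a, ha, hmax⟩ := Finset.exists_max_image _ D hne
  have ha0 : w a ≠ 0 := (Finset.mem_filter.1 ha).2
  have hDa : ∀ i, w i ≠ 0 → D i ≤ D a := fun i hi => hmax i (by simp [hi])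
  have hD0 : 0 < D a := h.K_pos.trans_le (h.K_le a)
  have hwa : δ ^ 2 ≤ w a ^ 2 := pow_le_pow_left₀ hδ.le (hw.le_of_ne_zero a ha0) 2
  set R := √(D a) with hR
  have hR2 : R ^ 2 = D a := Real.sq_sqrt hD0.le
  have hR0 : 0 ≤ R := Real.sqrt_nonneg _
  have hKR : √K ≤ R := Real.sqrt_le_sqrt (h.K_le a)
  -- decomposition of the errors
  set z := ∑ i, w i • (μ - (U i).starProjection μ) with hz
  set q := ∑ i, w i • (U i).starProjection e with hq
  set d : ι → E := fun i => p i - (U i).starProjection (μ + e) with hd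
  have hg0 : ∑ i, w i • (U i).starProjection (μ + e) - μ = q - z := by
    have : μ = ∑ i, w i • μ := by rw [← Finset.sum_smul, hw.sum_eq_one, one_smul]
    rw [hq, hz, ← Finset.sum_sub_distrib]
    conv_lhs => rw [this]
    rw [← Finset.sum_sub_distrib]
    refine Finset.sum_congr rfl fun i _ => ?_
    rw [map_add, ← Finset.sum_smul, hw.sum_eq_one, one_smul]
    module
  have hg : ∑ i, w i • p i - μ = (q - z) + ∑ i, w i • d i := by
    rw [← hg0]
    simp only [hd, smul_sub, Finset.sum_sub_distrib]
    abel
  -- lower bound for the loss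
  have hcross : |⟪z, q⟫| ≤ 2 * (ε * D a) := by
    rw [hz, sum_inner, ← Real.norm_eq_abs]
    simp_rw [inner_smul_left, hq, inner_sum, inner_smul_right]
    refine norm_sum_smul_le_of_sum_eq_one _ w hw.nonneg hw.sum_eq_one
      (fun i => ∑ j, w j * ⟪μ - (U i).starProjection μ, (U j).starProjection e⟫) fun i _ hi => ?_
    refine norm_sum_smul_le_of_sum_eq_one _ w hw.nonneg hw.sum_eq_one
      (fun j => ⟪μ - (U i).starProjection μ, (U j).starProjection e⟫) fun j _ hj => ?_
    exact abs_inner_sub_starProjection_starProjection_le U h.mono μ e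
      ((h.noise_inner i).trans (mul_le_mul_of_nonneg_left (hDa i hi) hε0))
      ((h.noise_inner j).trans (mul_le_mul_of_nonneg_left (hDa j hj) hε0))
  have hzlow : δ ^ 2 * ‖μ - (U a).starProjection μ‖ ^ 2 ≤ ‖z‖ ^ 2 :=
    (mul_le_mul_of_nonneg_right hwa (sq_nonneg _)).trans
      (sq_mul_norm_sq_le_norm_sum_sq Finset.univ w hw.nonneg
        (fun i => μ - (U i).starProjection μ)
        (fun i j => inner_sub_starProjection_sub_starProjection_nonneg U h.mono i j μ)
        (Finset.mem_univ a))
  have hqlow : δ ^ 2 * ‖(U a).starProjection e‖ ^ 2 ≤ ‖q‖ ^ 2 :=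
    (mul_le_mul_of_nonneg_right hwa (sq_nonneg _)).trans
      (sq_mul_norm_sq_le_norm_sum_sq Finset.univ w hw.nonneg
        (fun i => (U i).starProjection e)
        (fun i j => inner_starProjection_starProjection_nonneg U h.mono i j e)
        (Finset.mem_univ a))
  set L := ‖q - z‖ ^ 2 with hL
  -- The squares contribute at least `δ² (1 - ε) D a` and the cross term costs at most `4 ε D a`, so
  -- `L ≥ (δ² - 5 ε) D a`; this is where `ε ≤ δ² / 10` is needed.
  have hLlow : δ ^ 2 / 2 * D a ≤ L := by
    have h1 : L = ‖q‖ ^ 2 - 2 * ⟪q, z⟫ + ‖z‖ ^ 2 := norm_sub_sq_real q z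
    rw [real_inner_comm] at h1
    have h2 := (abs_le.1 (h.noise_sq a)).1
    have h3 : D a = ‖μ - (U a).starProjection μ‖ ^ 2 + k a := rfl
    rw [← h3] at h2
    have h4 := mul_le_mul_of_nonneg_left h2 hδ20.le
    have h5 : ε * D a ≤ δ ^ 2 / 10 * D a := mul_le_mul_of_nonneg_right hε hD0.le
    have h6 : δ ^ 2 * (ε * D a) ≤ 1 * (ε * D a) :=
      mul_le_mul_of_nonneg_right hδ2 (by positivity)
    have h7 : δ ^ 2 * D a
        = δ ^ 2 * ‖μ - (U a).starProjection μ‖ ^ 2 + δ ^ 2 * k a := by rw [h3]; ring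
    have h8 := (abs_le.1 hcross).2
    nlinarith
  have hLpos : 0 < L := lt_of_lt_of_le (by positivity) hLlow
  have hDL : D a ≤ 2 / δ ^ 2 * L := by
    rw [div_mul_eq_mul_div, le_div_iff₀ hδ20]
    linarith
  -- the perturbation of the projections
  have hdi : ∀ i, w i ≠ 0 → ‖d i‖ ≤ 4 * ε * R := by
    intro i hi
    have h1 := norm_sub_starProjection_le_of_normal_eq U (y := μ + e)
      (h.norm_le.trans (by linarith))
      (h.mem i) (h.normal_eq i)
    have h2 : ‖μ + e - (U i).starProjection (μ + e)‖ ≤ R + ‖e‖ := by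
      have h3 : μ + e - (U i).starProjection (μ + e)
          = (μ - (U i).starProjection μ) + (e - (U i).starProjection e) := by
        rw [map_add]; abel
      rw [h3]
      refine (norm_add_le _ _).trans (add_le_add ?_ (norm_sub_starProjection_le U i e))
      refine Real.le_sqrt_of_sq_le (le_trans ?_ (hDa i hi))
      simp only [hD]
      linarith [h.k_nonneg i]
    calc ‖d i‖ ≤ 2 * ‖Δ‖ * (R + ‖e‖) :=
          h1.trans (mul_le_mul_of_nonneg_left h2 (by positivity))
      _ = 2 * (‖Δ‖ * R) + 2 * (‖Δ‖ * ‖e‖) := by ring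
      _ ≤ 2 * (ε * R) + 2 * (ε * R) := by
          have h4 := mul_le_mul_of_nonneg_right h.norm_le hR0
          have h5 := h.norm_mul_le.trans (mul_le_mul_of_nonneg_left hKR hε0)
          linarith
      _ = 4 * ε * R := by ring
  set dw := ∑ i, w i • d i with hdw
  have hdn : ‖dw‖ ≤ 4 * ε * R :=
    norm_sum_smul_le_of_sum_eq_one _ w hw.nonneg hw.sum_eq_one d fun i _ hi => hdi i hi
  have hdn2 : ‖dw‖ ^ 2 ≤ 2 * ε * D a := by
    calc ‖dw‖ ^ 2 ≤ (4 * ε * R) ^ 2 := pow_le_pow_left₀ (norm_nonneg _) hdn 2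
      _ = 16 * ε * (ε * D a) := by rw [← hR2]; ring
      _ ≤ 2 * ε * D a := by nlinarith [mul_nonneg hε0 hD0.le]
  set g := q - z + dw with hgdef
  have hdiff : |‖g‖ ^ 2 - L| ≤ 6 * ε * D a + 4 * ε * L := by
    have h1 : ‖g‖ ^ 2 = L + 2 * ⟪q - z, dw⟫ + ‖dw‖ ^ 2 := norm_add_sq_real _ _
    have h2 : |⟪q - z, dw⟫| ≤ ‖q - z‖ * (4 * ε * R) :=
      (abs_real_inner_le_norm _ _).trans (mul_le_mul_of_nonneg_left hdn (norm_nonneg _))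
    have h3 : ‖q - z‖ * R ≤ (L + D a) / 2 := by
      rw [hL, ← hR2]
      nlinarith [sq_nonneg (‖q - z‖ - R)]
    have h4 : ‖q - z‖ * (4 * ε * R) ≤ 2 * ε * (L + D a) := by nlinarith
    have h5 := sq_nonneg ‖dw‖
    rw [h1, abs_le]
    rw [abs_le] at h2
    constructor <;> linarith [h2.1, h2.2]
  have hgL : ‖g‖ ^ 2 ≤ 2 * L + D a := by
    have h1 := (abs_le.1 hdiff).2
    nlinarith [mul_le_mul_of_nonneg_right hε1 hD0.le, mul_le_mul_of_nonneg_right hε1 hLpos.le]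
  -- the criterion
  have heg : |⟪e, g⟫ - ∑ i, w i * k i| ≤ 10 * ε * D a := by
    have h1 : ⟪e, g⟫ - ∑ i, w i * k i = ∑ i, w i • ((‖(U i).starProjection e‖ ^ 2 - k i)
        - ⟪μ - (U i).starProjection μ, e⟫ + ⟪e, d i⟫) := by
      have h2 : ∀ i, ⟪e, (U i).starProjection e⟫ = ‖(U i).starProjection e‖ ^ 2 := fun i => by
        rw [← real_inner_self_eq_norm_sq, inner_starProjection_of_mem U
          (Submodule.starProjection_apply_mem (U i) e), real_inner_comm]
      rw [hgdef, inner_add_right, inner_sub_right, hq, hz, hdw, inner_sum, inner_sum, inner_sum]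
      simp_rw [inner_smul_right, h2, real_inner_comm _ e, smul_eq_mul]
      rw [← Finset.sum_sub_distrib, ← Finset.sum_add_distrib, ← Finset.sum_sub_distrib]
      exact Finset.sum_congr rfl fun i _ => by ring
    rw [h1, ← Real.norm_eq_abs]
    refine norm_sum_smul_le_of_sum_eq_one _ w hw.nonneg hw.sum_eq_one _ fun i _ hi => ?_
    rw [Real.norm_eq_abs]
    have h3 := (h.noise_sq i).trans (mul_le_mul_of_nonneg_left (hDa i hi) hε0)
    have h4 := (h.noise_inner i).trans (mul_le_mul_of_nonneg_left (hDa i hi) hε0)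
    have hdU : d i ∈ U i := (U i).sub_mem (h.mem i) (Submodule.starProjection_apply_mem _ _)
    have h5 : ‖(U i).starProjection e‖ ≤ 2 * R := by
      refine le_of_sq_le_sq ?_ (by positivity)
      have hki : k i ≤ D i := by simp only [hD]; linarith [sq_nonneg ‖μ - (U i).starProjection μ‖]
      have := (abs_le.1 h3).2
      have hb := mul_le_mul_of_nonneg_right hε1 hD0.le
      have hc := hDa i hi
      rw [mul_pow, hR2]
      linarith
    -- Since `d i` lies in `U i`, the noise enters only through its projection, of norm at most `2 *
    -- R`. With the two noise bounds this gives `10 = 1 + 1 + 8`.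
    have h6 : |⟪e, d i⟫| ≤ 8 * ε * D a := by
      rw [real_inner_comm, ← inner_starProjection_of_mem U hdU]
      calc |⟪d i, (U i).starProjection e⟫| ≤ ‖d i‖ * ‖(U i).starProjection e‖ :=
            abs_real_inner_le_norm _ _
        _ ≤ (4 * ε * R) * (2 * R) :=
            mul_le_mul (hdi i hi) h5 (norm_nonneg _) (by positivity)
        _ = 8 * ε * D a := by rw [← hR2]; ring
    rw [abs_le] at h3 h4 h6 ⊢
    constructor <;> linarith [h3.1, h3.2, h4.1, h4.2, h6.1, h6.2]
  have hcrit := abs_criterion_sub_le h.norm_le h.norm_mul_le hε0 hKR g (∑ i, w i * k i)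
    (by rw [hR2]; exact heg)
  rw [hR2] at hcrit
  have hres : μ + e - ∑ i, w i • p i = e - g := by
    rw [← hg]; abel
  -- The criterion costs `21 ε D + 2 ε (2 L + D)` and the passage from `‖g‖²` to `L` costs `6 ε D +
  -- 4 ε L`, in total `29 ε D + 8 ε L`. Substituting `D ≤ 2 L / δ²` and `1 ≤ 1 / δ²` gives `58 + 8 =
  -- 66`.
  have hfin : 27 * ε * D a + 8 * ε * L + 2 * ε * D a ≤ 66 * ε / δ ^ 2 * L := by
    have h1 : ε * L ≤ ε / δ ^ 2 * L := by
      refine mul_le_mul_of_nonneg_right ?_ hLpos.le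
      rw [le_div_iff₀ hδ20]
      nlinarith
    have h2 : ε * D a ≤ ε * (2 / δ ^ 2 * L) := mul_le_mul_of_nonneg_left hDL hε0
    have h3 : 66 * ε / δ ^ 2 * L = 66 * (ε / δ ^ 2 * L) := by ring
    have h4 : ε * (2 / δ ^ 2 * L) = 2 * (ε / δ ^ 2 * L) := by ring
    rw [h3]
    linarith
  have hεD : 0 ≤ ε * D a := mul_nonneg hε0 hD0.le
  have hεL : 0 ≤ ε * L := mul_nonneg hε0 hLpos.le
  rw [hg0, hg, hres]
  refine ⟨le_trans (mul_le_mul_of_nonneg_left (h.K_le a) (by positivity)) hLlow,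
    hdiff.trans (by linarith), ?_⟩
  have h1 := mul_le_mul_of_nonneg_left hgL hε0
  rw [abs_le] at hcrit hdiff ⊢
  constructor <;> linarith [hcrit.1, hcrit.2, hdiff.1, hdiff.2]

end Averaging

/-! ### Minimizers of approximate criteria. -/

/-- A minimizer of a criterion that approximates the loss `L` nearly minimizes `L`. -/
theorem abs_div_sInf_sub_one_le {X : Type*} {H : Set X} {L LF C : X → ℝ} {c κ : ℝ} {x : X}
    (hκ : κ ≤ 1 / 3) (hx : x ∈ H) (hmin : IsMinOn C H x)
    (hpos : ∃ l, 0 < l ∧ ∀ w ∈ H, l ≤ L w)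
    (hLF : ∀ w ∈ H, |LF w - L w| ≤ κ * L w) (hC : ∀ w ∈ H, |C w - c - L w| ≤ κ * L w) :
    |LF x / sInf (L '' H) - 1| ≤ 5 * κ := by
  obtain ⟨l, hl, hlL⟩ := hpos
  set I := sInf (L '' H) with hI
  have hne : (L '' H).Nonempty := ⟨_, Set.mem_image_of_mem L hx⟩
  have hlI : l ≤ I := le_csInf hne (by rintro _ ⟨w, hw, rfl⟩; exact hlL w hw)
  have hI0 : 0 < I := hl.trans_le hlI
  have hIx : I ≤ L x := csInf_le ⟨l, by rintro _ ⟨w, hw, rfl⟩; exact hlL w hw⟩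
    (Set.mem_image_of_mem L hx)
  have hLx : 0 < L x := hI0.trans_le hIx
  have hκ0 : 0 ≤ κ := by
    by_contra hneg
    have := (abs_nonneg _).trans (hLF x hx)
    nlinarith
  -- For every `w`, `(1 - κ) L x ≤ C x - c ≤ C w - c ≤ (1 + κ) L w`; then take the infimum over `w`.
  have hup : (1 - κ) * L x / (1 + κ) ≤ I := by
    refine le_csInf hne ?_
    rintro _ ⟨w, hw, rfl⟩
    rw [div_le_iff₀ (by linarith)]
    have h1 := (abs_le.1 (hC x hx)).1
    have h2 := (abs_le.1 (hC w hw)).2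
    have h3 : C x ≤ C w := hmin hw
    nlinarith
  rw [div_le_iff₀ (by linarith)] at hup
  have h1 := abs_le.1 (hLF x hx)
  have h2 : |LF x - I| ≤ 5 * κ * I := by
    rw [abs_le]
    constructor
    · nlinarith [h1.1]
    · have h3 : LF x ≤ (1 + κ) * L x := by linarith [h1.2]
      have h4 : (1 - κ) * LF x ≤ (1 + κ) * (I * (1 + κ)) := by
        calc (1 - κ) * LF x ≤ (1 - κ) * ((1 + κ) * L x) :=
              mul_le_mul_of_nonneg_left h3 (by linarith)
          _ = (1 + κ) * ((1 - κ) * L x) := by ring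
          _ ≤ (1 + κ) * (I * (1 + κ)) := mul_le_mul_of_nonneg_left hup (by linarith)
      -- The difference of the two sides is `2 κ (1 - 3 κ) I`, whence the condition `κ ≤ 1 / 3`.
      have h5 : (1 + κ) * (I * (1 + κ)) ≤ (1 - κ) * ((1 + 5 * κ) * I) := by
        have : 0 ≤ κ * (1 - 3 * κ) := mul_nonneg hκ0 (by linarith)
        nlinarith [mul_nonneg this hI0.le]
      have h6 := le_of_mul_le_mul_left (h4.trans h5) (by linarith : (0 : ℝ) < 1 - κ)
      linarith
  rw [div_sub_one hI0.ne', abs_div, abs_of_pos hI0, div_le_iff₀ hI0]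
  exact h2

/-! ### Generalized least squares and orthogonal projections -/

section GLS

open Matrix RealInnerProductSpace

/-- Symmetric matrices with eigenvalues in `[c, C]`. -/
structure HasSpectralBounds {n : ℕ} (Sig : Matrix (Fin n) (Fin n) ℝ) (c C : ℝ) : Prop where
  symm : Sigᵀ = Sig
  pos : 0 < c
  lower : ∀ v, c * (v ⬝ᵥ v) ≤ quadForm Sig v
  upper : ∀ v, quadForm Sig v ≤ C * (v ⬝ᵥ v)

variable {n k : ℕ} {Sig : Matrix (Fin n) (Fin n) ℝ} {c C : ℝ}

theorem dotProduct_self_nonneg' (v : Fin n → ℝ) : 0 ≤ v ⬝ᵥ v :=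
  Finset.sum_nonneg fun i _ => mul_self_nonneg (v i)

theorem dotProduct_self_pos {v : Fin n → ℝ} (hv : v ≠ 0) : 0 < v ⬝ᵥ v :=
  (dotProduct_self_nonneg' v).lt_of_ne fun h => hv (dotProduct_self_eq_zero.1 h.symm)

theorem dotProduct_mulVec_comm {A : Matrix (Fin n) (Fin n) ℝ} (hA : Aᵀ = A) (u v : Fin n → ℝ) :
    u ⬝ᵥ A *ᵥ v = (A *ᵥ u) ⬝ᵥ v := by
  rw [dotProduct_mulVec, ← mulVec_transpose, hA]

namespace HasSpectralBounds

theorem posDef (h : HasSpectralBounds Sig c C) : Sig.PosDef := by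
  refine PosDef.of_dotProduct_mulVec_pos ?_ fun v hv => ?_
  · rw [IsHermitian, conjTranspose_eq_transpose_of_trivial, h.symm]
  · simp only [star_trivial]
    exact (mul_pos h.pos (dotProduct_self_pos hv)).trans_le (h.lower v)

theorem mul_inv (h : HasSpectralBounds Sig c C) : Sig * Sig⁻¹ = 1 :=
  Matrix.mul_nonsing_inv _ ((Matrix.isUnit_iff_isUnit_det _).1 h.posDef.isUnit)

theorem inv_mul (h : HasSpectralBounds Sig c C) : Sig⁻¹ * Sig = 1 :=
  Matrix.nonsing_inv_mul _ ((Matrix.isUnit_iff_isUnit_det _).1 h.posDef.isUnit)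

theorem inv_symm (h : HasSpectralBounds Sig c C) : (Sig⁻¹)ᵀ = Sig⁻¹ := by
  rw [transpose_nonsing_inv, h.symm]

theorem invSqrt_mul_self (h : HasSpectralBounds Sig c C) : invSqrt Sig * invSqrt Sig = Sig⁻¹ := by
  open scoped MatrixOrder in
  exact CFC.sqrt_mul_sqrt_self _ h.posDef.inv.posSemidef.nonneg

theorem invSqrt_symm (_h : HasSpectralBounds Sig c C) : (invSqrt Sig)ᵀ = invSqrt Sig := by
  open scoped MatrixOrder in
  have h1 : (0 : Matrix (Fin n) (Fin n) ℝ) ≤ invSqrt Sig := CFC.sqrt_nonneg _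
  have h2 := (Matrix.nonneg_iff_posSemidef.1 h1).isHermitian
  rwa [IsHermitian, conjTranspose_eq_transpose_of_trivial] at h2

/-- With `u = Σ⁻¹ v`, expand `0 ≤ ‖c u - v‖²` and use `c ‖u‖² ≤ u'Σu = v'u`; no diagonalization is
needed. -/
theorem quadForm_inv_le (h : HasSpectralBounds Sig c C) (v : Fin n → ℝ) :
    quadForm Sig⁻¹ v ≤ c⁻¹ * (v ⬝ᵥ v) := by
  set u := Sig⁻¹ *ᵥ v with hu
  have h1 : quadForm Sig u = v ⬝ᵥ u := by
    rw [quadForm, hu, mulVec_mulVec, h.mul_inv, one_mulVec, dotProduct_comm]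
  have h2 := h.lower u
  rw [h1] at h2
  have h3 : 0 ≤ (c • u - v) ⬝ᵥ (c • u - v) := dotProduct_self_nonneg' _
  have h4 : (c • u - v) ⬝ᵥ (c • u - v) = c ^ 2 * (u ⬝ᵥ u) - 2 * c * (v ⬝ᵥ u) + v ⬝ᵥ v := by
    rw [sub_dotProduct, dotProduct_sub, dotProduct_sub, smul_dotProduct, smul_dotProduct,
      dotProduct_smul, dotProduct_smul, dotProduct_comm u v]
    simp only [smul_eq_mul]
    ring
  have h5 : quadForm Sig⁻¹ v = v ⬝ᵥ u := rfl
  rw [h5, inv_mul_eq_div, le_div_iff₀ h.pos]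
  nlinarith [h.pos]

theorem C_pos [NeZero n] (h : HasSpectralBounds Sig c C) : 0 < C := by
  have h1 : 0 < (1 : Fin n → ℝ) ⬝ᵥ 1 := dotProduct_self_pos one_ne_zero
  have h2 := (h.lower 1).trans (h.upper 1)
  have h3 := le_of_mul_le_mul_right h2 h1
  exact h.pos.trans_le h3

end HasSpectralBounds

theorem mul_mulVec_injective_of_rank_eq {X : Matrix (Fin n) (Fin k) ℝ} (hX : X.rank = k) :
    Function.Injective X.mulVec := by
  have h1 := LinearMap.finrank_range_add_finrank_ker X.mulVecLin
  rw [Module.finrank_fin_fun] at h1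
  have h2 : Module.finrank ℝ (LinearMap.ker X.mulVecLin) = 0 := by
    have : X.rank = Module.finrank ℝ (LinearMap.range X.mulVecLin) := rfl
    omega
  rw [Submodule.finrank_eq_zero, LinearMap.ker_eq_bot] at h2
  exact h2

/-- A kernel vector `v` of `X'WX` would make the form of `W` vanish at `X v ≠ 0`. Symmetry of `W`
plays no role, which matters for an arbitrary estimate. -/
theorem isUnit_det_gram {X : Matrix (Fin n) (Fin k) ℝ} (hX : X.rank = k)
    {W : Matrix (Fin n) (Fin n) ℝ} (hW : ∀ v, v ≠ 0 → 0 < quadForm W v) :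
    IsUnit (Xᵀ * W * X).det := by
  rw [← Matrix.isUnit_iff_isUnit_det, ← mulVec_injective_iff_isUnit]
  have hinj := mul_mulVec_injective_of_rank_eq hX
  refine (injective_iff_map_eq_zero (Xᵀ * W * X).mulVecLin).2 fun v hv => ?_
  by_contra hne
  have hXv : X *ᵥ v ≠ 0 := fun h0 => hne (hinj (by rw [h0, mulVec_zero]))
  have h1 := hW _ hXv
  have h2 : quadForm W (X *ᵥ v) = v ⬝ᵥ (Xᵀ * W * X) *ᵥ v := by
    rw [quadForm, ← mulVec_mulVec, ← mulVec_mulVec, dotProduct_mulVec v, vecMul_transpose]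
  rw [mulVecLin_apply] at hv
  rw [h2, hv, dotProduct_zero] at h1
  exact lt_irrefl _ h1

/-- The normal equations `X'W (y - ŷ) = 0` in matrix form. -/
theorem transpose_mul_mul_glsHat {X : Matrix (Fin n) (Fin k) ℝ} {W : Matrix (Fin n) (Fin n) ℝ}
    (h : IsUnit (Xᵀ * W * X).det) : Xᵀ * W * glsHat X W = Xᵀ * W := by
  rw [glsHat, ← Matrix.mul_assoc, ← Matrix.mul_assoc, ← Matrix.mul_assoc,
    Matrix.mul_nonsing_inv _ h, Matrix.one_mul]

theorem glsHat_mulVec_eq (X : Matrix (Fin n) (Fin k) ℝ) (W : Matrix (Fin n) (Fin n) ℝ)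
    (v : Fin n → ℝ) : glsHat X W *ᵥ v = X *ᵥ (((Xᵀ * W * X)⁻¹ * Xᵀ * W) *ᵥ v) := by
  rw [mulVec_mulVec, glsHat]
  simp only [Matrix.mul_assoc]

/-- The matrix `Σ⁻¹ X (X' Σ⁻¹ X)⁻¹ X' Σ⁻¹` of the squared norm of the whitened projection. -/
def projForm (Sig : Matrix (Fin n) (Fin n) ℝ) (X : Matrix (Fin n) (Fin k) ℝ) :
    Matrix (Fin n) (Fin n) ℝ :=
  Sig⁻¹ * glsHat X Sig⁻¹

/-- The linear map `v ↦ Σ^{-1/2} v` into Euclidean space. -/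
def whiten (Sig : Matrix (Fin n) (Fin n) ℝ) : (Fin n → ℝ) →ₗ[ℝ] EuclideanSpace ℝ (Fin n) :=
  (WithLp.linearEquiv 2 ℝ (Fin n → ℝ)).symm.toLinearMap ∘ₗ (invSqrt Sig).mulVecLin

/-- The range of the whitened design matrix. -/
def whitenedRange (Sig : Matrix (Fin n) (Fin n) ℝ) (X : Matrix (Fin n) (Fin k) ℝ) :
    Submodule ℝ (EuclideanSpace ℝ (Fin n)) :=
  LinearMap.range (whiten Sig ∘ₗ X.mulVecLin)

/-- The perturbation `Σ^{1/2} (W - Σ⁻¹) Σ^{1/2}` of the identity. -/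
def whitenedError (Sig W : Matrix (Fin n) (Fin n) ℝ) :
    EuclideanSpace ℝ (Fin n) →L[ℝ] EuclideanSpace ℝ (Fin n) :=
  toEuclideanCLM (n := Fin n) (𝕜 := ℝ) (Sig * invSqrt Sig) *
    toEuclideanCLM (n := Fin n) (𝕜 := ℝ) (W - Sig⁻¹) *
    toEuclideanCLM (n := Fin n) (𝕜 := ℝ) (invSqrt Sig * Sig)

theorem whiten_apply (v : Fin n → ℝ) : whiten Sig v = WithLp.toLp 2 (invSqrt Sig *ᵥ v) := rfl

namespace HasSpectralBounds

theorem isUnit_det (h : HasSpectralBounds Sig c C) {X : Matrix (Fin n) (Fin k) ℝ}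
    (hX : X.rank = k) : IsUnit (Xᵀ * Sig⁻¹ * X).det := by
  refine isUnit_det_gram hX fun v hv => ?_
  have := h.posDef.inv.dotProduct_mulVec_pos hv
  rwa [star_trivial] at this

theorem inner_whiten (h : HasSpectralBounds Sig c C) (u v : Fin n → ℝ) :
    ⟪whiten Sig u, whiten Sig v⟫ = u ⬝ᵥ Sig⁻¹ *ᵥ v := by
  rw [whiten_apply, whiten_apply, EuclideanSpace.inner_toLp_toLp, star_trivial, dotProduct_comm,
    ← dotProduct_mulVec_comm h.invSqrt_symm, mulVec_mulVec, h.invSqrt_mul_self]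

theorem norm_whiten_sq (h : HasSpectralBounds Sig c C) (v : Fin n → ℝ) :
    ‖whiten Sig v‖ ^ 2 = quadForm Sig⁻¹ v := by
  rw [← real_inner_self_eq_norm_sq, h.inner_whiten, quadForm]

/-- The normal equations say that the whitened residual is orthogonal to the range of the whitened
design. -/
theorem starProjection_whiten (h : HasSpectralBounds Sig c C) {X : Matrix (Fin n) (Fin k) ℝ}
    (hX : X.rank = k) (v : Fin n → ℝ) :
    (whitenedRange Sig X).starProjection (whiten Sig v) = whiten Sig (glsHat X Sig⁻¹ *ᵥ v) := by
  refine Submodule.eq_starProjection_of_mem_of_inner_eq_zero ?_ ?_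
  · rw [glsHat_mulVec_eq]
    exact LinearMap.mem_range_self (whiten Sig ∘ₗ X.mulVecLin) _
  · rintro _ ⟨a, rfl⟩
    rw [← map_sub, LinearMap.comp_apply, h.inner_whiten, dotProduct_comm, mulVecLin_apply,
      ← dotProduct_mulVec_comm h.inv_symm, ← vecMul_transpose X a, ← dotProduct_mulVec,
      mulVec_sub, mulVec_mulVec, mulVec_sub, mulVec_mulVec, mulVec_mulVec,
      ← Matrix.mul_assoc, transpose_mul_mul_glsHat (h.isUnit_det hX), sub_self, dotProduct_zero]

/-- `Σ Σ^{-1/2}` plays the part of `Σ^{1/2}`: it equals `Σ^{-1/2} Σ`, as one sees after multiplying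
by `Σ⁻¹`, and it inverts `Σ^{-1/2}`. -/
theorem whitenedError_whiten (h : HasSpectralBounds Sig c C) (W : Matrix (Fin n) (Fin n) ℝ)
    (v : Fin n → ℝ) :
    whitenedError Sig W (whiten Sig v) = whiten Sig (Sig *ᵥ ((W - Sig⁻¹) *ᵥ v)) := by
  have h1 : Sig * invSqrt Sig = invSqrt Sig * Sig := by
    have h2 : Sig⁻¹ * (Sig * invSqrt Sig) = Sig⁻¹ * (invSqrt Sig * Sig) := by
      rw [← Matrix.mul_assoc, h.inv_mul, ← h.invSqrt_mul_self, Matrix.mul_assoc (invSqrt Sig),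
        ← Matrix.mul_assoc (invSqrt Sig) _ Sig, h.invSqrt_mul_self, h.inv_mul, Matrix.one_mul,
        Matrix.mul_one]
    have h3 := congrArg (fun A => Sig * A) h2
    simpa only [← Matrix.mul_assoc, h.mul_inv, Matrix.one_mul] using h3
  have h2 : invSqrt Sig * Sig * invSqrt Sig = 1 := by
    rw [Matrix.mul_assoc, h1, ← Matrix.mul_assoc, h.invSqrt_mul_self, h.inv_mul]
  rw [whiten_apply, whiten_apply, whitenedError, h1]
  simp only [mul_apply_eq_comp, toEuclideanCLM_toLp, mulVec_mulVec]
  rw [h2, Matrix.mul_one, Matrix.mul_assoc]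

/-- This is the dictionary between `W` and `1 + Δ`: it translates both the feasible normal equations
and the quadratic part of the criterion. -/
theorem inner_whitenedError (h : HasSpectralBounds Sig c C) (W : Matrix (Fin n) (Fin n) ℝ)
    (u v : Fin n → ℝ) :
    ⟪whiten Sig u, whiten Sig v + whitenedError Sig W (whiten Sig v)⟫ = u ⬝ᵥ W *ᵥ v := by
  rw [h.whitenedError_whiten, inner_add_right, h.inner_whiten, h.inner_whiten, mulVec_mulVec,
    mulVec_mulVec, h.inv_mul, Matrix.one_mul, ← dotProduct_add,
    ← add_mulVec, add_sub_cancel]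

/-- The two outer factors are adjoint to each other and have norm at most `√C`, because `‖Σ^{-1/2} Σ
v‖² = v'Σv`. -/
theorem norm_whitenedError_le [NeZero n] (h : HasSpectralBounds Sig c C)
    (W : Matrix (Fin n) (Fin n) ℝ) :
    ‖whitenedError Sig W‖ ≤ C * spectralNorm2 (W - Sig⁻¹) := by
  have hC := h.C_pos
  have hB : (Sig * invSqrt Sig) = (invSqrt Sig * Sig)ᵀ := by
    rw [transpose_mul, h.symm, h.invSqrt_symm]
  have hnorm : ‖toEuclideanCLM (n := Fin n) (𝕜 := ℝ) (invSqrt Sig * Sig)‖ ≤ √C := by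
    refine ContinuousLinearMap.opNorm_le_bound _ (Real.sqrt_nonneg _) fun x => ?_
    refine le_of_sq_le_sq ?_ (by positivity)
    rw [mul_pow, Real.sq_sqrt hC.le]
    have h1 : ‖toEuclideanCLM (n := Fin n) (𝕜 := ℝ) (invSqrt Sig * Sig) x‖ ^ 2
        = quadForm Sig⁻¹ (Sig *ᵥ x.ofLp) := by
      rw [← h.norm_whiten_sq, whiten_apply, mulVec_mulVec, ← toEuclideanCLM_toLp]
    have h2 : quadForm Sig⁻¹ (Sig *ᵥ x.ofLp) = quadForm Sig x.ofLp := by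
      rw [quadForm, mulVec_mulVec, h.inv_mul, one_mulVec, dotProduct_comm, quadForm]
    have h3 : ‖x‖ ^ 2 = x.ofLp ⬝ᵥ x.ofLp := by
      rw [← real_inner_self_eq_norm_sq, EuclideanSpace.inner_eq_star_dotProduct, star_trivial]
    rw [h1, h2, h3]
    exact h.upper _
  have hnorm' : ‖toEuclideanCLM (n := Fin n) (𝕜 := ℝ) (Sig * invSqrt Sig)‖ ≤ √C := by
    have h4 : toEuclideanCLM (n := Fin n) (𝕜 := ℝ) (Sig * invSqrt Sig)
        = star (toEuclideanCLM (n := Fin n) (𝕜 := ℝ) (invSqrt Sig * Sig)) := by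
      rw [← map_star, star_eq_conjTranspose, conjTranspose_eq_transpose_of_trivial, hB]
    rw [h4, ContinuousLinearMap.star_eq_adjoint, LinearIsometryEquiv.norm_map]
    exact hnorm
  calc ‖whitenedError Sig W‖ ≤ √C * spectralNorm2 (W - Sig⁻¹) * √C := by
        rw [whitenedError]
        refine (norm_mul_le _ _).trans (mul_le_mul ((norm_mul_le _ _).trans
          (mul_le_mul_of_nonneg_right hnorm' (norm_nonneg _))) hnorm (norm_nonneg _) ?_)
        exact mul_nonneg (Real.sqrt_nonneg _) (norm_nonneg _)
    _ = C * spectralNorm2 (W - Sig⁻¹) := by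
        rw [mul_right_comm, Real.mul_self_sqrt hC.le]

theorem projForm_symm (h : HasSpectralBounds Sig c C) (X : Matrix (Fin n) (Fin k) ℝ) :
    (projForm Sig X)ᵀ = projForm Sig X := by
  rw [projForm, glsHat]
  simp only [transpose_mul, transpose_nonsing_inv, transpose_transpose, h.symm, Matrix.mul_assoc]

theorem norm_starProjection_sq (h : HasSpectralBounds Sig c C) {X : Matrix (Fin n) (Fin k) ℝ}
    (hX : X.rank = k) (v : Fin n → ℝ) :
    ‖(whitenedRange Sig X).starProjection (whiten Sig v)‖ ^ 2 = quadForm (projForm Sig X) v := by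
  rw [← real_inner_self_eq_norm_sq]
  have h1 := inner_starProjection_of_mem (fun _ : Unit => whitenedRange Sig X) (i := ())
    (Submodule.starProjection_apply_mem (whitenedRange Sig X) (whiten Sig v)) (whiten Sig v)
  rw [h1, real_inner_comm, h.starProjection_whiten hX, h.inner_whiten, mulVec_mulVec]
  rfl

theorem inner_sub_starProjection (h : HasSpectralBounds Sig c C) {X : Matrix (Fin n) (Fin k) ℝ}
    (hX : X.rank = k) (u v : Fin n → ℝ) :
    ⟪whiten Sig u - (whitenedRange Sig X).starProjection (whiten Sig u), whiten Sig v⟫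
      = ((Sig⁻¹ - projForm Sig X) *ᵥ u) ⬝ᵥ v := by
  rw [h.starProjection_whiten hX, ← map_sub, real_inner_comm, h.inner_whiten, mulVec_sub,
    mulVec_mulVec, ← sub_mulVec, dotProduct_comm]
  rfl

theorem norm_sub_starProjection_sq (h : HasSpectralBounds Sig c C)
    {X : Matrix (Fin n) (Fin k) ℝ} (hX : X.rank = k) (v : Fin n → ℝ) :
    ‖whiten Sig v - (whitenedRange Sig X).starProjection (whiten Sig v)‖ ^ 2
      = quadForm (Sig⁻¹ - projForm Sig X) v := by
  rw [quadForm, dotProduct_comm, ← h.inner_sub_starProjection hX, ← real_inner_self_eq_norm_sq,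
    inner_sub_right]
  have h1 := inner_sub_starProjection_eq_zero (fun _ : Unit => whitenedRange Sig X) (i := ())
    (Submodule.starProjection_apply_mem (whitenedRange Sig X) (whiten Sig v)) (whiten Sig v)
  rw [real_inner_comm] at h1
  rw [h1, sub_zero]

theorem modelRisk_eq (h : HasSpectralBounds Sig c C) (X : Matrix (Fin n) (Fin k) ℝ)
    (v : Fin n → ℝ) :
    modelRisk Sig X v = quadForm (Sig⁻¹ - projForm Sig X) v + k := by
  have h1 : invSqrt Sig * (1 - whitenedProj Sig X) * invSqrt Sig = Sig⁻¹ - projForm Sig X := by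
    rw [Matrix.mul_sub, Matrix.sub_mul, Matrix.mul_one, h.invSqrt_mul_self, whitenedProj, projForm,
      glsHat]
    congr 1
    simp only [← Matrix.mul_assoc, h.invSqrt_mul_self]
    rw [Matrix.mul_assoc _ (invSqrt Sig) (invSqrt Sig), h.invSqrt_mul_self]
  rw [modelRisk, h1]

theorem projForm_mul_mul (h : HasSpectralBounds Sig c C) {X : Matrix (Fin n) (Fin k) ℝ}
    (hX : X.rank = k) : projForm Sig X * Sig * projForm Sig X = projForm Sig X := by
  have h1 := transpose_mul_mul_glsHat (h.isUnit_det hX)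
  rw [projForm, Matrix.mul_assoc (Sig⁻¹ * glsHat X Sig⁻¹), ← Matrix.mul_assoc Sig, h.mul_inv,
    Matrix.one_mul, Matrix.mul_assoc]
  congr 1
  have h2 : glsHat X Sig⁻¹ = X * (Xᵀ * Sig⁻¹ * X)⁻¹ * (Xᵀ * Sig⁻¹) := by
    rw [glsHat, Matrix.mul_assoc]
  nth_rw 1 [h2]
  rw [Matrix.mul_assoc, h1, ← h2]

theorem trace_projForm_mul (h : HasSpectralBounds Sig c C) {X : Matrix (Fin n) (Fin k) ℝ}
    (hX : X.rank = k) : (projForm Sig X * Sig).trace = k := by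
  have h1 := h.isUnit_det hX
  rw [Matrix.trace_mul_comm, projForm, ← Matrix.mul_assoc, h.mul_inv, Matrix.one_mul, glsHat,
    Matrix.mul_assoc, Matrix.mul_assoc, Matrix.trace_mul_comm, Matrix.mul_assoc,
    Matrix.nonsing_inv_mul _ h1, Matrix.trace_one, Fintype.card_fin]

theorem trace_transpose_mul_mul (A Z : Matrix (Fin n) (Fin n) ℝ) :
    (Zᵀ * A * Z).trace = ∑ s, quadForm A (fun t => Z t s) := by
  simp only [trace, diag, quadForm, dotProduct, mulVec, Matrix.mul_apply, transpose_apply,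
    Finset.mul_sum, Finset.sum_mul]
  refine Finset.sum_congr rfl fun s _ => ?_
  rw [Finset.sum_comm]
  exact Finset.sum_congr rfl fun s _ => Finset.sum_congr rfl fun t _ => by ring

theorem trace_transpose_mul_mul_le {A B : Matrix (Fin n) (Fin n) ℝ} {a b : ℝ}
    (hAB : ∀ v, a * quadForm A v ≤ b * quadForm B v) (Z : Matrix (Fin n) (Fin n) ℝ) :
    a * (Zᵀ * A * Z).trace ≤ b * (Zᵀ * B * Z).trace := by
  rw [trace_transpose_mul_mul, trace_transpose_mul_mul, Finset.mul_sum, Finset.mul_sum]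
  exact Finset.sum_le_sum fun s _ => hAB _

/-- Apply `c ≤ Σ` twice. With `G Σ G = G` one gets `c tr(G'G) ≤ tr(GΣG) = tr G`; writing `G = Z Z'`
with `Z = G Σ Σ^{-1/2}`, one gets `c tr G ≤ tr(Z'ΣZ) = tr(GΣ) = k`. -/
theorem sum_projForm_sq_le (h : HasSpectralBounds Sig c C) {X : Matrix (Fin n) (Fin k) ℝ}
    (hX : X.rank = k) : ∑ s, ∑ t, projForm Sig X s t ^ 2 ≤ (c⁻¹) ^ 2 * k := by
  set G := projForm Sig X with hG
  set A := invSqrt Sig with hA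
  have hq1 : ∀ v : Fin n → ℝ, quadForm 1 v = v ⬝ᵥ v := fun v => by rw [quadForm, one_mulVec]
  have h1 : ∑ s, ∑ t, G s t ^ 2 = (Gᵀ * 1 * G).trace := by
    rw [trace_transpose_mul_mul, Finset.sum_comm]
    simp only [hq1, dotProduct, sq]
  have h2 : c * (Gᵀ * 1 * G).trace ≤ 1 * (Gᵀ * Sig * G).trace :=
    trace_transpose_mul_mul_le (fun v => by rw [hq1, one_mul]; exact h.lower v) G
  have h2' : (Gᵀ * Sig * G).trace = G.trace := by
    rw [hG, h.projForm_symm, h.projForm_mul_mul hX]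
  rw [h2', one_mul] at h2
  have h3 : (G * Sig * A) * (G * Sig * A)ᵀ = G := by
    have h4 : (G * Sig * A)ᵀ = A * Sig * G := by
      rw [transpose_mul, transpose_mul, h.symm, h.projForm_symm, h.invSqrt_symm, Matrix.mul_assoc]
    rw [h4, Matrix.mul_assoc (G * Sig), ← Matrix.mul_assoc A, ← Matrix.mul_assoc A,
      h.invSqrt_mul_self, h.inv_mul, Matrix.one_mul, h.projForm_mul_mul hX]
  have h4 : c * ((G * Sig * A)ᵀ * 1 * (G * Sig * A)).trace
      ≤ 1 * ((G * Sig * A)ᵀ * Sig * (G * Sig * A)).trace :=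
    trace_transpose_mul_mul_le (fun v => by rw [hq1, one_mul]; exact h.lower v) _
  rw [Matrix.mul_one, Matrix.trace_mul_comm, h3, Matrix.mul_assoc, Matrix.trace_mul_comm,
    Matrix.mul_assoc, h3, Matrix.trace_mul_comm, h.trace_projForm_mul hX, one_mul] at h4
  rw [h1]
  have hc := h.pos
  have h5 : c * (c * (Gᵀ * 1 * G).trace) ≤ k := (mul_le_mul_of_nonneg_left h2 hc.le).trans h4
  rw [inv_pow, inv_mul_eq_div, le_div_iff₀ (by positivity)]
  linarith

end HasSpectralBounds

end GLS

/-! ### Uniform bounds over the candidate models: fixed designs -/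

section Uniform

variable {Ω : Type*} [MeasurableSpace Ω] {P : Measure Ω}

theorem measure_lt_abs_le_of_eLpNorm_le {f : Ω → ℝ} (hf : AEStronglyMeasurable f P) {a t : ℝ}
    (ha : 0 ≤ a) (ht : 0 < t) (h : eLpNorm f 2 P ≤ ENNReal.ofReal a) :
    P {ω | t < |f ω|} ≤ ENNReal.ofReal (a ^ 2 / t ^ 2) := by
  have h1 := meas_ge_le_mul_pow_eLpNorm_enorm P (p := 2) (by norm_num) (by norm_num) hf
    (ε := ENNReal.ofReal t) (by simpa using ht) (by simp)
  calc P {ω | t < |f ω|} ≤ P {ω | ENNReal.ofReal t ≤ ‖f ω‖ₑ} := by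
        refine measure_mono fun ω hω => ?_
        simp only [Set.mem_ofPred_eq] at hω ⊢
        rw [Real.enorm_eq_ofReal_abs]
        exact ENNReal.ofReal_le_ofReal hω.le
    _ ≤ (ENNReal.ofReal t)⁻¹ ^ (ENNReal.toReal 2) * eLpNorm f 2 P ^ (ENNReal.toReal 2) := h1
    _ ≤ (ENNReal.ofReal t)⁻¹ ^ (ENNReal.toReal 2) * ENNReal.ofReal a ^ (ENNReal.toReal 2) := by
        gcongr
    _ = ENNReal.ofReal (a ^ 2 / t ^ 2) := by
        have h2 : ENNReal.toReal 2 = ((2 : ℕ) : ℝ) := by norm_num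
        rw [h2, ENNReal.rpow_natCast, ENNReal.rpow_natCast, ← ENNReal.ofReal_inv_of_pos ht,
          ← ENNReal.ofReal_pow (by positivity), ← ENNReal.ofReal_pow ha,
          ← ENNReal.ofReal_mul (by positivity)]
        congr 1
        field_simp

/-- The sum `∑_j 1 / max (j², K)`. -/
def blockSum (K : ℝ) : ℝ := ∑' j : ℕ, (max ((j : ℝ) ^ 2) K)⁻¹

theorem blockSum_term_le {K : ℝ} (hK : 1 ≤ K) (j : ℕ) :
    (max ((j : ℝ) ^ 2) K)⁻¹ ≤ (max ((j : ℝ) ^ 2) 1)⁻¹ :=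
  inv_anti₀ (by positivity) (max_le_max le_rfl hK)

theorem summable_blockSum_one : Summable fun j : ℕ => (max ((j : ℝ) ^ 2) 1)⁻¹ := by
  refine (summable_nat_add_iff 1).1 ?_
  refine ((summable_nat_add_iff 1).2 (Real.summable_nat_pow_inv.2 (by norm_num : 1 < 2))).congr
    fun j => ?_
  rw [max_eq_left]
  push_cast
  nlinarith [(Nat.cast_nonneg j : (0 : ℝ) ≤ j)]

theorem summable_blockSum {K : ℝ} (hK : 1 ≤ K) :
    Summable fun j : ℕ => (max ((j : ℝ) ^ 2) K)⁻¹ :=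
  Summable.of_nonneg_of_le (fun j => by positivity) (blockSum_term_le hK) summable_blockSum_one

theorem tendsto_blockSum : Tendsto blockSum atTop (𝓝 0) := by
  have h := tendsto_tsum_of_dominated_convergence (𝓕 := (atTop : Filter ℝ))
    (f := fun K (j : ℕ) => (max ((j : ℝ) ^ 2) K)⁻¹) (g := fun _ => (0 : ℝ))
    summable_blockSum_one
    (fun j => tendsto_inv_atTop_zero.comp
      (tendsto_atTop_mono (fun K => le_max_right _ _) tendsto_id))
    (by
      filter_upwards [eventually_ge_atTop 1] with K hK j
      rw [Real.norm_of_nonneg (by positivity)]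
      exact blockSum_term_le hK j)
  simp only [tsum_zero] at h
  exact h

/-- The dimensions `κ m` are distinct integers, so the union bound is dominated by a convergent
series over all integers, whatever the number of models. -/
theorem measure_exists_le_of_forall_le {M : ℕ} {κ : Fin M → ℕ} (hκ : StrictMono κ)
    {s : Fin M → Set Ω} {D : Fin M → ℝ} {A K : ℝ} (hA : 0 ≤ A) (hK : 1 ≤ K)
    (hκD : ∀ m, (κ m : ℝ) ≤ D m) (hKD : ∀ m, K ≤ D m)
    (hs : ∀ m, P (s m) ≤ ENNReal.ofReal (A / D m ^ 2)) :
    P (⋃ m, s m) ≤ ENNReal.ofReal (A * blockSum K) := by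
  calc P (⋃ m, s m) ≤ ∑ m, P (s m) := measure_iUnion_fintype_le _ _
    _ ≤ ∑ m, ENNReal.ofReal (A * (max ((κ m : ℝ) ^ 2) K)⁻¹) := by
        refine Finset.sum_le_sum fun m _ => (hs m).trans (ENNReal.ofReal_le_ofReal ?_)
        rw [div_eq_mul_inv]
        refine mul_le_mul_of_nonneg_left (inv_anti₀ (by positivity) (max_le ?_ ?_)) hA
        · exact pow_le_pow_left₀ (by positivity) (hκD m) 2
        · have := hKD m
          nlinarith
    _ = ENNReal.ofReal (∑ m, A * (max ((κ m : ℝ) ^ 2) K)⁻¹) :=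
        (ENNReal.ofReal_sum_of_nonneg fun m _ => by positivity).symm
    _ ≤ ENNReal.ofReal (A * blockSum K) := by
        refine ENNReal.ofReal_le_ofReal ?_
        rw [← Finset.mul_sum]
        refine mul_le_mul_of_nonneg_left ?_ hA
        rw [← Finset.sum_image (s := Finset.univ) (g := κ)
          (f := fun j : ℕ => (max ((j : ℝ) ^ 2) K)⁻¹) fun a _ b _ h => hκ.injective h]
        exact (summable_blockSum hK).sum_le_tsum _ fun j _ => by positivity

/-- A uniform law of large numbers for monotone families with variance proportional to the mean:
it suffices to control the endpoints of the blocks `j² ≤ κ < (j + 1)²`. -/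
theorem measure_exists_lt_abs_sub_le {M : ℕ} {κ : Fin M → ℕ} (hκ : StrictMono κ)
    (hκ1 : ∀ m, 1 ≤ κ m) {T : Fin M → Ω → ℝ} (hT : ∀ ω, Monotone fun m => T m ω) {A : ℝ}
    (hA : 0 ≤ A)
    (hcheb : ∀ m t, 0 < t → P {ω | t < |T m ω - κ m|} ≤ ENNReal.ofReal (A * κ m / t ^ 2))
    {D : Fin M → ℝ} {K ε : ℝ} (hε : 0 < ε) (hK : 1 ≤ K) (hKε : 16 ≤ ε ^ 2 * K)
    (hκD : ∀ m, (κ m : ℝ) ≤ D m) (hKD : ∀ m, K ≤ D m) :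
    P (⋃ m, {ω | ε * D m < |T m ω - κ m|}) ≤ ENNReal.ofReal (24 * A / ε ^ 2 * blockSum K) := by
  classical
  -- A union bound over all models would cost `∑ κ m / D m ^ 2`, which may behave like the harmonic
  -- series. Using only the first and last model of each block leaves a sum of order `∑ 1 / j²`.
  set B : ℕ → Finset (Fin M) := fun j => Finset.univ.filter fun m => Nat.sqrt (κ m) = j with hB
  set ends : ℕ → Finset (Fin M) := fun j =>
    if h : (B j).Nonempty then {(B j).min' h, (B j).max' h} else ∅ with hends
  have hends_sub : ∀ j, ends j ⊆ B j := by
    intro j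
    simp only [hends]
    split_ifs with h
    · intro a ha
      rcases Finset.mem_insert.1 ha with rfl | ha
      · exact Finset.min'_mem _ _
      · rw [Finset.mem_singleton.1 ha]; exact Finset.max'_mem _ _
    · exact Finset.empty_subset _
  have hends_card : ∀ j, (ends j).card ≤ 2 := by
    intro j
    simp only [hends]
    split_ifs with h
    · exact Finset.card_le_two
    · simp
  set Q : ℕ → ℝ := fun j => max ((j : ℝ) ^ 2) K with hQ
  have hQ1 : ∀ j, 1 ≤ Q j := fun j => hK.trans (le_max_right _ _)
  have hBκ : ∀ j, ∀ m ∈ B j, (j : ℝ) ^ 2 ≤ κ m ∧ (κ m : ℝ) ≤ (j : ℝ) ^ 2 + 2 * j ∧ 1 ≤ j := by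
    intro j m hm
    have hj : Nat.sqrt (κ m) = j := (Finset.mem_filter.1 hm).2
    refine ⟨?_, ?_, ?_⟩
    · have := Nat.sqrt_le' (κ m)
      rw [hj] at this
      exact_mod_cast this
    · have := Nat.sqrt_le_add (κ m)
      rw [hj] at this
      have h2 : (κ m : ℝ) ≤ ((j * j + j + j : ℕ) : ℝ) := by exact_mod_cast this
      push_cast at h2
      linarith
    · rw [← hj]
      exact Nat.sqrt_pos.2 (hκ1 m)
  have hcover : (⋃ m, {ω | ε * D m < |T m ω - κ m|})
      ⊆ ⋃ j, ⋃ a ∈ ends j, {ω | ε / 2 * Q j < |T a ω - κ a|} := by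
    intro ω hω
    obtain ⟨m, hm⟩ := Set.mem_iUnion.1 hω
    simp only [Set.mem_ofPred_eq] at hm
    set j := Nat.sqrt (κ m) with hj
    have hmB : m ∈ B j := Finset.mem_filter.2 ⟨Finset.mem_univ m, hj.symm⟩
    have hne : (B j).Nonempty := ⟨m, hmB⟩
    obtain ⟨hm1, hm2, hj1⟩ := hBκ j m hmB
    have hj0 : (0 : ℝ) ≤ j := Nat.cast_nonneg j
    have hQD : Q j ≤ D m := max_le (hm1.trans (hκD m)) (hKD m)
    -- The dimensions in a block differ by at most `2 * j`, and half of the tolerance covers this: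
    -- `(ε Q)² ≥ 16 Q ≥ (4 j)²`.
    have h2j : 2 * (j : ℝ) ≤ ε / 2 * Q j := by
      have h1 : (4 * (j : ℝ)) ^ 2 ≤ (ε * Q j) ^ 2 := by
        have h2 : (j : ℝ) ^ 2 ≤ Q j := le_max_left _ _
        have h3 : 16 ≤ ε ^ 2 * Q j :=
          hKε.trans (mul_le_mul_of_nonneg_left (le_max_right _ _) (by positivity))
        have h4 := mul_le_mul h3 h2 (by positivity) (by positivity)
        nlinarith
      have h5 := le_of_sq_le_sq h1 (mul_nonneg hε.le ((zero_le_one).trans (hQ1 j)))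
      linarith
    have hεQ : ε * Q j ≤ ε * D m := mul_le_mul_of_nonneg_left hQD hε.le
    have hle : ∀ a b : Fin M, a ≤ b → (κ a : ℝ) ≤ κ b := fun a b hab => by
      exact_mod_cast hκ.monotone hab
    have hlo := (B j).min'_le m hmB
    have hhi := (B j).le_max' m hmB
    have hloB := hBκ j _ ((B j).min'_mem hne)
    have hhiB := hBκ j _ ((B j).max'_mem hne)
    simp only [Set.mem_iUnion, Set.mem_ofPred_eq, exists_prop]
    -- By monotonicity, an excess at `m` carries over to the last model of the block and a deficit
    -- to the first one.
    rcases lt_abs.1 hm with h | h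
    · refine ⟨j, (B j).max' hne, by simp [hends, hne], lt_abs.2 (Or.inl ?_)⟩
      have h1 : T m ω ≤ T ((B j).max' hne) ω := hT ω hhi
      linarith [hhiB.2.1]
    · refine ⟨j, (B j).min' hne, by simp [hends, hne], lt_abs.2 (Or.inr ?_)⟩
      have h1 : T ((B j).min' hne) ω ≤ T m ω := hT ω hlo
      linarith [hloB.1]
  calc P (⋃ m, {ω | ε * D m < |T m ω - κ m|})
      ≤ ∑' j, P (⋃ a ∈ ends j, {ω | ε / 2 * Q j < |T a ω - κ a|}) :=
        (measure_mono hcover).trans (measure_iUnion_le _)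
    _ ≤ ∑' j, ENNReal.ofReal (24 * A / ε ^ 2 * (Q j)⁻¹) := by
        refine ENNReal.tsum_le_tsum fun j => ?_
        have hQ0 : 0 < Q j := zero_lt_one.trans_le (hQ1 j)
        calc P (⋃ a ∈ ends j, {ω | ε / 2 * Q j < |T a ω - κ a|})
            ≤ ∑ a ∈ ends j, P {ω | ε / 2 * Q j < |T a ω - κ a|} := measure_biUnion_finset_le _ _
          _ ≤ ∑ _a ∈ ends j, ENNReal.ofReal (12 * A / ε ^ 2 * (Q j)⁻¹) := by
              refine Finset.sum_le_sum fun a ha => (hcheb a _ (by positivity)).trans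
                (ENNReal.ofReal_le_ofReal ?_)
              obtain ⟨-, h2, h3⟩ := hBκ j a (hends_sub j ha)
              -- Here `κ ≤ j² + 2 j ≤ 3 j²` since `j ≥ 1`; the factors `3`, `4` from the halved
              -- tolerance and `2` endpoints make up `24`.
              have h4 : (κ a : ℝ) ≤ 3 * Q j := by
                have h5 : (j : ℝ) ^ 2 ≤ Q j := le_max_left _ _
                have h6 : (1 : ℝ) ≤ j := by exact_mod_cast h3
                nlinarith
              calc A * κ a / (ε / 2 * Q j) ^ 2 ≤ A * (3 * Q j) / (ε / 2 * Q j) ^ 2 := by gcongr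
                _ = 12 * A / ε ^ 2 * (Q j)⁻¹ := by field_simp; ring
          _ ≤ 2 * ENNReal.ofReal (12 * A / ε ^ 2 * (Q j)⁻¹) := by
              rw [Finset.sum_const, nsmul_eq_mul]
              gcongr
              exact_mod_cast hends_card j
          _ = ENNReal.ofReal (24 * A / ε ^ 2 * (Q j)⁻¹) := by
              rw [← ENNReal.ofReal_ofNat, ← ENNReal.ofReal_mul (by norm_num)]
              congr 1
              ring
    _ = ENNReal.ofReal (24 * A / ε ^ 2 * blockSum K) := by
        rw [← ENNReal.ofReal_tsum_of_nonneg (fun j => by have := hQ1 j; positivity)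
          ((summable_blockSum hK).mul_left _), tsum_mul_left]
        rfl

end Uniform

/-! ### Chebyshev bounds for deterministic regressors. -/

section FixedDesign

open Matrix

variable {Ω : Type*} [MeasurableSpace Ω] {P : Measure Ω} [IsProbabilityMeasure P]
  {e : ℤ → Ω → ℝ}

/-- The conclusion of `IsLinearErrorProcess.exists_eLpNorm_quadForm_le`. -/
def HasQuadFormBound (P : Measure Ω) (e : ℤ → Ω → ℝ) (A : ℝ) : Prop :=
  ∀ (n : ℕ) (G : Matrix (Fin n) (Fin n) ℝ),
    eLpNorm (fun ω => quadForm G (fun t => e (t : ℕ) ω) - (G * errorCov P e n).trace) 2 P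
      ≤ ENNReal.ofReal (A * √(∑ s, ∑ t, G s t ^ 2))

omit [IsProbabilityMeasure P] in
theorem measurable_quadForm_errors (he : ∀ t, Measurable (e t)) {n : ℕ}
    (G : Matrix (Fin n) (Fin n) ℝ) : Measurable fun ω => quadForm G (fun t => e (t : ℕ) ω) := by
  simp only [quadForm, dotProduct, mulVec]
  exact Finset.measurable_fun_sum _ fun s _ => (he _).mul
    (Finset.measurable_fun_sum _ fun t _ => (he _).const_mul _)

theorem quadForm_vecMulVec {n : ℕ} (a v : Fin n → ℝ) :
    quadForm (vecMulVec a a) v = (a ⬝ᵥ v) ^ 2 := by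
  simp only [quadForm, dotProduct, mulVec, vecMulVec_apply, Finset.mul_sum, sq, Finset.sum_mul]
  exact Finset.sum_congr rfl fun s _ => Finset.sum_congr rfl fun t _ => by ring

theorem trace_vecMulVec_mul {n : ℕ} (a : Fin n → ℝ) (A : Matrix (Fin n) (Fin n) ℝ) :
    (vecMulVec a a * A).trace = quadForm A a := by
  simp only [quadForm, dotProduct, mulVec, vecMulVec_apply, trace, diag, Matrix.mul_apply,
    Finset.mul_sum]
  rw [Finset.sum_comm]
  exact Finset.sum_congr rfl fun s _ => Finset.sum_congr rfl fun t _ => by ring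

theorem sum_vecMulVec_sq {n : ℕ} (a : Fin n → ℝ) :
    √(∑ s, ∑ t, vecMulVec a a s t ^ 2) = a ⬝ᵥ a := by
  have h : ∑ s, ∑ t, vecMulVec a a s t ^ 2 = (a ⬝ᵥ a) ^ 2 := by
    simp only [vecMulVec_apply, dotProduct, sq, Finset.sum_mul_sum]
    exact Finset.sum_congr rfl fun s _ => Finset.sum_congr rfl fun t _ => by ring
  rw [h, Real.sqrt_sq (dotProduct_self_nonneg' a)]

variable {A c C : ℝ} {n k : ℕ}

omit [IsProbabilityMeasure P] in
-- Chebyshev: the form has mean `tr(GΣ) = k`, and its matrix has Frobenius norm at most `c⁻¹ √k`.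
theorem measure_lt_abs_projForm_sub_le (hq : HasQuadFormBound P e A) (hA : 0 ≤ A)
    (he : ∀ t, Measurable (e t)) (hb : HasSpectralBounds (errorCov P e n) c C)
    {X : Matrix (Fin n) (Fin k) ℝ} (hX : X.rank = k) {t : ℝ} (ht : 0 < t) :
    P {ω | t < |quadForm (projForm (errorCov P e n) X) (fun t => e (t : ℕ) ω) - k|}
      ≤ ENNReal.ofReal ((A * c⁻¹) ^ 2 * k / t ^ 2) := by
  have h1 := hq n (projForm (errorCov P e n) X)
  rw [hb.trace_projForm_mul hX] at h1
  have hc := hb.pos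
  have h2 : A * √(∑ s, ∑ t, projForm (errorCov P e n) X s t ^ 2) ≤ A * (c⁻¹ * √k) := by
    refine mul_le_mul_of_nonneg_left ?_ hA
    refine (Real.sqrt_le_sqrt (hb.sum_projForm_sq_le hX)).trans_eq ?_
    rw [Real.sqrt_mul (by positivity), Real.sqrt_sq (by positivity)]
  have h3 := measure_lt_abs_le_of_eLpNorm_le
    ((measurable_quadForm_errors he _).sub_const _).aestronglyMeasurable (by positivity) ht
    (h1.trans (ENNReal.ofReal_le_ofReal h2))
  refine h3.trans_eq ?_
  rw [← mul_assoc, mul_pow _ (√k), Real.sq_sqrt (Nat.cast_nonneg k)]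

/-- Chebyshev is applied to `(a'e)²`, a quadratic form of rank one whose mean `a'Σa` is the squared
bias. This yields the decay `D⁻²`, summable over models, instead of the `D⁻¹` that the variance of
`a'e` would give. -/
theorem measure_lt_abs_bias_inner_le (hq : HasQuadFormBound P e A) (hA : 0 ≤ A)
    (he : ∀ t, Measurable (e t)) (hb : HasSpectralBounds (errorCov P e n) c C)
    {X : Matrix (Fin n) (Fin k) ℝ} (hX : X.rank = k) (μ : Fin n → ℝ) {D ε : ℝ}
    (hD : 0 < D) (hε : 0 < ε)
    (hbias : quadForm ((errorCov P e n)⁻¹ - projForm (errorCov P e n) X) μ ≤ D) :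
    P {ω | ε * D < |(((errorCov P e n)⁻¹ - projForm (errorCov P e n) X) *ᵥ μ)
        ⬝ᵥ (fun t => e (t : ℕ) ω)|}
      ≤ ENNReal.ofReal ((A * c⁻¹ + 1) ^ 2 / ε ^ 4 / D ^ 2) := by
  set Sig := errorCov P e n with hSig
  set H := Sig⁻¹ - projForm Sig X with hH
  set a := H *ᵥ μ with ha
  have hc := hb.pos
  have hHsymm : Hᵀ = H := by rw [hH, transpose_sub, hb.inv_symm, hb.projForm_symm]
  have hHH : H * Sig * H = H := by
    have h1 := hb.projForm_mul_mul hX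
    rw [hH, Matrix.sub_mul, hb.inv_mul, Matrix.sub_mul, Matrix.one_mul, Matrix.mul_sub, h1,
      Matrix.mul_assoc, hb.mul_inv, Matrix.mul_one, sub_self, sub_zero]
  have haS : quadForm Sig a = quadForm H μ := by
    rw [quadForm, ha, ← dotProduct_mulVec_comm hHsymm, mulVec_mulVec, mulVec_mulVec,
      hHH, quadForm]
  have haa : a ⬝ᵥ a ≤ c⁻¹ * D := by
    have h1 := hb.lower a
    rw [haS] at h1
    rw [inv_mul_eq_div, le_div_iff₀ hc]
    linarith
  have haS0 : 0 ≤ quadForm Sig a := le_trans (mul_nonneg hc.le (dotProduct_self_nonneg' a))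
    (hb.lower a)
  have h1 := hq n (vecMulVec a a)
  rw [trace_vecMulVec_mul, sum_vecMulVec_sq] at h1
  have hmeas := measurable_quadForm_errors he (vecMulVec a a)
  have h2 : eLpNorm (fun ω => quadForm (vecMulVec a a) (fun t => e (t : ℕ) ω)) 2 P
      ≤ ENNReal.ofReal ((A * c⁻¹ + 1) * D) := by
    have h3 : (fun ω => quadForm (vecMulVec a a) (fun t => e (t : ℕ) ω))
        = (fun ω => quadForm (vecMulVec a a) (fun t => e (t : ℕ) ω) - quadForm Sig a)
          + fun _ => quadForm Sig a := by
      ext ω; simp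
    rw [h3]
    refine (eLpNorm_add_le (hmeas.sub_const _).aestronglyMeasurable
      aestronglyMeasurable_const (by norm_num)).trans ?_
    have h4 : eLpNorm (fun _ : Ω => quadForm Sig a) 2 P = ENNReal.ofReal (quadForm Sig a) := by
      rw [eLpNorm_const _ (by norm_num) (NeZero.ne P), measure_univ, ENNReal.one_rpow, mul_one,
        Real.enorm_eq_ofReal haS0]
    rw [h4, add_mul, one_mul, ENNReal.ofReal_add (by positivity) hD.le]
    refine add_le_add (h1.trans (ENNReal.ofReal_le_ofReal ?_)) (ENNReal.ofReal_le_ofReal ?_)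
    · rw [mul_assoc]
      exact mul_le_mul_of_nonneg_left haa hA
    · rw [haS]; exact hbias
  have h3 := measure_lt_abs_le_of_eLpNorm_le hmeas.aestronglyMeasurable
    (by positivity) (t := (ε * D) ^ 2) (by positivity) h2
  refine (measure_mono fun ω hω => ?_).trans (h3.trans_eq ?_)
  · simp only [Set.mem_ofPred_eq] at hω ⊢
    rw [quadForm_vecMulVec, abs_of_nonneg (sq_nonneg _), ← sq_abs (a ⬝ᵥ _)]
    exact pow_lt_pow_left₀ hω (by positivity) (by norm_num)
  · congr 1
    field_simp

theorem quadForm_projForm_mono {Sig : Matrix (Fin n) (Fin n) ℝ} (hb : HasSpectralBounds Sig c C)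
    {l : ℕ} {X : Matrix (Fin n) (Fin k) ℝ} {X' : Matrix (Fin n) (Fin l) ℝ} (hX : X.rank = k)
    (hX' : X'.rank = l) (hle : whitenedRange Sig X ≤ whitenedRange Sig X') (v : Fin n → ℝ) :
    quadForm (projForm Sig X) v ≤ quadForm (projForm Sig X') v := by
  rw [← hb.norm_starProjection_sq hX, ← hb.norm_starProjection_sq hX']
  refine pow_le_pow_left₀ (norm_nonneg _) ?_ 2
  have h1 : (whitenedRange Sig X).starProjection (whiten Sig v)
      = (whitenedRange Sig X).starProjection
        ((whitenedRange Sig X').starProjection (whiten Sig v)) :=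
    (congrArg (fun f => f (whiten Sig v))
      (Submodule.starProjection_comp_starProjection_of_le hle)).symm
  rw [h1]
  exact Submodule.norm_starProjection_apply_le _ _

/-- The design matrices of the first `k` regressors, for deterministic regressors `z`. -/
def detDesign (z : ℕ × ℕ → ℝ) (n k : ℕ) : Matrix (Fin n) (Fin k) ℝ :=
  Matrix.of fun t j => z ((t : ℕ), (j : ℕ))

theorem whitenedRange_detDesign_mono (Sig : Matrix (Fin n) (Fin n) ℝ) (z : ℕ × ℕ → ℝ) {l : ℕ}
    (hkl : k ≤ l) :
    whitenedRange Sig (detDesign z n k) ≤ whitenedRange Sig (detDesign z n l) := by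
  rintro _ ⟨v, rfl⟩
  refine ⟨fun j => if h : (j : ℕ) < k then v ⟨j, h⟩ else 0, ?_⟩
  simp only [LinearMap.comp_apply, mulVecLin_apply]
  congr 1
  ext t
  simp only [mulVec, dotProduct, detDesign, of_apply]
  have h1 : ∀ f : ℕ → ℝ, ∑ j : Fin k, f j * v j
      = ∑ j ∈ Finset.range k, f j * if h : j < k then v ⟨j, h⟩ else 0 := by
    intro f
    rw [Finset.sum_range]
    exact Finset.sum_congr rfl fun j _ => by simp
  have h2 : ∀ f : ℕ → ℝ, ∑ j : Fin l, f j * (if h : (j : ℕ) < k then v ⟨j, h⟩ else 0)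
      = ∑ j ∈ Finset.range l, f j * if h : j < k then v ⟨j, h⟩ else 0 := by
    intro f
    rw [Finset.sum_range]
  rw [h1 fun j => z (t, j), h2 fun j => z (t, j)]
  refine (Finset.sum_subset (Finset.range_mono hkl) fun j _ hj => ?_).symm
  rw [dif_neg (by simpa using hj), mul_zero]

/-- For designs in which all candidate models have a large risk, the noise behaves regularly in
all candidate models with high probability. -/
theorem exists_fixed_design_bound (hq : HasQuadFormBound P e A) (hA : 0 ≤ A)
    (he : ∀ t, Measurable (e t)) (hb : ∀ n, HasSpectralBounds (errorCov P e n) c C) {ε ρ : ℝ}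
    (hε : 0 < ε) (hρ : 0 < ρ) :
    ∃ K : ℝ, 1 ≤ K ∧ ∀ (n M : ℕ) (κ : Fin M → ℕ) (z : ℕ × ℕ → ℝ) (μ : Fin n → ℝ), StrictMono κ →
      (∀ m, 1 ≤ κ m) → (∀ m, (detDesign z n (κ m)).rank = κ m) →
      (∀ m, K ≤ modelRisk (errorCov P e n) (detDesign z n (κ m)) μ) →
      P {ω | ∃ m, ε * modelRisk (errorCov P e n) (detDesign z n (κ m)) μ
            < |quadForm (projForm (errorCov P e n) (detDesign z n (κ m)))
                (fun t => e (t : ℕ) ω) - κ m| ∨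
          ε * modelRisk (errorCov P e n) (detDesign z n (κ m)) μ
            < |(((errorCov P e n)⁻¹ - projForm (errorCov P e n) (detDesign z n (κ m))) *ᵥ μ)
                ⬝ᵥ (fun t => e (t : ℕ) ω)|} ≤ ENNReal.ofReal ρ := by
  -- The sum of the constants of the two union bounds. The threshold `K` depends on neither `n`, the
  -- models nor the regressors, as needed for integrating over random designs.
  set B := 24 * (A * c⁻¹) ^ 2 / ε ^ 2 + (A * c⁻¹ + 1) ^ 2 / ε ^ 4 with hB
  have hlim : Tendsto (fun K => B * blockSum K) atTop (𝓝 0) := by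
    simpa using tendsto_blockSum.const_mul B
  obtain ⟨K, hK1, hK2, hK3⟩ := ((eventually_ge_atTop 1).and
    ((eventually_ge_atTop (16 / ε ^ 2)).and (hlim.eventually (ge_mem_nhds hρ)))).exists
  rw [div_le_iff₀' (by positivity)] at hK2
  refine ⟨K, hK1, fun n M κ z μ hκ hκ1 hX hKD => ?_⟩
  set Sig := errorCov P e n with hSig
  set D : Fin M → ℝ := fun m => modelRisk Sig (detDesign z n (κ m)) μ with hD
  have hDeq : ∀ m, D m = quadForm (Sig⁻¹ - projForm Sig (detDesign z n (κ m))) μ + κ m :=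
    fun m => (hb n).modelRisk_eq _ _
  have hbias0 : ∀ m, 0 ≤ quadForm (Sig⁻¹ - projForm Sig (detDesign z n (κ m))) μ := fun m => by
    rw [← (hb n).norm_sub_starProjection_sq (hX m)]; positivity
  have hκD : ∀ m, (κ m : ℝ) ≤ D m := fun m => by rw [hDeq]; linarith [hbias0 m]
  have hD0 : ∀ m, 0 < D m := fun m => by have := hKD m; simp only [hD]; linarith
  have h1 := measure_exists_lt_abs_sub_le (P := P) (K := K) (D := D) hκ hκ1
    (T := fun m ω => quadForm (projForm Sig (detDesign z n (κ m))) (fun t => e (t : ℕ) ω))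
    (fun ω a b hab => quadForm_projForm_mono (hb n) (hX a) (hX b)
      (whitenedRange_detDesign_mono Sig z (hκ.monotone hab)) _)
    (sq_nonneg (A * c⁻¹))
    (fun m t ht => measure_lt_abs_projForm_sub_le hq hA he (hb n) (hX m) ht) hε hK1 hK2 hκD hKD
  have h2 := measure_exists_le_of_forall_le (P := P) hκ (D := D) (K := K)
    (A := (A * c⁻¹ + 1) ^ 2 / ε ^ 4) (by positivity) hK1 hκD hKD
    (fun m => measure_lt_abs_bias_inner_le hq hA he (hb n) (hX m) μ (hD0 m) hε
      (by rw [hDeq]; linarith [(Nat.cast_nonneg (κ m) : (0 : ℝ) ≤ κ m)]))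
  refine (measure_mono fun ω hω => ?_).trans ((measure_union_le _ _).trans
    ((add_le_add h1 h2).trans ?_))
  · obtain ⟨m, hm | hm⟩ := hω
    · exact Or.inl (Set.mem_iUnion.2 ⟨m, hm⟩)
    · exact Or.inr (Set.mem_iUnion.2 ⟨m, hm⟩)
  · have hΨ : 0 ≤ blockSum K := tsum_nonneg fun j => by positivity
    rw [← ENNReal.ofReal_add (by positivity) (by positivity), ← add_mul]
    exact ENNReal.ofReal_le_ofReal hK3

end FixedDesign

/-! ### Uniform bounds over the candidate models: random designs -/

section RandomDesign

open Matrix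

/-- A matrix-valued function with measurable entries. -/
def MeasurableEntries {Z ι ι' : Type*} [MeasurableSpace Z] (F : Z → Matrix ι ι' ℝ) : Prop :=
  ∀ i j, Measurable fun z => F z i j

namespace MeasurableEntries

variable {Z ι ι' ι'' : Type*} [MeasurableSpace Z] {F : Z → Matrix ι ι' ℝ}

theorem const (A : Matrix ι ι' ℝ) : MeasurableEntries fun _ : Z => A := fun _ _ =>
  measurable_const

theorem transpose (hF : MeasurableEntries F) : MeasurableEntries fun z => (F z)ᵀ :=
  fun i j => hF j i

theorem sub {G : Z → Matrix ι ι' ℝ} (hF : MeasurableEntries F) (hG : MeasurableEntries G) :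
    MeasurableEntries fun z => F z - G z := fun i j => (hF i j).sub (hG i j)

theorem mul [Fintype ι'] {G : Z → Matrix ι' ι'' ℝ} (hF : MeasurableEntries F)
    (hG : MeasurableEntries G) : MeasurableEntries fun z => F z * G z := fun i j => by
  simp only [Matrix.mul_apply]
  exact Finset.measurable_fun_sum _ fun l _ => (hF i l).mul (hG l j)

theorem det [Fintype ι] [DecidableEq ι] {G : Z → Matrix ι ι ℝ} (hG : MeasurableEntries G) :
    Measurable fun z => (G z).det := by
  simp only [Matrix.det_apply']
  exact Finset.measurable_fun_sum _ fun s _ =>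
    (Finset.measurable_fun_prod _ fun i _ => hG _ _).const_mul _

theorem inv [Fintype ι] [DecidableEq ι] {G : Z → Matrix ι ι ℝ} (hG : MeasurableEntries G) :
    MeasurableEntries fun z => (G z)⁻¹ := fun i j => by
  simp only [Matrix.inv_def, Matrix.smul_apply, Ring.inverse_eq_inv', smul_eq_mul,
    Matrix.adjugate_apply]
  refine hG.det.inv.mul (det fun a b => ?_)
  simp only [Matrix.updateRow_apply]
  split_ifs
  · exact measurable_const
  · exact hG a b

theorem mulVec [Fintype ι'] (hF : MeasurableEntries F) {v : Z → ι' → ℝ}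
    (hv : ∀ i, Measurable fun z => v z i) (i : ι) : Measurable fun z => (F z *ᵥ v z) i := by
  simp only [Matrix.mulVec, dotProduct]
  exact Finset.measurable_fun_sum _ fun l _ => (hF i l).mul (hv l)

theorem dotProduct [Fintype ι] {u v : Z → ι → ℝ} (hu : ∀ i, Measurable fun z => u z i)
    (hv : ∀ i, Measurable fun z => v z i) : Measurable fun z => u z ⬝ᵥ v z :=
  Finset.measurable_fun_sum _ fun l _ => (hu l).mul (hv l)

theorem quadForm {n : ℕ} {G : Z → Matrix (Fin n) (Fin n) ℝ} (hG : MeasurableEntries G)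
    {v : Z → Fin n → ℝ} (hv : ∀ i, Measurable fun z => v z i) :
    Measurable fun z => quadForm (G z) (v z) :=
  dotProduct hv (hG.mulVec hv)

variable {n k : ℕ} {X : Z → Matrix (Fin n) (Fin k) ℝ} (Sig : Matrix (Fin n) (Fin n) ℝ)

theorem projForm (hX : MeasurableEntries X) : MeasurableEntries fun z => projForm Sig (X z) :=
  (const _).mul (((hX.mul ((hX.transpose.mul (const _)).mul hX).inv).mul hX.transpose).mul
    (const _))

theorem modelRisk (hX : MeasurableEntries X) {v : Z → Fin n → ℝ}
    (hv : ∀ i, Measurable fun z => v z i) : Measurable fun z => modelRisk Sig (X z) (v z) := by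
  refine (quadForm (((const _).mul ((const _).sub ?_)).mul (const _)) hv).add_const _
  exact (((((const _).mul hX).mul ((hX.transpose.mul (const _)).mul hX).inv).mul
    hX.transpose).mul (const _))

end MeasurableEntries

theorem measurable_detDesign (n k : ℕ) : MeasurableEntries fun z => detDesign z n k :=
  fun t j => measurable_pi_apply ((t : ℕ), (j : ℕ))

/-- The regression function for deterministic regressors `z`. -/
def detMean (θ : ℕ → ℝ) (n : ℕ) (z : ℕ × ℕ → ℝ) : Fin n → ℝ :=
  fun t => ∑' j : ℕ, θ j * z ((t : ℕ), j)

theorem measurable_detMean (θ : ℕ → ℝ) (n : ℕ) (t : Fin n) :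
    Measurable fun z => detMean θ n z t :=
  Measurable.tsum fun _ => (measurable_pi_apply _).const_mul _

variable {Ω : Type*} [MeasurableSpace Ω] {P : Measure Ω} [IsProbabilityMeasure P]
  {x : ℕ → ℕ → Ω → ℝ} {θ : ℕ → ℝ} {e : ℤ → Ω → ℝ} {A c C : ℝ}

/-- If the candidate models have large risk, then the noise behaves regularly in all of them with
high probability. -/
theorem exists_random_design_bound (hreg : IsRegression P x θ e) (hq : HasQuadFormBound P e A)
    (hA : 0 ≤ A) (he : ∀ t, Measurable (e t))
    (hb : ∀ n, HasSpectralBounds (errorCov P e n) c C) {ε ρ : ℝ} (hε : 0 < ε) (hρ : 0 < ρ) :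
    ∃ K : ℝ, 1 ≤ K ∧ ∀ (n M : ℕ) (κ : Fin M → ℕ), StrictMono κ → (∀ m, 1 ≤ κ m) →
      (∀ᵐ ω ∂P, ∀ m, (designMat x n (κ m) ω).rank = κ m) →
      P {ω | (∀ m, K ≤ modelRisk (errorCov P e n) (designMat x n (κ m) ω) (meanVec x θ n ω)) ∧
        ∃ m, ε * modelRisk (errorCov P e n) (designMat x n (κ m) ω) (meanVec x θ n ω)
            < |quadForm (projForm (errorCov P e n) (designMat x n (κ m) ω))
                (fun t => e (t : ℕ) ω) - κ m| ∨
          ε * modelRisk (errorCov P e n) (designMat x n (κ m) ω) (meanVec x θ n ω)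
            < |(((errorCov P e n)⁻¹ - projForm (errorCov P e n) (designMat x n (κ m) ω)) *ᵥ
                meanVec x θ n ω) ⬝ᵥ (fun t => e (t : ℕ) ω)|} ≤ ENNReal.ofReal ρ := by
  obtain ⟨K, hK1, hK⟩ := exists_fixed_design_bound hq hA he hb hε hρ
  refine ⟨K, hK1, fun n M κ hκ hκ1 hrank => ?_⟩
  set Sig := errorCov P e n with hSig
  let E : Ω → Fin n → ℝ := fun ω t => e (t : ℕ) ω
  let X : Ω → ℕ × ℕ → ℝ := fun ω p => x p.1 p.2 ω
  have hE : Measurable E := measurable_pi_lambda _ fun t => he _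
  have hX : Measurable X := measurable_pi_lambda _ fun p => hreg.measurable p.1 p.2
  have hind : IndepFun X E P := by
    have hr : Measurable fun (y : ℤ → ℝ) (t : Fin n) => y (t : ℕ) :=
      measurable_pi_lambda _ fun t => measurable_pi_apply _
    exact (hreg.indep.symm).comp measurable_id hr
  let B : Set ((ℕ × ℕ → ℝ) × (Fin n → ℝ)) :=
    {y | (∀ m, K ≤ modelRisk Sig (detDesign y.1 n (κ m)) (detMean θ n y.1)) ∧
      ∃ m, ε * modelRisk Sig (detDesign y.1 n (κ m)) (detMean θ n y.1)
          < |quadForm (projForm Sig (detDesign y.1 n (κ m))) y.2 - κ m| ∨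
        ε * modelRisk Sig (detDesign y.1 n (κ m)) (detMean θ n y.1)
          < |((Sig⁻¹ - projForm Sig (detDesign y.1 n (κ m))) *ᵥ detMean θ n y.1) ⬝ᵥ y.2|}
  have hBmeas : MeasurableSet B := by
    have hD : ∀ m, MeasurableEntries
        fun y : (ℕ × ℕ → ℝ) × (Fin n → ℝ) => detDesign y.1 n (κ m) :=
      fun m i j => (measurable_detDesign n (κ m) i j).comp measurable_fst
    have hμ : ∀ t, Measurable fun y : (ℕ × ℕ → ℝ) × (Fin n → ℝ) => detMean θ n y.1 t :=
      fun t => (measurable_detMean θ n t).comp measurable_fst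
    have hv : ∀ t, Measurable fun y : (ℕ × ℕ → ℝ) × (Fin n → ℝ) => y.2 t :=
      fun t => (measurable_pi_apply t).comp measurable_snd
    have hR := fun m => (hD m).modelRisk Sig hμ
    have hG := fun m => (hD m).projForm Sig
    refine MeasurableSet.inter ?_ ?_
    · exact measurableSet_setOfPred.2 (Measurable.forall fun m =>
        measurableSet_setOfPred.1 (measurableSet_le measurable_const (hR m)))
    · refine measurableSet_setOfPred.2 (Measurable.exists fun m => Measurable.or ?_ ?_)
      · exact measurableSet_setOfPred.1 (measurableSet_lt ((hR m).const_mul ε)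
          (((hG m).quadForm hv).sub_const _).abs)
      · exact measurableSet_setOfPred.1 (measurableSet_lt ((hR m).const_mul ε)
          (MeasurableEntries.dotProduct
            (((MeasurableEntries.const _).sub (hG m)).mulVec hμ) hv).abs)
  -- Independence makes the joint law a product. Each slice of the bad set at full-rank regressors
  -- is either empty, because some risk is below `K`, or bounded by the fixed design result.
  have hmap := (indepFun_iff_map_prod_eq_prod_map_map hX.aemeasurable hE.aemeasurable).1 hind
  have hslice : ∀ z : ℕ × ℕ → ℝ, (∀ m, (detDesign z n (κ m)).rank = κ m) →
      (P.map E) (Prod.mk z ⁻¹' B) ≤ ENNReal.ofReal ρ := by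
    intro z hz
    rw [Measure.map_apply hE (measurable_prodMk_left hBmeas)]
    by_cases hKz : ∀ m, K ≤ modelRisk Sig (detDesign z n (κ m)) (detMean θ n z)
    · refine (measure_mono fun ω hω => ?_).trans (hK n M κ z (detMean θ n z) hκ hκ1 hz hKz)
      exact hω.2
    · have : E ⁻¹' (Prod.mk z ⁻¹' B) = ∅ := by
        ext ω
        simp only [Set.mem_preimage, Set.mem_empty_iff_false, iff_false]
        exact fun hω => hKz hω.1
      rw [this, measure_empty]
      exact zero_le
  calc P ((fun ω => (X ω, E ω)) ⁻¹' B) = (P.map fun ω => (X ω, E ω)) B :=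
        (Measure.map_apply (hX.prodMk hE) hBmeas).symm
    _ = ∫⁻ z, (P.map E) (Prod.mk z ⁻¹' B) ∂(P.map X) := by
        rw [hmap, Measure.prod_apply hBmeas]
    _ = ∫⁻ ω, (P.map E) (Prod.mk (X ω) ⁻¹' B) ∂P :=
        lintegral_map (measurable_measure_prodMk_left hBmeas) hX
    _ ≤ ∫⁻ _, ENNReal.ofReal ρ ∂P := by
        refine lintegral_mono_ae ?_
        filter_upwards [hrank] with ω hω
        exact hslice (X ω) hω
    _ = ENNReal.ofReal ρ := by simp

end RandomDesign

/-! ### Feasible and infeasible averages -/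

section Assembly

open Matrix RealInnerProductSpace

variable {n M : ℕ} {κ : Fin M → ℕ} {Sig W : Matrix (Fin n) (Fin n) ℝ} {c C : ℝ}

theorem isWeight_of_mem_sparseWeights {N : ℕ} {δ : ℝ} (hδ : 0 < δ) {w : Fin M → ℝ}
    (hw : w ∈ sparseWeights M N δ) : IsWeight δ w := by
  simp only [sparseWeights, Set.mem_iUnion] at hw
  obtain ⟨l, -, h1, -, h3⟩ := hw
  refine ⟨fun i => ?_, h3, fun i hi => (h1 i hi).1⟩
  by_cases h0 : w i = 0
  · rw [h0]
  · exact hδ.le.trans (h1 i h0).1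

theorem whiten_glsAverage_sub (X : (m : Fin M) → Matrix (Fin n) (Fin (κ m)) ℝ)
    (Y μ : Fin n → ℝ) (w : Fin M → ℝ) :
    whiten Sig (glsAverage X W Y w - μ)
      = ∑ m, w m • whiten Sig (glsHat (X m) W *ᵥ Y) - whiten Sig μ := by
  rw [map_sub, glsAverage, Matrix.sum_mulVec, map_sum]
  simp only [Matrix.smul_mulVec, map_smul]

/-- In whitened coordinates the form is `⟪u, (1 + Δ) u⟫ ≥ ‖u‖² / 2`. This makes the feasible Gram
matrices invertible. -/
theorem quadForm_pos_of_norm_whitenedError_le [NeZero n] (hb : HasSpectralBounds Sig c C)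
    (hΔ : ‖whitenedError Sig W‖ ≤ 1 / 2) {v : Fin n → ℝ} (hv : v ≠ 0) : 0 < quadForm W v := by
  have h1 : 0 < ‖whiten Sig v‖ ^ 2 := by
    rw [hb.norm_whiten_sq]
    have := hb.posDef.inv.dotProduct_mulVec_pos hv
    rwa [star_trivial] at this
  have h2 : |⟪whiten Sig v, whitenedError Sig W (whiten Sig v)⟫| ≤ 1 / 2 * ‖whiten Sig v‖ ^ 2 := by
    calc |⟪whiten Sig v, whitenedError Sig W (whiten Sig v)⟫|
        ≤ ‖whiten Sig v‖ * (‖whitenedError Sig W‖ * ‖whiten Sig v‖) :=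
          (abs_real_inner_le_norm _ _).trans (mul_le_mul_of_nonneg_left
            (ContinuousLinearMap.le_opNorm _ _) (norm_nonneg _))
      _ = ‖whitenedError Sig W‖ * ‖whiten Sig v‖ ^ 2 := by ring
      _ ≤ 1 / 2 * ‖whiten Sig v‖ ^ 2 := mul_le_mul_of_nonneg_right hΔ h1.le
  have h3 := hb.inner_whitenedError W v v
  rw [inner_add_right, real_inner_self_eq_norm_sq] at h3
  rw [quadForm, ← h3]
  linarith [(abs_le.1 h2).1]

theorem isRegularAveraging_whiten [NeZero n] (hb : HasSpectralBounds Sig c C)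
    {X : (m : Fin M) → Matrix (Fin n) (Fin (κ m)) ℝ} (hX : ∀ m, (X m).rank = κ m)
    (hmono : Monotone fun m => whitenedRange Sig (X m)) {μ e : Fin n → ℝ} {K ε : ℝ}
    (hε : ε ≤ 1 / 2) (hK : 0 < K) (hKD : ∀ m, K ≤ modelRisk Sig (X m) μ)
    (hsq : ∀ m, |quadForm (projForm Sig (X m)) e - κ m| ≤ ε * modelRisk Sig (X m) μ)
    (hinner : ∀ m, |((Sig⁻¹ - projForm Sig (X m)) *ᵥ μ) ⬝ᵥ e| ≤ ε * modelRisk Sig (X m) μ)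
    (hΔ : ‖whitenedError Sig W‖ ≤ ε) (hΔe : ‖whitenedError Sig W‖ * ‖whiten Sig e‖ ≤ ε * √K) :
    IsRegularAveraging (fun m => whitenedRange Sig (X m)) (whiten Sig μ) (whiten Sig e)
      (fun m => (κ m : ℝ)) (whitenedError Sig W)
      (fun m => whiten Sig (glsHat (X m) W *ᵥ (μ + e))) K ε := by
  have hD : ∀ m, ‖whiten Sig μ - (whitenedRange Sig (X m)).starProjection (whiten Sig μ)‖ ^ 2 + κ m
      = modelRisk Sig (X m) μ := fun m => by
    rw [hb.norm_sub_starProjection_sq (hX m), hb.modelRisk_eq]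
  refine ⟨hmono, hK, fun m => ?_, fun m => Nat.cast_nonneg _, fun m => ?_, fun m => ?_, hΔ, hΔe,
    fun m => ?_, fun m => ?_⟩
  · rw [hD]; exact hKD m
  · rw [hD, hb.norm_starProjection_sq (hX m)]; exact hsq m
  · rw [hD, hb.inner_sub_starProjection (hX m)]; exact hinner m
  · rw [glsHat_mulVec_eq]
    exact LinearMap.mem_range_self (whiten Sig ∘ₗ (X m).mulVecLin) _
  · rintro _ ⟨a, rfl⟩
    have hunit := isUnit_det_gram (hX m) fun v hv =>
      quadForm_pos_of_norm_whitenedError_le hb (hΔ.trans hε) hv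
    rw [← map_add, ← map_sub, LinearMap.comp_apply, hb.inner_whitenedError, mulVecLin_apply,
      ← vecMul_transpose (X m) a, ← dotProduct_mulVec, mulVec_mulVec, mulVec_sub, mulVec_mulVec,
      transpose_mul_mul_glsHat hunit, sub_self, dotProduct_zero]

/-- Deterministic comparison of the feasible average with the best infeasible one. -/
theorem abs_averagingLoss_div_sInf_sub_one_le [NeZero n] (hb : HasSpectralBounds Sig c C)
    {X : (m : Fin M) → Matrix (Fin n) (Fin (κ m)) ℝ} (hX : ∀ m, (X m).rank = κ m)
    (hmono : Monotone fun m => whitenedRange Sig (X m)) {μ e : Fin n → ℝ} {K ε τ : ℝ}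
    (hK : 0 < K) (hKD : ∀ m, K ≤ modelRisk Sig (X m) μ)
    (hsq : ∀ m, |quadForm (projForm Sig (X m)) e - κ m| ≤ ε * modelRisk Sig (X m) μ)
    (hinner : ∀ m, |((Sig⁻¹ - projForm Sig (X m)) *ᵥ μ) ⬝ᵥ e| ≤ ε * modelRisk Sig (X m) μ)
    (hΔ : ‖whitenedError Sig W‖ ≤ ε) (hΔe : ‖whitenedError Sig W‖ * ‖whiten Sig e‖ ≤ ε * √K)
    {N : ℕ} {δ : ℝ} (hδ : 0 < δ) (hδ1 : δ ≤ 1) (hε1 : ε ≤ δ ^ 2 / 10)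
    (hε2 : 66 * ε / δ ^ 2 ≤ τ) (hτ : τ ≤ 1 / 3) {w : Fin M → ℝ}
    (hw : w ∈ sparseWeights M N δ)
    (hmin : IsMinOn (averagingCriterion X W (μ + e)) (sparseWeights M N δ) w) :
    |averagingLoss X Sig⁻¹ W (μ + e) μ w
      / sInf (averagingLoss X Sig⁻¹ Sig⁻¹ (μ + e) μ '' sparseWeights M N δ) - 1| ≤ 5 * τ := by
  have hε12 : ε ≤ 1 / 2 := by
    have := pow_le_one₀ hδ.le hδ1 (n := 2)
    linarith
  have hreg := isRegularAveraging_whiten hb hX hmono hε12 hK hKD hsq hinner hΔ hΔe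
  have hL : ∀ v : Fin M → ℝ, averagingLoss X Sig⁻¹ Sig⁻¹ (μ + e) μ v
      = ‖∑ m, v m • (whitenedRange Sig (X m)).starProjection (whiten Sig μ + whiten Sig e)
          - whiten Sig μ‖ ^ 2 := fun v => by
    rw [averagingLoss, ← hb.norm_whiten_sq, whiten_glsAverage_sub]
    simp only [← map_add, hb.starProjection_whiten (hX _)]
  have hLF : ∀ v : Fin M → ℝ, averagingLoss X Sig⁻¹ W (μ + e) μ v
      = ‖∑ m, v m • whiten Sig (glsHat (X m) W *ᵥ (μ + e)) - whiten Sig μ‖ ^ 2 := fun v => by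
    rw [averagingLoss, ← hb.norm_whiten_sq, whiten_glsAverage_sub]
  have hC : ∀ v : Fin M → ℝ, averagingCriterion X W (μ + e) v
      = ⟪whiten Sig μ + whiten Sig e - ∑ m, v m • whiten Sig (glsHat (X m) W *ᵥ (μ + e)),
          whiten Sig μ + whiten Sig e - ∑ m, v m • whiten Sig (glsHat (X m) W *ᵥ (μ + e))
          + whitenedError Sig W (whiten Sig μ + whiten Sig e
            - ∑ m, v m • whiten Sig (glsHat (X m) W *ᵥ (μ + e)))⟫
        + 2 * ∑ m, v m * (κ m : ℝ) := fun v => by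
    have h1 : whiten Sig μ + whiten Sig e - ∑ m, v m • whiten Sig (glsHat (X m) W *ᵥ (μ + e))
        = whiten Sig (μ + e - glsAverage X W (μ + e) v) := by
      have h2 := whiten_glsAverage_sub (Sig := Sig) (W := W) X (μ + e) 0 v
      rw [map_zero, sub_zero, sub_zero] at h2
      rw [map_sub, map_add, h2]
    rw [h1, hb.inner_whitenedError, averagingCriterion, quadForm]
  refine abs_div_sInf_sub_one_le (C := averagingCriterion X W (μ + e))
    (c := ‖whiten Sig e‖ ^ 2 + ⟪whiten Sig e, whitenedError Sig W (whiten Sig e)⟫) hτ hw hmin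
    ⟨δ ^ 2 / 2 * K, by positivity, fun v hv => ?_⟩ (fun v hv => ?_) fun v hv => ?_
  · rw [hL]
    exact (hreg.loss_bounds _ hδ hδ1 hε1 (isWeight_of_mem_sparseWeights hδ hv)).1
  · rw [hL, hLF]
    exact (hreg.loss_bounds _ hδ hδ1 hε1 (isWeight_of_mem_sparseWeights hδ hv)).2.1.trans
      (mul_le_mul_of_nonneg_right hε2 (sq_nonneg _))
  · rw [hL, hC]
    exact (hreg.loss_bounds _ hδ hδ1 hε1 (isWeight_of_mem_sparseWeights hδ hv)).2.2.trans
      (mul_le_mul_of_nonneg_right hε2 (sq_nonneg _))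

end Assembly

/-! ### Convergence in probability -/

section Convergence

variable {Ω : Type*} [MeasurableSpace Ω] {P : Measure Ω} [IsProbabilityMeasure P]

/-- The indicators tend to zero almost surely, hence so do their integrals. Almost sure assumptions
on `k*` become probability bounds in this way. -/
theorem eventually_measure_le_of_ae_eventually_notMem {s : ℕ → Set Ω}
    (hs : ∀ n, MeasurableSet (s n)) (h : ∀ᵐ ω ∂P, ∀ᶠ n in atTop, ω ∉ s n) {ρ : ℝ} (hρ : 0 < ρ) :
    ∀ᶠ n in atTop, P (s n) ≤ ENNReal.ofReal ρ := by
  have h1 := tendsto_measure_of_ae_tendsto_indicator_of_isFiniteMeasure (μ := P) atTop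
    (MeasurableSet.empty) hs (by
      filter_upwards [h] with ω hω
      filter_upwards [hω] with n hn
      simp [hn])
  rw [measure_empty] at h1
  exact h1.eventually (ge_mem_nhds (ENNReal.ofReal_pos.2 hρ))

omit [IsProbabilityMeasure P] in
theorem measurable_minModelRisk {x : ℕ → ℕ → Ω → ℝ} (hx : ∀ t j, Measurable (x t j)) (θ : ℕ → ℝ)
    (e : ℤ → Ω → ℝ) (M : ℕ → ℕ) (k : (n : ℕ) → Fin (M n) → ℕ) (n : ℕ) :
    Measurable (minModelRisk P x θ e M k n) := by
  refine Measurable.iInf fun m => ?_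
  refine MeasurableEntries.modelRisk _ (X := fun ω => designMat x n (k n m) ω)
    (fun t j => hx t j) fun t => ?_
  exact Measurable.tsum fun j => (hx t j).const_mul _

omit [IsProbabilityMeasure P] in
theorem minModelRisk_le (x : ℕ → ℕ → Ω → ℝ) (θ : ℕ → ℝ) (e : ℤ → Ω → ℝ) (M : ℕ → ℕ)
    (k : (n : ℕ) → Fin (M n) → ℕ) (n : ℕ) (ω : Ω) (m : Fin (M n)) :
    minModelRisk P x θ e M k n ω
      ≤ modelRisk (errorCov P e n) (designMat x n (k n m) ω) (meanVec x θ n ω) :=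
  ciInf_le (Set.finite_range _).bddBelow m

theorem measure_lt_sum_sq_le {e : ℤ → Ω → ℝ} (he : IsCenteredStationary P e) {ρ : ℝ}
    (hρ : 0 < ρ) :
    ∃ B : ℝ, 0 < B ∧ ∀ n : ℕ,
      P {ω | B * n < ∑ t : Fin n, e (t : ℕ) ω ^ 2} ≤ ENNReal.ofReal ρ := by
  set γ := ∫ ω, e 0 ω ^ 2 ∂P with hγ
  have hγ0 : 0 ≤ γ := integral_nonneg fun ω => sq_nonneg _
  refine ⟨(γ + 1) / ρ, by positivity, fun n => ?_⟩
  have hint : ∀ t : Fin n, Integrable (fun ω => e (t : ℕ) ω ^ 2) P := fun t =>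
    (he.memLp _).integrable_sq
  have hmean : ∫ ω, ∑ t : Fin n, e (t : ℕ) ω ^ 2 ∂P = n * γ := by
    rw [integral_finsetSum _ fun t _ => hint t]
    have h1 : ∀ t : Fin n, ∫ ω, e (t : ℕ) ω ^ 2 ∂P = γ := fun t => by
      have := he.cov_shift (t : ℕ) 0 0
      simpa only [add_zero, ← sq] using this
    simp [h1]
  rcases Nat.eq_zero_or_pos n with rfl | hn
  · simp
  have hn0 : (0 : ℝ) < n := by exact_mod_cast hn
  have hB : 0 < (γ + 1) / ρ * n := by positivity
  have h1 := mul_meas_ge_le_integral_of_nonneg (μ := P)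
    (f := fun ω => ∑ t : Fin n, e (t : ℕ) ω ^ 2)
    (.of_forall fun ω => Finset.sum_nonneg fun t _ => sq_nonneg _)
    (integrable_finsetSum _ fun t _ => hint t) ((γ + 1) / ρ * n)
  rw [hmean] at h1
  have h2 : P.real {ω | (γ + 1) / ρ * n ≤ ∑ t : Fin n, e (t : ℕ) ω ^ 2} ≤ ρ := by
    refine le_of_mul_le_mul_left (h1.trans ?_) hB
    have : (γ + 1) / ρ * n * ρ = (γ + 1) * n := by field_simp
    rw [this]
    nlinarith
  calc P {ω | (γ + 1) / ρ * n < ∑ t : Fin n, e (t : ℕ) ω ^ 2}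
      ≤ P {ω | (γ + 1) / ρ * n ≤ ∑ t : Fin n, e (t : ℕ) ω ^ 2} :=
        measure_mono fun ω hω => le_of_lt (Set.mem_ofPred_eq ▸ hω)
    _ ≤ ENNReal.ofReal ρ := by
        rw [← ofReal_measureReal]
        exact ENNReal.ofReal_le_ofReal h2

/-- Once `K n ≥ 1`, the power `K n ^ (1 - 2 * η)` is at most `K n`. -/
theorem eventually_rate_le {b K : ℕ → ℝ} {η : ℝ} (hη0 : 0 < η) (hK : Tendsto K atTop atTop)
    (hrate : Tendsto (fun n => b n ^ 2 / K n ^ (1 - 2 * η)) atTop (𝓝 0)) {r : ℝ} (hr : 0 < r) :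
    ∀ᶠ n in atTop, b n ^ 2 ≤ r * K n := by
  filter_upwards [hK.eventually_ge_atTop 1, hrate.eventually (ge_mem_nhds hr)] with n h1 h2
  have h3 : K n ^ (1 - 2 * η) ≤ K n := by
    have := Real.rpow_le_rpow_of_exponent_le h1 (by linarith : 1 - 2 * η ≤ 1)
    rwa [Real.rpow_one] at this
  have h4 : 0 < K n ^ (1 - 2 * η) := Real.rpow_pos_of_pos (by linarith) _
  rw [div_le_iff₀ h4] at h2
  exact h2.trans (mul_le_mul_of_nonneg_left h3 hr.le)

omit [IsProbabilityMeasure P] in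
theorem hasSpectralBounds_errorCov {e : ℤ → Ω → ℝ} {c C : ℝ} (hc : 0 < c) {n : ℕ}
    (h : ∀ v : Fin n → ℝ, c * (v ⬝ᵥ v) ≤ quadForm (errorCov P e n) v ∧
        quadForm (errorCov P e n) v ≤ C * (v ⬝ᵥ v)) :
    HasSpectralBounds (errorCov P e n) c C := by
  refine ⟨?_, hc, fun v => (h v).1, fun v => (h v).2⟩
  ext s t
  simp only [Matrix.transpose_apply, errorCov, Matrix.of_apply]
  exact integral_congr_ae (.of_forall fun ω => mul_comm _ _)

/-- The estimate of the inverse covariance matrix perturbs the whitened problem only slightly. -/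
theorem norm_whitenedError_bounds {n : ℕ} [NeZero n] {Sig W : Matrix (Fin n) (Fin n) ℝ}
    {c C : ℝ} (hb : HasSpectralBounds Sig c C) {v : Fin n → ℝ} {a b B r ε K : ℝ} (ha : 0 < a)
    (hB : 0 < B) (hε : 0 < ε) (hK : 0 ≤ K)
    (hW : n * spectralNorm2 (W - Sig⁻¹) ^ 2 ≤ a * b ^ 2) (hv : ∑ t, v t ^ 2 ≤ B * n)
    (hbn : b ^ 2 ≤ r * n) (hr : C ^ 2 * a * r ≤ ε ^ 2)
    (hbK : C ^ 2 * c⁻¹ * a * B * b ^ 2 ≤ ε ^ 2 * K) :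
    ‖whitenedError Sig W‖ ≤ ε ∧ ‖whitenedError Sig W‖ * ‖whiten Sig v‖ ≤ ε * √K := by
  set s := spectralNorm2 (W - Sig⁻¹) with hs
  have hs0 : 0 ≤ s := norm_nonneg _
  have hn : (0 : ℝ) < n := Nat.cast_pos.2 (NeZero.pos n)
  have hC := hb.C_pos
  have hc := hb.pos
  have hΔ := hb.norm_whitenedError_le W
  constructor
  · refine hΔ.trans (le_of_sq_le_sq ?_ hε.le)
    refine le_of_mul_le_mul_left ?_ hn
    calc (n : ℝ) * (C * s) ^ 2 = C ^ 2 * (n * s ^ 2) := by ring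
      _ ≤ C ^ 2 * (a * (r * n)) := by
          refine mul_le_mul_of_nonneg_left (hW.trans ?_) (by positivity)
          exact mul_le_mul_of_nonneg_left hbn ha.le
      _ = n * (C ^ 2 * a * r) := by ring
      _ ≤ n * ε ^ 2 := mul_le_mul_of_nonneg_left hr hn.le
  -- The squared noise norm is of order `n`; this factor is exactly the `n` in the rate of the
  -- estimate, which leaves a multiple of `b ^ 2`.
  · refine le_of_sq_le_sq ?_ (by positivity)
    have h1 : ‖whiten Sig v‖ ^ 2 ≤ c⁻¹ * (B * n) := by
      rw [hb.norm_whiten_sq]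
      refine (hb.quadForm_inv_le v).trans (mul_le_mul_of_nonneg_left ?_ (by positivity))
      have : v ⬝ᵥ v = ∑ t, v t ^ 2 := by simp [dotProduct, sq]
      rw [this]
      exact hv
    calc (‖whitenedError Sig W‖ * ‖whiten Sig v‖) ^ 2
        = ‖whitenedError Sig W‖ ^ 2 * ‖whiten Sig v‖ ^ 2 := mul_pow _ _ _
      _ ≤ (C * s) ^ 2 * (c⁻¹ * (B * n)) :=
          mul_le_mul (pow_le_pow_left₀ (norm_nonneg _) hΔ 2) h1 (sq_nonneg _) (sq_nonneg _)
      _ = C ^ 2 * c⁻¹ * B * (n * s ^ 2) := by ring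
      _ ≤ C ^ 2 * c⁻¹ * B * (a * b ^ 2) := mul_le_mul_of_nonneg_left hW (by positivity)
      _ = C ^ 2 * c⁻¹ * a * B * b ^ 2 := by ring
      _ ≤ ε ^ 2 * K := hbK
      _ = (ε * √K) ^ 2 := by rw [mul_pow, Real.sq_sqrt hK]

end Convergence

end

/-! ### Asymptotic efficiency of the feasible average. -/

theorem theorem2 {Ω : Type*} [MeasurableSpace Ω] (P : Measure Ω) [IsProbabilityMeasure P]
    -- the regression model and its errors
    (x : ℕ → ℕ → Ω → ℝ) (θ : ℕ → ℝ) (e α : ℤ → Ω → ℝ) (β : ℕ → ℝ) (σ : ℝ)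
    (ℱ : Filtration ℤ (inferInstance : MeasurableSpace Ω))
    (N : ℕ) (hN : 1 ≤ N) (S : ℝ) (hS : 4 * (N : ℝ) < S)
    (hreg : IsRegression P x θ e)
    (herr : IsLinearErrorProcess P ℱ e α β σ S)
    (hspec : IsSpectrallyRegular σ β)
    -- the candidate models and the weight set
    (M : ℕ → ℕ) (k : (n : ℕ) → Fin (M n) → ℕ)
    (hmodels : IsCandidateFamily P x M k)
    (δ : ℝ) (hδ_pos : 0 < δ) (hδ_lt : δ < 1 / (N : ℝ))
    -- the estimate `W n` of the inverse covariance matrix and its rate of convergence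
    (W : (n : ℕ) → Ω → Matrix (Fin n) (Fin n) ℝ)
    (b : ℕ → ℝ) (hb_pos : ∀ n, 0 < b n)
    (hb_little : b =o[atTop] fun n : ℕ => (n : ℝ) ^ (1 / 2 : ℝ))
    (hW : IsBigOInProbability P
      (fun n ω => (n : ℝ) * spectralNorm2 (W n ω - (errorCov P e n)⁻¹) ^ 2)
      (fun n => b n ^ 2))
    -- the amount of information in the candidate models
    (hk_infty : ∀ᵐ ω ∂P, Tendsto (fun n => minModelRisk P x θ e M k n ω) atTop atTop)
    (η : ℝ) (hη_gt : 2 * (N : ℝ) / S < η) (hη_lt : η < 1 / 2)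
    (hk_rate : ∀ᵐ ω ∂P, Tendsto
      (fun n => b n ^ 2 / minModelRisk P x θ e M k n ω ^ (1 - 2 * η)) atTop (𝓝 0))
    -- a minimizer of the feasible criterion
    (w_hat : (n : ℕ) → Ω → Fin (M n) → ℝ)
    (hw_hat : ∀ᶠ n in atTop, ∀ᵐ ω ∂P, w_hat n ω ∈ sparseWeights (M n) N δ ∧
      IsMinOn (feasibleCriterion x θ e M k W n ω) (sparseWeights (M n) N δ) (w_hat n ω)) :
    TendstoInMeasure P
      (fun n ω => feasibleLoss P x θ e M k W n ω (w_hat n ω) /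
        sInf (infeasibleLoss P x θ e M k n ω '' sparseWeights (M n) N δ))
      atTop (fun _ => 1) := by
  have hN' : (1 : ℝ) ≤ N := by exact_mod_cast hN
  have hS4 : 4 < S := by linarith
  have hη0 : 0 < η := lt_trans (by positivity) hη_gt
  have hδ1 : δ ≤ 1 := hδ_lt.le.trans (by rw [div_le_one (by linarith)]; exact hN')
  obtain ⟨A, hA, hq⟩ := herr.exists_eLpNorm_quadForm_le hS4 hspec.summable_abs
  obtain ⟨c, C, hc, hC, hcC⟩ := exists_quadForm_errorCov_bounds herr hS4 hspec
  have hb : ∀ n, HasSpectralBounds (errorCov P e n) c C :=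
    fun n => hasSpectralBounds_errorCov hc (hcC n)
  rw [tendstoInMeasure_iff_norm]
  intro τ₀ hτ₀
  rw [ENNReal.tendsto_nhds_zero]
  intro ρ' hρ'
  obtain ⟨ρ, hρ, hρle⟩ : ∃ ρ : ℝ, 0 < ρ ∧ ENNReal.ofReal ρ ≤ ρ' := by
    refine ⟨(min ρ' 1).toReal, ENNReal.toReal_pos ?_ ?_, ?_⟩
    · exact (lt_min hρ' zero_lt_one).ne'
    · exact ((min_le_right _ _).trans_lt ENNReal.one_lt_top).ne
    · rw [ENNReal.ofReal_toReal ((min_le_right _ _).trans_lt ENNReal.one_lt_top).ne]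
      exact min_le_left _ _
  -- The deterministic comparison gives an error `5 * τ`, at most `τ₀ / 2`, and requires `τ ≤ 1 /
  -- 3`; `ε` is then chosen to meet its two conditions.
  set τ := min (τ₀ / 10) (1 / 3) with hτ
  have hτ0 : 0 < τ := lt_min (by positivity) (by norm_num)
  set ε := min (δ ^ 2 / 10) (τ * δ ^ 2 / 66) with hε
  have hε0 : 0 < ε := lt_min (by positivity) (by positivity)
  have hε2 : 66 * ε / δ ^ 2 ≤ τ := by
    rw [div_le_iff₀ (by positivity)]
    have : ε ≤ τ * δ ^ 2 / 66 := min_le_right _ _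
    linarith
  obtain ⟨K₁, hK1, hbad⟩ := exists_random_design_bound hreg hq hA herr.stationary.measurable hb
    hε0 (by positivity : 0 < ρ / 4)
  obtain ⟨a₀, ha₀⟩ := hW (ρ / 4) (by positivity)
  set a := max a₀ 1 with ha
  have ha0 : 0 < a := zero_lt_one.trans_le (le_max_right _ _)
  obtain ⟨B, hB, hBn⟩ := measure_lt_sum_sq_le herr.stationary (by positivity : 0 < ρ / 4)
  -- `r` makes `‖Δ‖ ≤ ε` follow from `b n ^ 2 ≤ r * n`; `r'` makes `‖Δ‖ ‖e‖ ≤ ε √k*` follow from `b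
  -- n ^ 2 ≤ r' * k*`.
  set r := ε ^ 2 / (C ^ 2 * a) with hr
  have hr0 : 0 < r := by positivity
  set r' := ε ^ 2 / (C ^ 2 * c⁻¹ * a * B) with hr'
  have hr'0 : 0 < r' := by positivity
  have hKmeas := measurable_minModelRisk (P := P) hreg.measurable θ e M k
  have hrare := eventually_measure_le_of_ae_eventually_notMem (P := P)
    (s := fun n => {ω | minModelRisk P x θ e M k n ω < K₁} ∪
      {ω | r' * minModelRisk P x θ e M k n ω < b n ^ 2})
    (fun n => (measurableSet_lt (hKmeas n) measurable_const).union
      (measurableSet_lt ((hKmeas n).const_mul r') measurable_const))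
    (by
      filter_upwards [hk_infty, hk_rate] with ω h1 h2
      filter_upwards [h1.eventually_ge_atTop K₁, eventually_rate_le hη0 h1 h2 hr'0] with n h3 h4 h5
      rcases h5 with h5 | h5
      · exact h5.not_ge h3
      · exact h5.not_ge h4)
    (by positivity : 0 < ρ / 4)
  have hbr : ∀ᶠ n : ℕ in atTop, b n ^ 2 ≤ r * n := by
    filter_upwards [hb_little.bound (Real.sqrt_pos.2 hr0)] with n hn
    rw [← Real.sqrt_eq_rpow, Real.norm_of_nonneg (hb_pos n).le,
      Real.norm_of_nonneg (Real.sqrt_nonneg _)] at hn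
    calc b n ^ 2 ≤ (√r * √(n : ℝ)) ^ 2 := pow_le_pow_left₀ (hb_pos n).le hn 2
      _ = r * n := by rw [mul_pow, Real.sq_sqrt hr0.le, Real.sq_sqrt (Nat.cast_nonneg n)]
  filter_upwards [hw_hat, hmodels.pos, hmodels.strictMono, hmodels.fullRank, ha₀, hrare, hbr,
    eventually_gt_atTop 0] with n hwn hpos hmono hrank hWn hrn hbn hn
  have : NeZero n := ⟨hn.ne'⟩
  set S₁ := {ω |
    (∀ m, K₁ ≤ modelRisk (errorCov P e n) (designMat x n (k n m) ω) (meanVec x θ n ω)) ∧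
        ∃ m, ε * modelRisk (errorCov P e n) (designMat x n (k n m) ω) (meanVec x θ n ω)
            < |quadForm (projForm (errorCov P e n) (designMat x n (k n m) ω))
                (fun t => e (t : ℕ) ω) - k n m| ∨
          ε * modelRisk (errorCov P e n) (designMat x n (k n m) ω) (meanVec x θ n ω)
            < |(((errorCov P e n)⁻¹ - projForm (errorCov P e n) (designMat x n (k n m) ω)).mulVec
                (meanVec x θ n ω)) ⬝ᵥ (fun t => e (t : ℕ) ω)|} with hS₁
  have hS₁le : P S₁ ≤ ENNReal.ofReal (ρ / 4) := hbad n (M n) (k n) hmono hpos hrank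
  have hle : P {ω | τ₀ ≤ ‖feasibleLoss P x θ e M k W n ω (w_hat n ω) /
        sInf (infeasibleLoss P x θ e M k n ω '' sparseWeights (M n) N δ) - 1‖}
      ≤ P (S₁ ∪ ({ω | minModelRisk P x θ e M k n ω < K₁} ∪
          {ω | r' * minModelRisk P x θ e M k n ω < b n ^ 2}) ∪
        ({ω | a₀ * b n ^ 2 < |n * spectralNorm2 (W n ω - (errorCov P e n)⁻¹) ^ 2|} ∪
          {ω | B * n < ∑ t : Fin n, e (t : ℕ) ω ^ 2})) := by
    -- Full rank and minimality hold only almost surely. Outside the bad events (irregular noise,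
    -- small `k*`, poor estimate, large noise norm), each group costing at most `ρ / 4`, the
    -- comparison is deterministic.
    refine measure_mono_ae ?_
    filter_upwards [hwn, hrank] with ω hwω hrω hτω
    by_contra hnot
    have hnot' : ω ∉ S₁ ∪ ({ω | minModelRisk P x θ e M k n ω < K₁} ∪
          {ω | r' * minModelRisk P x θ e M k n ω < b n ^ 2}) ∪
        ({ω | a₀ * b n ^ 2 < |n * spectralNorm2 (W n ω - (errorCov P e n)⁻¹) ^ 2|} ∪
          {ω | B * n < ∑ t : Fin n, e (t : ℕ) ω ^ 2}) := hnot
    simp only [Set.mem_union, not_or, Set.mem_ofPred_eq, not_lt] at hnot'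
    obtain ⟨⟨hn1, hn2, hn3⟩, hn4, hn5⟩ := hnot'
    set K := minModelRisk P x θ e M k n ω with hK
    have hK0 : 0 < K := zero_lt_one.trans_le (hK1.trans hn2)
    have hKD := minModelRisk_le (P := P) x θ e M k n ω
    have hgood : ∀ m, ¬ (ε * modelRisk (errorCov P e n) (designMat x n (k n m) ω) (meanVec x θ n ω)
            < |quadForm (projForm (errorCov P e n) (designMat x n (k n m) ω))
                (fun t => e (t : ℕ) ω) - k n m| ∨
          ε * modelRisk (errorCov P e n) (designMat x n (k n m) ω) (meanVec x θ n ω)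
            < |(((errorCov P e n)⁻¹ - projForm (errorCov P e n) (designMat x n (k n m) ω)).mulVec
                (meanVec x θ n ω)) ⬝ᵥ (fun t => e (t : ℕ) ω)|) := fun m hm =>
      hn1 ⟨fun m' => hn2.trans (hKD m'), m, hm⟩
    simp only [not_or, not_lt] at hgood
    obtain ⟨hΔ, hΔe⟩ := norm_whitenedError_bounds (hb n) (W := W n ω) (K := K) (b := b n) (r := r)
      ha0 hB hε0 hK0.le
      ((le_abs_self _).trans (hn4.trans (mul_le_mul_of_nonneg_right (le_max_left _ _)
        (sq_nonneg _)))) hn5 hbn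
      (by rw [hr]; exact (mul_div_cancel₀ _ (by positivity)).le)
      (by
        calc C ^ 2 * c⁻¹ * a * B * b n ^ 2 ≤ C ^ 2 * c⁻¹ * a * B * (r' * K) :=
              mul_le_mul_of_nonneg_left hn3 (by positivity)
          _ = ε ^ 2 * K := by rw [hr']; field_simp)
    have hfin := abs_averagingLoss_div_sInf_sub_one_le (hb n)
      (X := fun m => designMat x n (k n m) ω) hrω
      (fun m m' hm => whitenedRange_detDesign_mono (errorCov P e n) (fun p => x p.1 p.2 ω)
        (hmono.monotone hm))
      hK0 hKD (fun m => (hgood m).1) (fun m => (hgood m).2) hΔ hΔe hδ_pos hδ1 (min_le_left _ _)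
      hε2 (min_le_right _ _) hwω.1 hwω.2
    have h5 : 5 * τ < τ₀ := by
      have : τ ≤ τ₀ / 10 := min_le_left _ _
      linarith
    exact absurd (hτω.trans hfin) (not_le.2 h5)
  refine hle.trans (le_trans ?_ hρle)
  calc _ ≤ (ENNReal.ofReal (ρ / 4) + ENNReal.ofReal (ρ / 4))
        + (ENNReal.ofReal (ρ / 4) + ENNReal.ofReal (ρ / 4)) := by
        refine (measure_union_le _ _).trans (add_le_add ?_ ?_)
        · exact (measure_union_le _ _).trans (add_le_add hS₁le hrn)
        · exact (measure_union_le _ _).trans (add_le_add hWn (hBn n))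
    _ = ENNReal.ofReal ρ := by
        rw [← ENNReal.ofReal_add (by positivity) (by positivity),
          ← ENNReal.ofReal_add (by positivity) (by positivity)]
        congr 1
        ring
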